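/- \textbf{Theorem.} For $N\ge 1$ let $\hat U(N)$ be the set of signatures $\lambda=(\lambda_1\ge\dots\ge\lambda_N)\in\mathbb Z^N$, let $\chi^\lambda(u_1,\dots,u_N)=\det(u_i^{\lambda_j+N-j})_{i,j}/\prod_{i<j}(u_i-u_j)$ be the rational Schur functions (Laurent polynomials), and for $q\in[-1,1]$ let $$m_{N,PP(q)}[\lambda]=\frac1N\sum_{i=1}^N\Big(\prod_{j\ne i}\frac{(\lambda_i-i)-(\lambda_j-j)-q}{(\lambda_i-i)-(\lambda_j-j)}\Big)\,\delta\Big(\frac{\lambda_i+N-i}{N}\Big),$$ a probability measure on $\mathbb R$. For each $N$ let $\varrho(N)$ be a probability measure on $\hat U(N)$ whose Schur generating function $$S_{\varrho(N)}(u)=\sum_{\lambda\in\hat U(N)}\varrho(N)[\lambda]\,\frac{\chi^\lambda(u)}{\chi^\lambda(1^N)}$$ converges uniformly in a neighbourhood of $1^N=(1,\dots,1)$ in $\mathbb C^N$. Assume that there are numbers $a_k,b_k$ such that $$\lim_{N\to\infty}\big(\partial_{i_0}^k\log S_{\varrho(N)}(1^N)-N a_k\big)=b_k,\qquad \lim_{N\to\infty}\partial_{i_1}\cdots\partial_{i_m}\log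 S_{\varrho(N)}(1^N)=0$$ for all $k\ge1$ and all fixed indices $i_0,\dots,i_m$ with $|\{i_1,\dots,i_m\}|\ge2$, and that the power series $\Psi(z)=\sum_{k\ge0}a_k\frac{(z-1)^k}{k!}$ and $\Phi(z)=\sum_{k\ge0}b_k\frac{(z-1)^k}{k!}$ converge in a neighbourhood of $1$ (the values $a_0,b_0$ play no role). For $q\in[-1,1]$ and $P\in\mathbb C[t]$ put $$\varphi^{(q)}_N(P)=\sum_{\lambda}\varrho(N)[\lambda]\int_{\mathbb R}P(t)\,m_{N,PP(q)}[\lambda](dt).$$ Then these series converge absolutely and, for every $q\in[-1,1]$, there is an infinitesimal limit: linear functionals $\varphi_q,\varphi_q'$ on $\mathbb C[t]$ with $$\varphi_q(P)=\lim_{N\to\infty}\varphi^{(q)}_N(P),\qquad \varphi'_q(P)=\lim_{N\to\infty}N\big(\varphi_N^{(q)}(P)-\varphi_q(P)\big)\qquad\text{for all }P\in\mathbb C[t].$$ For every $k\ge0$, $$\varphi_q(t^k)=\sum_{m=0}^k\binom km\frac1{(m+1)!}\frac{d^m}{du^m}\Big(u^{k-q}\,\Psi'(u)^{k-m}\Big)\Big|_{u=1},$$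 $$\varphi_q'(t^k)=\sum_{m=0}^{k-1}\binom k{m+1}\frac1{m!}\frac{d^m}{du^m}\Big(u^{k-q}\Big(\Phi'(u)-\frac{1-q}{2u}\Big)\Psi'(u)^{k-m-1}\Big)\Big|_{u=1}.$$ Moreover, with $\mu^{(q)}_k=\varphi_q(t^k)$ and ${\mu^{(q)}_k}'=\varphi'_q(t^k)$, for all $z\in\mathbb C$ in a neighbourhood of $0$ the following series converge and $$\exp\Big(q\sum_{k\ge0}\mu^{(0)}_kz^{k+1}\Big)\sum_{k\ge0}{\mu_k^{(q)}}'z^{k+1}=\sum_{k\ge0}{\mu_k^{(0)}}'z^{k+1}+\frac q2\sum_{k\ge0}(k+1)\mu_k^{(0)}z^{k+2}.$$ -/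

import Mathlib

open Filter Topology Polynomial

/-! ### Rational Schur functions -/

/-- The Vandermonde product `∏_{i<j} (X_i - X_j)`. -/
noncomputable def vandermondePoly (N : ℕ) : MvPolynomial (Fin N) ℂ :=
  ∏ p : Fin N × Fin N with p.1 < p.2, (MvPolynomial.X p.1 - MvPolynomial.X p.2)

/-- The alternant `det (X_i ^ {e_j})`. -/
noncomputable def alternant {N : ℕ} (e : Fin N → ℕ) : MvPolynomial (Fin N) ℂ :=
  Matrix.det (Matrix.of fun i j => (MvPolynomial.X i : MvPolynomial (Fin N) ℂ) ^ e j)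

theorem X_sub_X_dvd_alternant {N : ℕ} (e : Fin N → ℕ) {i j : Fin N} (h : i ≠ j) :
    (MvPolynomial.X i - MvPolynomial.X j : MvPolynomial (Fin N) ℂ) ∣ alternant e := by
  rw [← Ideal.mem_span_singleton, ← Ideal.Quotient.eq_zero_iff_mem, alternant, RingHom.map_det]
  refine Matrix.det_zero_of_row_eq h ?_
  ext k
  have hx : Ideal.Quotient.mk (Ideal.span {(MvPolynomial.X i - MvPolynomial.X j :
      MvPolynomial (Fin N) ℂ)}) (MvPolynomial.X i) = Ideal.Quotient.mk _ (MvPolynomial.X j) :=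
    Ideal.Quotient.eq.2 (Ideal.mem_span_singleton_self _)
  simp [hx]

theorem irreducible_X_sub_X {N : ℕ} {i j : Fin N} (h : i ≠ j) :
    Irreducible (MvPolynomial.X i - MvPolynomial.X j : MvPolynomial (Fin N) ℂ) := by
  classical
  have hc : MvPolynomial.coeff (Finsupp.single i 1)
      (MvPolynomial.X i - MvPolynomial.X j : MvPolynomial (Fin N) ℂ) = 1 := by
    rw [MvPolynomial.coeff_sub, MvPolynomial.coeff_X, MvPolynomial.coeff_X, if_pos rfl,
      if_neg (fun h' => h ((Finsupp.single_left_injective one_ne_zero h').symm)), sub_zero]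
  refine MvPolynomial.irreducible_of_totalDegree_eq_one (le_antisymm ?_ ?_) fun x hx =>
    isUnit_of_dvd_one (hc ▸ hx (Finsupp.single i 1))
  · refine (MvPolynomial.totalDegree_sub _ _).trans ?_
    simp [MvPolynomial.totalDegree_X]
  · have := MvPolynomial.le_totalDegree (MvPolynomial.mem_support_iff.2 (hc ▸ one_ne_zero))
    simpa using this

theorem vandermondePoly_dvd_alternant {N : ℕ} (e : Fin N → ℕ) :
    vandermondePoly N ∣ alternant e := by
  refine Finset.prod_dvd_of_isRelPrime ?_ ?_
  · rintro ⟨i, j⟩ hij ⟨k, l⟩ hkl hne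
    simp only [Finset.coe_filter, Finset.mem_univ, true_and, Set.mem_ofPred_eq] at hij hkl
    refine (irreducible_X_sub_X hij.ne).isRelPrime_iff_not_dvd.2 fun hd => ?_
    have key : ∀ t : Fin N, t ≠ i → t ≠ j → (t = k ∨ t = l) → False := by
      intro t hi hj ht
      have h2 := map_dvd (MvPolynomial.eval (Pi.single t (1 : ℂ))) hd
      simp only [map_sub, MvPolynomial.eval_X, Pi.single_eq_of_ne hi.symm,
        Pi.single_eq_of_ne hj.symm, sub_zero, zero_dvd_iff] at h2
      rcases ht with rfl | rfl
      · simp [Pi.single_eq_of_ne hkl.ne'] at h2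
      · simp [Pi.single_eq_of_ne hkl.ne] at h2
    have h1 := key k
    have h2 := key l
    grind
  · rintro ⟨i, j⟩ hij
    simp only [Finset.mem_filter, Finset.mem_univ, true_and] at hij
    exact X_sub_X_dvd_alternant e hij.ne

/-- The polynomial `det (X_i ^ {e_j}) / ∏_{i<j} (X_i - X_j)`. -/
noncomputable def alternantQuotient {N : ℕ} (e : Fin N → ℕ) : MvPolynomial (Fin N) ℂ :=
  (vandermondePoly_dvd_alternant e).choose

theorem vandermondePoly_mul_alternantQuotient {N : ℕ} (e : Fin N → ℕ) :
    vandermondePoly N * alternantQuotient e = alternant e :=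
  (vandermondePoly_dvd_alternant e).choose_spec.symm

/-- Signatures of length `N`: non-increasing `N`-tuples of integers. -/
abbrev Signature (N : ℕ) : Type := {lam : Fin N → ℤ // Antitone lam}

/-- The shifted coordinate `λ_i + N - i` (the index `i` is `0`-based here, whence the `- 1`). -/
def Signature.shifted {N : ℕ} (lam : Signature N) (i : Fin N) : ℤ :=
  lam.1 i + N - 1 - (i : ℕ)

/-- A natural number with `λ_i + offset ≥ 0` for all `i`. -/
def Signature.offset {N : ℕ} (lam : Signature N) : ℕ := ∑ i, (lam.1 i).natAbs

theorem Signature.shifted_add_offset_nonneg {N : ℕ} (lam : Signature N) (i : Fin N) :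
    0 ≤ lam.shifted i + lam.offset := by
  have h : (lam.1 i).natAbs ≤ lam.offset :=
    Finset.single_le_sum (f := fun i => (lam.1 i).natAbs) (fun _ _ => Nat.zero_le _)
      (Finset.mem_univ i)
  unfold Signature.shifted
  omega

/-- The rational Schur function `det (u_i ^ {λ_j + N - j}) / ∏_{i<j} (u_i - u_j)`, as a Laurent
polynomial, so that it is also defined where some of the `u_i` coincide: the exponents are first
raised by a constant, and the factor `∏_i u_i` to that power is then divided out. -/
noncomputable def schurChar {N : ℕ} (lam : Signature N) (u : Fin N → ℂ) : ℂ :=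
  MvPolynomial.eval u (alternantQuotient fun j => (lam.shifted j + lam.offset).toNat) /
    (∏ i, u i) ^ lam.offset

/-- `schurChar` satisfies the defining formula of the rational Schur function. -/
theorem prod_mul_schurChar {N : ℕ} (lam : Signature N) (u : Fin N → ℂ) (hu : ∀ i, u i ≠ 0) :
    (∏ p : Fin N × Fin N with p.1 < p.2, (u p.1 - u p.2)) * schurChar lam u =
      Matrix.det (Matrix.of fun i j => u i ^ lam.shifted j) := by
  have h := congrArg (MvPolynomial.eval u)
    (vandermondePoly_mul_alternantQuotient fun j => (lam.shifted j + lam.offset).toNat)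
  have h0 : (∏ i, u i) ^ lam.offset ≠ 0 := pow_ne_zero _ (Finset.prod_ne_zero_iff.2 fun i _ => hu i)
  have hV : MvPolynomial.eval u (vandermondePoly N) =
      ∏ p : Fin N × Fin N with p.1 < p.2, (u p.1 - u p.2) := by
    simp [vandermondePoly, map_prod]
  rw [map_mul, hV] at h
  rw [schurChar, mul_div_assoc', h, div_eq_iff h0, alternant, RingHom.map_det, ← Finset.prod_pow,
    mul_comm, ← Matrix.det_mul_column]
  congr 1
  ext i j
  have : (((lam.shifted j + lam.offset).toNat : ℕ) : ℤ) = lam.shifted j + lam.offset :=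
    Int.toNat_of_nonneg (lam.shifted_add_offset_nonneg j)
  simp only [RingHom.mapMatrix_apply, Matrix.map_apply, Matrix.of_apply, map_pow,
    MvPolynomial.eval_X]
  rw [← zpow_natCast, this, zpow_add₀ (hu i), zpow_natCast, mul_comm]

/-! ### Schur generating functions -/

/-- The summand `ρ[λ] χ^λ(u) / χ^λ(1^N)` of the Schur generating function. -/
noncomputable def schurTerm {N : ℕ} (ρ : PMF (Signature N)) (lam : Signature N)
    (u : Fin N → ℂ) : ℂ :=
  ((ρ lam).toReal : ℂ) * (schurChar lam u / schurChar lam 1)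

/-- The Schur generating function `S_ρ`. -/
noncomputable def schurGen {N : ℕ} (ρ : PMF (Signature N)) (u : Fin N → ℂ) : ℂ :=
  ∑' lam, schurTerm ρ lam u

/-- The series defining `S_ρ` converges uniformly in a (complex) neighbourhood of `1^N`. -/
def SchurGenConverges {N : ℕ} (ρ : PMF (Signature N)) : Prop :=
  ∃ U ∈ 𝓝 (1 : Fin N → ℂ), SummableUniformlyOn (schurTerm ρ) U

/-- The direction of the coordinate `i` in `ℂ^N` (`0` if there is no such coordinate). -/
def coordDir (N i : ℕ) : Fin N → ℂ := fun j => if (j : ℕ) = i then 1 else 0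

/-- The mixed partial derivative `∂_{i_1} ⋯ ∂_{i_m} (log S_ρ) (1^N)`. -/
noncomputable def logSchurDeriv {N m : ℕ} (ρ : PMF (Signature N)) (i : Fin m → ℕ) : ℂ :=
  iteratedFDeriv ℂ m (fun u : Fin N → ℂ => Complex.log (schurGen ρ u)) 1
    fun s => coordDir N (i s)

/-! ### Deformed Perelomov-Popov measures -/

/-- The weight `∏_{j≠i} ((λ_i - i) - (λ_j - j) - q) / ((λ_i - i) - (λ_j - j))`; it is nonnegative
for `q ∈ [-1, 1]`. -/
noncomputable def ppWeight {N : ℕ} (q : ℝ) (lam : Signature N) (i : Fin N) : ℝ :=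
  ∏ j ∈ Finset.univ.erase i,
    ((lam.shifted i : ℝ) - lam.shifted j - q) / ((lam.shifted i : ℝ) - lam.shifted j)

/-- The `q`-deformed Perelomov-Popov measure of a signature, for `q ∈ [-1, 1]`. -/
noncomputable def ppMeasure {N : ℕ} (q : ℝ) (lam : Signature N) : MeasureTheory.Measure ℝ :=
  ∑ i, ENNReal.ofReal (ppWeight q lam i / N) •
    MeasureTheory.Measure.dirac ((lam.shifted i : ℝ) / N)

/-- `∫ P dm` for the `q`-deformed Perelomov-Popov measure `m` of a signature. -/
noncomputable def ppIntegral {N : ℕ} (q : ℝ) (lam : Signature N) (P : ℂ[X]) : ℂ :=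
  ∫ t, P.eval (t : ℂ) ∂(ppMeasure q lam)

/-- The expectation of `∫ P dm` for a random signature with law `ρ`. -/
noncomputable def ppExpect {N : ℕ} (q : ℝ) (ρ : PMF (Signature N)) (P : ℂ[X]) : ℂ :=
  ∑' lam, ((ρ lam).toReal : ℂ) * ppIntegral q lam P

/-- `(ℂ[t], φ, φ')` is the infinitesimal limit of the sequence `φN` of functionals on `ℂ[t]`. -/
def IsInfinitesimalLimit (φN : ℕ → ℂ[X] → ℂ) (φ φ' : ℂ[X] →ₗ[ℂ] ℂ) : Prop :=
  (∀ P, Tendsto (fun N => φN N P) atTop (𝓝 (φ P))) ∧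
    ∀ P, Tendsto (fun N : ℕ => (N : ℂ) * (φN N P - φ P)) atTop (𝓝 (φ' P))

/-! ### The limiting moments -/

/-- The series `∑_k c_k (z - 1)^k / k!`. -/
noncomputable def taylorOne (c : ℕ → ℂ) (z : ℂ) : ℂ := ∑' k : ℕ, c k * (z - 1) ^ k / k.factorial

/-- The series `∑_k c_k (z - 1)^k / k!` converges in a neighbourhood of `1`. -/
def TaylorOneConverges (c : ℕ → ℂ) : Prop :=
  ∀ᶠ z in 𝓝 (1 : ℂ), Summable fun k : ℕ => c k * (z - 1) ^ k / k.factorial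

/-- `∑_{m=0}^k C(k,m) / (m+1)! * (d/du)^m (u^{k-q} Ψ'(u)^{k-m}) |_{u=1}`. -/
noncomputable def limitMoment (Ψ : ℂ → ℂ) (q : ℝ) (k : ℕ) : ℂ :=
  ∑ m ∈ Finset.range (k + 1), (k.choose m : ℂ) / (m + 1).factorial *
    iteratedDeriv m (fun u : ℂ => u ^ ((k : ℂ) - q) * deriv Ψ u ^ (k - m)) 1

/-- `∑_{m=0}^{k-1} C(k,m+1) / m! * (d/du)^m (u^{k-q} (Φ'(u) - (1-q)/(2u)) Ψ'(u)^{k-m-1}) |_{u=1}`. -/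
noncomputable def infinitesimalMoment (Ψ Φ : ℂ → ℂ) (q : ℝ) (k : ℕ) : ℂ :=
  ∑ m ∈ Finset.range k, (k.choose (m + 1) : ℂ) / m.factorial *
    iteratedDeriv m (fun u : ℂ => u ^ ((k : ℂ) - q) * (deriv Φ u - (1 - q) / (2 * u)) *
      deriv Ψ u ^ (k - m - 1)) 1

/-! Write m_i = λ_i + N - i and let V be the Vandermonde product. The proof rests on the operator D
= V⁻¹ ∑_i u_i^{n-q} ∂_i^n V. Since V χ^λ = det(u_i^{m_j}), applying D multiplies by the falling
factorial (m_b)_n and lowers one exponent m_b by q. In the limit u → 1^N the quotient of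
determinants becomes a quotient of Vandermonde determinants in the m_j, which is exactly the
deformed weight (`hasDiffOpValue_schurChar`). Hence the value of D S_ρ at 1^N is the expected n-th
factorial moment of the measure, up to a power of N (`SchurGenConverges.exists_hasSum`). Values at
1^N are limits along a ray of points with distinct coordinates. On symmetric functions they depend
on finitely many derivatives at 1^N, so they commute with the locally uniformly convergent sum over
λ.

For f = ∏ g(u_j), Leibniz' rule turns D f into divided differences over (s+1)-element sets of
variables, whose confluent limits give the explicit `productValue`. If g'/g = Nψ + φ + o(1)
coefficientwise, this has order N^{n+1}. Its 1/N correction comes from φ, from the second term of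
g^{(r)}/g, and from the second term of binom(N, s+1) (`hasExpansion_productValue`).

In general S_ρ = exp(R) ∏ g(u_j), where g is S_ρ along the first axis and all derivatives of R at
1^N of positive order in fixed directions tend to 0. By `exists_symmetric_jet` the jet of exp(R) is
its value plus (derivatives) × ∑_x γ_x ∏_j f_x(u_j), with coefficients γ_x independent of N and of
sum 0. Multiplying g by a fixed f_x with f_x(1) = 1 leaves ψ unchanged, so ∑ γ_x = 0 cancels the
leading term. What remains is o(1)·O(1/N) = o(1/N), so R does not affect the expansion
(`hasExpansion_diffOpValue`). Passing from factorial to ordinary powers adds binom(k,2)/N times the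
value of order k-1, and the total simplifies to the stated formula
(`correctionValue_add_limitValue`).

For the last identity put H(u) = u((u-1)Ψ'(u) + 1) and let v be the local inverse of (u-1)/H(u).
Lagrange inversion gives ∑ μ_k^{(0)} z^{k+1} = log v(z), and the infinitesimal generating function
equals z² v^{-q}(Φ'(v) - (1-q)/(2v)) v'. Multiplication by exp(q log v) removes v^{-q}, and the
terms that depend on q differ by z² q v'/(2v) (`eventually_generating_identity`). -/

/-! ### Taylor series of holomorphic functions -/

/-- The Taylor series of `f` at `c`. -/
noncomputable def taylorAt (c : ℂ) (f : ℂ → ℂ) : PowerSeries ℂ :=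
  PowerSeries.mk fun n => iteratedDeriv n f c / n.factorial

theorem coeff_taylorAt (c : ℂ) (f : ℂ → ℂ) (n : ℕ) :
    PowerSeries.coeff n (taylorAt c f) = iteratedDeriv n f c / n.factorial :=
  PowerSeries.coeff_mk _ _

theorem iteratedDeriv_eq_coeff_taylorAt (c : ℂ) (f : ℂ → ℂ) (n : ℕ) :
    iteratedDeriv n f c = n.factorial * PowerSeries.coeff n (taylorAt c f) := by
  rw [coeff_taylorAt, mul_div_cancel₀]
  exact_mod_cast n.factorial_ne_zero

theorem constantCoeff_taylorAt (c : ℂ) (f : ℂ → ℂ) :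
    PowerSeries.constantCoeff (taylorAt c f) = f c := by
  rw [← PowerSeries.coeff_zero_eq_constantCoeff_apply, coeff_taylorAt]
  simp

theorem taylorAt_congr {c : ℂ} {f g : ℂ → ℂ} (h : f =ᶠ[𝓝 c] g) : taylorAt c f = taylorAt c g := by
  ext n
  rw [coeff_taylorAt, coeff_taylorAt, h.iteratedDeriv_eq]

theorem taylorAt_add {c : ℂ} {f g : ℂ → ℂ} (hf : AnalyticAt ℂ f c) (hg : AnalyticAt ℂ g c) :
    taylorAt c (fun u => f u + g u) = taylorAt c f + taylorAt c g := by
  ext n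
  rw [map_add, coeff_taylorAt, coeff_taylorAt, coeff_taylorAt,
    iteratedDeriv_fun_add hf.contDiffAt hg.contDiffAt, add_div]

theorem taylorAt_sub {c : ℂ} {f g : ℂ → ℂ} (hf : AnalyticAt ℂ f c) (hg : AnalyticAt ℂ g c) :
    taylorAt c (fun u => f u - g u) = taylorAt c f - taylorAt c g := by
  ext n
  rw [map_sub, coeff_taylorAt, coeff_taylorAt, coeff_taylorAt,
    iteratedDeriv_fun_sub hf.contDiffAt hg.contDiffAt, sub_div]

theorem taylorAt_mul {c : ℂ} {f g : ℂ → ℂ} (hf : AnalyticAt ℂ f c) (hg : AnalyticAt ℂ g c) :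
    taylorAt c (fun u => f u * g u) = taylorAt c f * taylorAt c g := by
  ext n
  rw [PowerSeries.coeff_mul, coeff_taylorAt,
    iteratedDeriv_fun_mul hf.contDiffAt hg.contDiffAt,
    Finset.Nat.sum_antidiagonal_eq_sum_range_succ_mk, Finset.sum_div]
  refine Finset.sum_congr rfl fun i hi => ?_
  have hin : i ≤ n := Nat.lt_succ_iff.1 (Finset.mem_range.1 hi)
  rw [coeff_taylorAt, coeff_taylorAt, Nat.cast_choose ℂ hin]
  have h1 : (n.factorial : ℂ) ≠ 0 := by exact_mod_cast n.factorial_ne_zero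
  have h2 : (i.factorial : ℂ) ≠ 0 := by exact_mod_cast i.factorial_ne_zero
  have h3 : ((n - i).factorial : ℂ) ≠ 0 := by exact_mod_cast (n - i).factorial_ne_zero
  field_simp

theorem taylorAt_const (c a : ℂ) : taylorAt c (fun _ => a) = PowerSeries.C a := by
  ext n
  rw [coeff_taylorAt, iteratedDeriv_const, PowerSeries.coeff_C]
  split_ifs with h <;> simp [h]

theorem taylorAt_const_mul {c : ℂ} (a : ℂ) (f : ℂ → ℂ) :
    taylorAt c (fun u => a * f u) = PowerSeries.C a * taylorAt c f := by
  ext n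
  rw [PowerSeries.coeff_C_mul, coeff_taylorAt, coeff_taylorAt, iteratedDeriv_const_mul_field,
    mul_div_assoc]

theorem taylorAt_pow {c : ℂ} {f : ℂ → ℂ} (hf : AnalyticAt ℂ f c) (k : ℕ) :
    taylorAt c (fun u => f u ^ k) = taylorAt c f ^ k := by
  induction k with
  | zero => simpa using taylorAt_const c 1
  | succ k ih =>
    simp only [pow_succ]
    rw [taylorAt_mul (hf.fun_pow k) hf, ih]

theorem taylorAt_deriv (c : ℂ) (f : ℂ → ℂ) :
    taylorAt c (deriv f) = PowerSeries.derivative ℂ (taylorAt c f) := by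
  ext n
  rw [PowerSeries.coeff_derivative, coeff_taylorAt, coeff_taylorAt, ← iteratedDeriv_succ',
    Nat.factorial_succ]
  have h1 : (n.factorial : ℂ) ≠ 0 := by exact_mod_cast n.factorial_ne_zero
  have h2 : (n : ℂ) + 1 ≠ 0 := by exact_mod_cast n.succ_ne_zero
  push_cast
  field_simp

theorem taylorAt_id (c : ℂ) : taylorAt c (fun u => u) = PowerSeries.C c + PowerSeries.X := by
  ext n
  rw [coeff_taylorAt, map_add, PowerSeries.coeff_C, PowerSeries.coeff_X]
  rcases n with _ | _ | n
  · simp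
  · simp
  · have : deriv (fun u : ℂ => u) = fun _ => 1 := by ext; simp
    rw [iteratedDeriv_succ', this, iteratedDeriv_const]
    simp

/-- An analytic function is the sum of its Taylor series. -/
theorem AnalyticAt.eventually_hasSum_taylorAt {c : ℂ} {f : ℂ → ℂ} (hf : AnalyticAt ℂ f c) :
    ∀ᶠ z in 𝓝 (0 : ℂ), HasSum (fun n => PowerSeries.coeff n (taylorAt c f) * z ^ n) (f (c + z)) := by
  obtain ⟨r, hr⟩ := hf.hasFPowerSeriesAt
  filter_upwards [Metric.eball_mem_nhds (0 : ℂ) hr.r_pos] with z hz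
  have := hr.hasSum hz
  simpa [FormalMultilinearSeries.ofScalars_apply_eq, coeff_taylorAt, smul_eq_mul, mul_comm] using this

/-! ### First order expansions in `1 / N` -/

/-- `y N = a + b / N + o(1 / N)`. -/
def HasExpansion (y : ℕ → ℂ) (a b : ℂ) : Prop :=
  Tendsto (fun N : ℕ => (N : ℂ) * (y N - a)) atTop (𝓝 b)

namespace HasExpansion

variable {y y' : ℕ → ℂ} {a b a' b' : ℂ}

theorem tendsto (h : HasExpansion y a b) : Tendsto y atTop (𝓝 a) := by
  have h1 : Tendsto (fun N : ℕ => (N : ℂ)⁻¹ * ((N : ℂ) * (y N - a)) + a) atTop (𝓝 (0 * b + a)) :=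
    (tendsto_inv_atTop_nhds_zero_nat.mul h).add_const a
  rw [zero_mul, zero_add] at h1
  refine h1.congr' ?_
  filter_upwards [eventually_gt_atTop 0] with N hN
  have : (N : ℂ) ≠ 0 := by exact_mod_cast hN.ne'
  field_simp
  ring

theorem congr' (h : HasExpansion y a b) (he : y =ᶠ[atTop] y') : HasExpansion y' a b :=
  Tendsto.congr' (he.mono fun N hN => by rw [hN]) h

theorem const (a : ℂ) : HasExpansion (fun _ => a) a 0 := by
  simp [HasExpansion]

theorem add (h : HasExpansion y a b) (h' : HasExpansion y' a' b') :
    HasExpansion (fun N => y N + y' N) (a + a') (b + b') :=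
  (Tendsto.add h h').congr fun N => by ring

theorem mul (h : HasExpansion y a b) (h' : HasExpansion y' a' b') :
    HasExpansion (fun N => y N * y' N) (a * a') (a * b' + b * a') := by
  -- N(yy' - aa') = a·N(y' - a') + N(y - a)·y', where y' → a'.
  have := ((h'.const_mul a)).add (Tendsto.mul h h'.tendsto)
  exact this.congr fun N => by ring

theorem const_mul (c : ℂ) (h : HasExpansion y a b) :
    HasExpansion (fun N => c * y N) (c * a) (c * b) := by
  simpa using (const c).mul h

theorem sum {ι : Type*} (s : Finset ι) {y : ι → ℕ → ℂ} {a b : ι → ℂ}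
    (h : ∀ i ∈ s, HasExpansion (y i) (a i) (b i)) :
    HasExpansion (fun N => ∑ i ∈ s, y i N) (∑ i ∈ s, a i) (∑ i ∈ s, b i) := by
  refine (tendsto_finsetSum s h).congr fun N => ?_
  rw [← Finset.sum_sub_distrib, Finset.mul_sum]

theorem inv : HasExpansion (fun N => (N : ℂ)⁻¹) 0 1 := by
  refine tendsto_const_nhds.congr' ?_
  filter_upwards [eventually_gt_atTop 0] with N hN
  have : (N : ℂ) ≠ 0 := by exact_mod_cast hN.ne'
  simp [this]

theorem inv_mul (h : HasExpansion y a b) : HasExpansion (fun N => (N : ℂ)⁻¹ * y N) 0 a := by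
  simpa using inv.mul h

/-- binom(N, s+1) N^{-(s+1)} is 1/(s+1)! times ∏_{i ≤ s} (1 - i/N), so the 1/N coefficient is -(0 +
1 + ⋯ + s)/(s+1)! = -s/(2·s!). -/
theorem choose (s : ℕ) : HasExpansion (fun N => (N.choose (s + 1) : ℂ) * ((N : ℂ)⁻¹) ^ (s + 1))
    (1 / (s + 1).factorial) (-(s / (2 * s.factorial))) := by
  induction s with
  | zero =>
    refine ((const 1).congr' ?_).congr' (EventuallyEq.refl _ _) |> fun h => by simpa using h
    filter_upwards [eventually_gt_atTop 0] with N hN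
    have : (N : ℂ) ≠ 0 := by exact_mod_cast hN.ne'
    simp [this]
  | succ s ih =>
    -- The quotient of two consecutive normalized binomials is (1 - (s+1)/N)/(s+2).
    have h1 : HasExpansion (fun N => 1 / ((s : ℂ) + 2) * (1 + (-((s : ℂ) + 1)) * (N : ℂ)⁻¹))
        (1 / ((s : ℂ) + 2) * (1 + (-((s : ℂ) + 1)) * 0))
        (1 / ((s : ℂ) + 2) * (0 + (-((s : ℂ) + 1)) * 1)) :=
      ((const 1).add (inv.const_mul _)).const_mul _
    have h2 := ih.mul h1
    have hs : (s : ℂ) + 2 ≠ 0 := by exact_mod_cast (s + 1).succ_ne_zero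
    have hs' : (s : ℂ) + 1 ≠ 0 := by exact_mod_cast s.succ_ne_zero
    have hf : (s.factorial : ℂ) ≠ 0 := by exact_mod_cast s.factorial_ne_zero
    have h3 := h2.congr' (y' := fun N =>
        (N.choose (s + 1 + 1) : ℂ) * ((N : ℂ)⁻¹) ^ (s + 1 + 1)) (by
      filter_upwards [eventually_gt_atTop (s + 1)] with N hN
      have hN0 : (N : ℂ) ≠ 0 := by exact_mod_cast (by omega : N ≠ 0)
      have hc := Nat.choose_succ_right_eq N (s + 1)
      have hc' : (N.choose (s + 1 + 1) : ℂ) * ((s : ℂ) + 2) = N.choose (s + 1) * (N - (s + 1)) := by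
        have := congrArg (Nat.cast : ℕ → ℂ) hc
        push_cast [Nat.cast_sub hN.le] at this
        rw [← this]; ring
      have : (N.choose (s + 1 + 1) : ℂ) = N.choose (s + 1) * (N - (s + 1)) / (s + 2) := by
        rw [eq_div_iff hs, hc']
      simp only [this]
      have hi : (N : ℂ)⁻¹ ^ (s + 1 + 1) = (N : ℂ)⁻¹ ^ (s + 1) * (N : ℂ)⁻¹ := pow_succ _ _
      rw [hi]
      field_simp
      ring)
    convert h3 using 1
    · rw [Nat.factorial_succ (s + 1)]
      push_cast
      have : ((s + 1).factorial : ℂ) ≠ 0 := by exact_mod_cast (s + 1).factorial_ne_zero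
      have hs2 : (s : ℂ) + 1 + 1 ≠ 0 := by
        rw [add_assoc, one_add_one_eq_two]
        exact hs
      field_simp
      ring
    · rw [Nat.factorial_succ s]
      push_cast
      field_simp
      ring

end HasExpansion

/-- A coefficientwise first order expansion of power series. -/
def SeriesExpansion (Y : ℕ → PowerSeries ℂ) (A B : PowerSeries ℂ) : Prop :=
  ∀ j, HasExpansion (fun N => PowerSeries.coeff j (Y N)) (PowerSeries.coeff j A)
    (PowerSeries.coeff j B)

namespace SeriesExpansion

variable {Y Y' : ℕ → PowerSeries ℂ} {A B A' B' : PowerSeries ℂ}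

theorem congr' (h : SeriesExpansion Y A B) (he : Y =ᶠ[atTop] Y') : SeriesExpansion Y' A B :=
  fun j => (h j).congr' (he.mono fun N hN => by simp only [hN])

theorem const (A : PowerSeries ℂ) : SeriesExpansion (fun _ => A) A 0 := fun j => by
  simpa using HasExpansion.const _

theorem add (h : SeriesExpansion Y A B) (h' : SeriesExpansion Y' A' B') :
    SeriesExpansion (fun N => Y N + Y' N) (A + A') (B + B') := fun j => by
  simpa using (h j).add (h' j)

theorem mul (h : SeriesExpansion Y A B) (h' : SeriesExpansion Y' A' B') :
    SeriesExpansion (fun N => Y N * Y' N) (A * A') (A * B' + B * A') := fun j => by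
  simp only [PowerSeries.coeff_mul, map_add, ← Finset.sum_add_distrib]
  exact HasExpansion.sum _ fun p _ => (h p.1).mul (h' p.2)

theorem derivative (h : SeriesExpansion Y A B) :
    SeriesExpansion (fun N => PowerSeries.derivative ℂ (Y N)) (PowerSeries.derivative ℂ A)
      (PowerSeries.derivative ℂ B) := fun j => by
  simp only [PowerSeries.coeff_derivative]
  simpa [mul_comm] using (h (j + 1)).const_mul ((j : ℂ) + 1)

theorem inv_mul (h : SeriesExpansion Y A B) :
    SeriesExpansion (fun N => PowerSeries.C ((N : ℂ)⁻¹) * Y N) 0 A := fun j => by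
  simpa [PowerSeries.coeff_C_mul] using (h j).inv_mul

end SeriesExpansion

/-! ### The value of the difference operators on multiplicative functions -/

/-- The value at `1^N` of the operator `V⁻¹ ∑ᵢ uᵢ^(n-q) ∂ᵢⁿ V` on the function `∏ⱼ g(uⱼ)`, where
`V` is the Vandermonde product and `g 1 = 1`. -/
noncomputable def productValue (N n : ℕ) (q : ℂ) (g : ℂ → ℂ) : ℂ :=
  ∑ s ∈ Finset.range (n + 1), (n.choose s : ℂ) * N.choose (s + 1) *
    iteratedDeriv s (fun u => u ^ ((n : ℂ) - q) * (iteratedDeriv (n - s) g u / g u)) 1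

theorem analyticAt_iteratedDeriv {g : ℂ → ℂ} {c : ℂ} (hg : AnalyticAt ℂ g c) (r : ℕ) :
    AnalyticAt ℂ (iteratedDeriv r g) c := by
  rw [iteratedDeriv_eq_iterate]
  exact hg.iterated_deriv r

/-- The quotient rule for G_r = g^{(r)}/g reads G_{r+1} = G_r' + G_1 G_r, so every G_r is governed
by the logarithmic derivative G_1 alone. -/
theorem taylorAt_iteratedDeriv_div {g : ℂ → ℂ} {c : ℂ} (hg : AnalyticAt ℂ g c) (h0 : g c ≠ 0)
    (r : ℕ) :
    taylorAt c (fun u => iteratedDeriv (r + 1) g u / g u) =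
      PowerSeries.derivative ℂ (taylorAt c fun u => iteratedDeriv r g u / g u) +
        taylorAt c (fun u => deriv g u / g u) * taylorAt c fun u => iteratedDeriv r g u / g u := by
  have hr := analyticAt_iteratedDeriv hg r
  rw [← taylorAt_deriv, ← taylorAt_mul (hg.deriv.fun_div hg h0) (hr.fun_div hg h0),
    ← taylorAt_add (hr.fun_div hg h0).deriv ((hg.deriv.fun_div hg h0).fun_mul (hr.fun_div hg h0))]
  refine taylorAt_congr ?_
  filter_upwards [hg.eventually_analyticAt, hr.eventually_analyticAt,
    hg.continuousAt.eventually_ne h0] with u hu hu' hu0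
  rw [deriv_fun_div hu'.differentiableAt hu.differentiableAt hu0, iteratedDeriv_succ]
  field_simp
  ring

/-- The limit of `N^(-n-1) * productValue N n`, in terms of the limit `ψ` of `N⁻¹ (log g)'`. -/
noncomputable def limitValue (n : ℕ) (q : ℂ) (ψ : PowerSeries ℂ) : ℂ :=
  ∑ s ∈ Finset.range (n + 1), (n.choose s : ℂ) / (s + 1).factorial *
    (s.factorial * PowerSeries.coeff s (taylorAt 1 (fun u => u ^ ((n : ℂ) - q)) * ψ ^ (n - s)))

/-- The coefficient of `1 / N` in `N^(-n-1) * productValue N n`. -/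
noncomputable def correctionValue (n : ℕ) (q : ℂ) (ψ φ : PowerSeries ℂ) : ℂ :=
  ∑ s ∈ Finset.range (n + 1), (n.choose s : ℂ) *
    ((1 / (s + 1).factorial) * (s.factorial * PowerSeries.coeff s
      (taylorAt 1 (fun u => u ^ ((n : ℂ) - q)) * (((n - s : ℕ) : PowerSeries ℂ) * ψ ^ (n - s - 1) * φ +
        (((n - s).choose 2 : ℕ) : PowerSeries ℂ) * ψ ^ (n - s - 2) * PowerSeries.derivative ℂ ψ))) +
      (-(s / (2 * s.factorial))) *
        (s.factorial * PowerSeries.coeff s (taylorAt 1 (fun u => u ^ ((n : ℂ) - q)) * ψ ^ (n - s))))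

/-- In G_{r+1} = G_r' + G_1 G_r the term G_r' is smaller by one power of N. It contributes (ψ^r)' =
r ψ^{r-1} ψ' to the 1/N coefficient only, and these contributions accumulate to binom(r,2) ψ^{r-2}
ψ'. -/
theorem seriesExpansion_iteratedDeriv_div {g : ℕ → ℂ → ℂ} {ψ φ : PowerSeries ℂ}
    (hg : ∀ᶠ N in atTop, AnalyticAt ℂ (g N) 1) (h1 : ∀ᶠ N in atTop, g N 1 = 1)
    (h : SeriesExpansion (fun N => PowerSeries.C ((N : ℂ)⁻¹) *
      taylorAt 1 fun u => deriv (g N) u / g N u) ψ φ) (r : ℕ) :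
    SeriesExpansion (fun N => PowerSeries.C (((N : ℂ)⁻¹) ^ r) *
      taylorAt 1 fun u => iteratedDeriv r (g N) u / g N u) (ψ ^ r)
      ((r : PowerSeries ℂ) * ψ ^ (r - 1) * φ + ((r.choose 2 : ℕ) : PowerSeries ℂ) * ψ ^ (r - 2) * PowerSeries.derivative ℂ ψ) := by
  induction r with
  | zero =>
    have : SeriesExpansion (fun _ => (1 : PowerSeries ℂ)) 1 0 := SeriesExpansion.const 1
    simp only [pow_zero, Nat.cast_zero, zero_mul, Nat.choose_zero_succ, add_zero]
    refine this.congr' ?_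
    filter_upwards [hg, h1] with N hN hN1
    have : taylorAt 1 (fun u => iteratedDeriv 0 (g N) u / g N u) = taylorAt 1 fun _ => 1 := by
      refine taylorAt_congr ?_
      filter_upwards [hN.continuousAt.eventually_ne (by rw [hN1]; exact one_ne_zero)] with u hu
      rw [iteratedDeriv_zero, div_self hu]
    rw [this, taylorAt_const, map_one, one_mul]
  | succ r ih =>
    have h2 := (ih.derivative.inv_mul).add (h.mul ih)
    have h3 := h2.congr' (Y' := fun N => PowerSeries.C (((N : ℂ)⁻¹) ^ (r + 1)) *
        taylorAt 1 fun u => iteratedDeriv (r + 1) (g N) u / g N u) (by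
      filter_upwards [hg, h1] with N hN hN1
      rw [taylorAt_iteratedDeriv_div hN (by rw [hN1]; exact one_ne_zero)]
      have hd : ∀ (c : ℂ) (f : PowerSeries ℂ), PowerSeries.derivative ℂ (PowerSeries.C c * f) =
          PowerSeries.C c * PowerSeries.derivative ℂ f := by
        intro c f
        ext n
        simp only [PowerSeries.coeff_derivative, PowerSeries.coeff_C_mul]
        ring
      rw [hd]
      simp only [pow_succ, map_mul]
      ring)
    convert h3 using 1
    · rw [zero_add, pow_succ']
    · rw [Nat.choose_succ_succ' r 1, Nat.choose_one_right]
      -- The truncated exponents r - 1 and r - 2 force the small cases apart; there the binomial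
      -- prefactors vanish or the powers are trivial.
      rcases r with _ | _ | r
      · simp
      · simp
        ring
      · simp only [Derivation.leibniz_pow]
        simp
        ring

/-- The normalization N^{n+1} splits as N^{s+1} for the binomial coefficient and N^{n-s} for the
derivative of order n - s, so every s contributes at leading order. -/
theorem hasExpansion_productValue {g : ℕ → ℂ → ℂ} {ψ φ : PowerSeries ℂ} (n : ℕ) (q : ℂ)
    (hg : ∀ᶠ N in atTop, AnalyticAt ℂ (g N) 1) (h1 : ∀ᶠ N in atTop, g N 1 = 1)
    (h : SeriesExpansion (fun N => PowerSeries.C ((N : ℂ)⁻¹) *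
      taylorAt 1 fun u => deriv (g N) u / g N u) ψ φ) :
    HasExpansion (fun N => ((N : ℂ)⁻¹) ^ (n + 1) * productValue N n q (g N))
      (limitValue n q ψ) (correctionValue n q ψ φ) := by
  have hp : AnalyticAt ℂ (fun u : ℂ => u ^ ((n : ℂ) - q)) 1 :=
    analyticAt_id.cpow analyticAt_const (by simp)
  have key : HasExpansion (fun N => ∑ s ∈ Finset.range (n + 1), (n.choose s : ℂ) *
      (((N.choose (s + 1) : ℂ) * ((N : ℂ)⁻¹) ^ (s + 1)) * (s.factorial * PowerSeries.coeff s
        (taylorAt 1 (fun u => u ^ ((n : ℂ) - q)) * (PowerSeries.C (((N : ℂ)⁻¹) ^ (n - s)) *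
          taylorAt 1 fun u => iteratedDeriv (n - s) (g N) u / g N u))))) _ _ :=
    HasExpansion.sum _ fun s _ => (((HasExpansion.choose s).mul
      ((((SeriesExpansion.const _).mul (seriesExpansion_iteratedDeriv_div hg h1 h (n - s))) s).const_mul
        (s.factorial : ℂ)))).const_mul _
  have key2 := key.congr' (y' := fun N => ((N : ℂ)⁻¹) ^ (n + 1) * productValue N n q (g N)) (by
    filter_upwards [hg, h1] with N hN hN1
    have hN0 : g N 1 ≠ 0 := by rw [hN1]; exact one_ne_zero
    rw [productValue, Finset.mul_sum]
    refine Finset.sum_congr rfl fun s hs => ?_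
    have hsn : s ≤ n := Nat.lt_succ_iff.1 (Finset.mem_range.1 hs)
    rw [iteratedDeriv_eq_coeff_taylorAt,
      taylorAt_mul hp ((analyticAt_iteratedDeriv hN _).fun_div hN hN0), mul_left_comm
      (taylorAt 1 fun u : ℂ => u ^ ((n : ℂ) - q)), PowerSeries.coeff_C_mul]
    have : ((N : ℂ)⁻¹) ^ (n + 1) = ((N : ℂ)⁻¹) ^ (s + 1) * ((N : ℂ)⁻¹) ^ (n - s) := by
      rw [← pow_add]; congr 1; omega
    rw [this]
    ring)
  convert key2 using 1
  · rw [limitValue]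
    refine Finset.sum_congr rfl fun s _ => ?_
    ring
  · rw [correctionValue]
    refine Finset.sum_congr rfl fun s _ => ?_
    simp only [zero_mul, add_zero]

/-! ### The functions `Ψ` and `Φ` -/

theorem hasFPowerSeriesAt_taylorOne {c : ℕ → ℂ} (h : TaylorOneConverges c) :
    HasFPowerSeriesAt (taylorOne c)
      (FormalMultilinearSeries.ofScalars ℂ fun n => c n / n.factorial) 1 := by
  set p := FormalMultilinearSeries.ofScalars ℂ fun n => c n / n.factorial with hp
  have hterm : ∀ (n : ℕ) (z : ℂ), c n * (z - 1) ^ n / n.factorial = p n fun _ => z - 1 := by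
    intro n z
    rw [hp, FormalMultilinearSeries.ofScalars_apply_eq, smul_eq_mul]
    ring
  obtain ⟨r, hr, hball⟩ := Metric.eventually_nhds_iff.1 h
  have hrad : 0 < p.radius := by
    -- Convergence at the single point 1 + r/2 makes the terms tend to 0, which already bounds the
    -- radius of convergence below by r/2.
    have hs : Summable fun k : ℕ => c k * (1 + (r / 2 : ℝ) - 1) ^ k / k.factorial := by
      refine hball (y := 1 + ((r / 2 : ℝ) : ℂ)) ?_
      rw [dist_eq_norm, add_sub_cancel_left, Complex.norm_real, Real.norm_eq_abs,
        abs_of_pos (by positivity)]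
      linarith
    have ht := hs.tendsto_atTop_zero.norm
    rw [norm_zero] at ht
    have : ENNReal.ofNNReal (r / 2).toNNReal ≤ p.radius := by
      refine p.le_radius_of_tendsto (l := 0) (ht.congr fun n => ?_)
      rw [hp, FormalMultilinearSeries.ofScalars_norm]
      rw [Real.coe_toNNReal _ (by positivity)]
      simp [abs_of_pos hr]
      ring
    refine lt_of_lt_of_le ?_ this
    simpa using hr
  have h1 := p.hasFPowerSeriesOnBall hrad
  have h2 := h1.comp_sub 1
  rw [zero_add] at h2
  refine h2.hasFPowerSeriesAt.congr (Eventually.of_forall fun z => ?_)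
  change (∑' n, p n fun _ => z - 1) = _
  exact tsum_congr fun n => (hterm n z).symm

theorem analyticAt_taylorOne {c : ℕ → ℂ} (h : TaylorOneConverges c) :
    AnalyticAt ℂ (taylorOne c) 1 :=
  (hasFPowerSeriesAt_taylorOne h).analyticAt

theorem coeff_taylorAt_taylorOne {c : ℕ → ℂ} (h : TaylorOneConverges c) (n : ℕ) :
    PowerSeries.coeff n (taylorAt 1 (taylorOne c)) = c n / n.factorial := by
  have := (analyticAt_taylorOne h).hasFPowerSeriesAt.eq_formalMultilinearSeries
    (hasFPowerSeriesAt_taylorOne h)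
  have h2 := congrArg (fun p => FormalMultilinearSeries.coeff p n) this
  simpa [FormalMultilinearSeries.coeff_ofScalars, coeff_taylorAt] using h2

/-! ### Formulas for the limiting moments -/

theorem analyticAt_cpow_one (p : ℂ) : AnalyticAt ℂ (fun u : ℂ => u ^ p) 1 :=
  analyticAt_id.cpow analyticAt_const (by simp)

theorem derivative_taylorAt_cpow (p : ℂ) :
    PowerSeries.derivative ℂ (taylorAt 1 fun u : ℂ => u ^ p) =
      PowerSeries.C p * taylorAt 1 fun u : ℂ => u ^ (p - 1) := by
  rw [← taylorAt_deriv, ← taylorAt_const_mul]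
  refine taylorAt_congr ?_
  filter_upwards [(Complex.isOpen_slitPlane.mem_nhds (by simp) : Complex.slitPlane ∈ 𝓝 (1 : ℂ))]
    with u hu
  simpa using ((hasDerivAt_id u).cpow_const (c := p) hu).deriv

theorem limitMoment_eq_limitValue {Ψ : ℂ → ℂ} (hΨ : AnalyticAt ℂ Ψ 1) (q : ℝ) (k : ℕ) :
    limitMoment Ψ q k = limitValue k q (taylorAt 1 (deriv Ψ)) := by
  rw [limitMoment, limitValue]
  refine Finset.sum_congr rfl fun m _ => ?_
  rw [iteratedDeriv_eq_coeff_taylorAt, taylorAt_mul (analyticAt_cpow_one _) (hΨ.deriv.fun_pow _),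
    taylorAt_pow hΨ.deriv]

theorem infinitesimalMoment_eq_sum {Ψ Φ : ℂ → ℂ} (hΨ : AnalyticAt ℂ Ψ 1) (hΦ : AnalyticAt ℂ Φ 1)
    (q : ℝ) (k : ℕ) :
    infinitesimalMoment Ψ Φ q k = ∑ m ∈ Finset.range k, (k.choose (m + 1) : ℂ) *
      (PowerSeries.coeff m (taylorAt 1 (fun u : ℂ => u ^ ((k : ℂ) - q)) * taylorAt 1 (deriv Φ) *
          taylorAt 1 (deriv Ψ) ^ (k - m - 1)) -
        (1 - q) / 2 * PowerSeries.coeff m (taylorAt 1 (fun u : ℂ => u ^ ((k : ℂ) - q - 1)) *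
          taylorAt 1 (deriv Ψ) ^ (k - m - 1))) := by
  rw [infinitesimalMoment]
  refine Finset.sum_congr rfl fun m _ => ?_
  have hf : (m.factorial : ℂ) ≠ 0 := by exact_mod_cast m.factorial_ne_zero
  have e : taylorAt 1 (fun u : ℂ => u ^ ((k : ℂ) - q) * (deriv Φ u - (1 - q) / (2 * u)) *
      deriv Ψ u ^ (k - m - 1)) = taylorAt 1 (fun u : ℂ => u ^ ((k : ℂ) - q) * deriv Φ u *
        deriv Ψ u ^ (k - m - 1) - (1 - q) / 2 * (u ^ ((k : ℂ) - q - 1) *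
          deriv Ψ u ^ (k - m - 1))) := by
    refine taylorAt_congr ?_
    filter_upwards [continuousAt_id.eventually_ne (one_ne_zero (α := ℂ))] with u hu
    have hu' : u ≠ 0 := hu
    rw [Complex.cpow_sub ((k : ℂ) - q) 1 hu', Complex.cpow_one]
    field_simp
  have h1 := (analyticAt_cpow_one ((k : ℂ) - q))
  have h2 := (analyticAt_cpow_one ((k : ℂ) - q - 1))
  have h3 := hΨ.deriv.fun_pow (k - m - 1)
  rw [iteratedDeriv_eq_coeff_taylorAt, e, taylorAt_sub ((h1.fun_mul hΦ.deriv).fun_mul h3)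
    (analyticAt_const.fun_mul (h2.fun_mul h3)), taylorAt_mul (h1.fun_mul hΦ.deriv) h3,
    taylorAt_mul h1 hΦ.deriv, taylorAt_const_mul, taylorAt_mul h2 h3, taylorAt_pow hΨ.deriv,
    map_sub, PowerSeries.coeff_C_mul]
  field_simp

/-- Since binom(k,s) binom(k-s,2)/(s+1) = binom(k,s+1)(k-s-1)/2, the terms with ψ' can be integrated
by parts through (U ψ^{k-s-1})'. The total derivative gives (s+1)/2 times a coefficient of index s +
1, which cancels the terms -s/2 after the shift s → s + 1; only the derivative of U survives. -/
theorem sum_choose_mul_leibniz (k : ℕ) (U U' ψ : PowerSeries ℂ) (p : ℂ)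
    (hU : PowerSeries.derivative ℂ U = PowerSeries.C p * U') :
    ∑ s ∈ Finset.range (k + 1), (k.choose s : ℂ) * (1 / (s + 1) * PowerSeries.coeff s
        (U * ((((k - s).choose 2 : ℕ) : PowerSeries ℂ) * ψ ^ (k - s - 2) *
          PowerSeries.derivative ℂ ψ)) - s / 2 * PowerSeries.coeff s (U * ψ ^ (k - s))) =
      -∑ s ∈ Finset.range k, (k.choose (s + 1) : ℂ) * (p / 2 *
        PowerSeries.coeff s (U' * ψ ^ (k - s - 1))) := by
  have hterm : ∀ s ∈ Finset.range (k + 1), (k.choose s : ℂ) * (1 / (s + 1) * PowerSeries.coeff s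
        (U * ((((k - s).choose 2 : ℕ) : PowerSeries ℂ) * ψ ^ (k - s - 2) *
          PowerSeries.derivative ℂ ψ)) ) =
      (k.choose (s + 1) : ℂ) * ((s + 1) / 2 * PowerSeries.coeff (s + 1) (U * ψ ^ (k - s - 1)) -
        p / 2 * PowerSeries.coeff s (U' * ψ ^ (k - s - 1))) := by
    intro s hs
    have hsk : s ≤ k := Nat.lt_succ_iff.1 (Finset.mem_range.1 hs)
    have hs1 : (s : ℂ) + 1 ≠ 0 := by exact_mod_cast s.succ_ne_zero
    have hc : (k.choose (s + 1) : ℂ) * (s + 1) = k.choose s * (k - s : ℕ) := by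
      exact_mod_cast Nat.choose_succ_right_eq k s
    have hc2 : ((k - s).choose 2 : ℂ) = (k - s : ℕ) * (k - s - 1 : ℕ) / 2 := by
      rw [eq_div_iff two_ne_zero]
      have := Nat.choose_mul_succ_eq
      exact_mod_cast (by
        rw [Nat.choose_two_right]
        exact Nat.div_mul_cancel (Nat.even_mul_pred_self _).two_dvd :
        (k - s).choose 2 * 2 = (k - s) * (k - s - 1))
    have hd : PowerSeries.derivative ℂ (U * ψ ^ (k - s - 1)) =
        U * (PowerSeries.C ((k - s - 1 : ℕ) : ℂ) * (ψ ^ (k - s - 2) *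
          PowerSeries.derivative ℂ ψ)) + PowerSeries.C p * (U' * ψ ^ (k - s - 1)) := by
      rw [Derivation.leibniz, Derivation.leibniz_pow, hU, Nat.sub_sub (k - s) 1 1]
      simp only [smul_eq_mul, nsmul_eq_mul, map_natCast]
      ring
    have hd' := congrArg (PowerSeries.coeff s) hd
    rw [PowerSeries.coeff_derivative, map_add, mul_left_comm U, PowerSeries.coeff_C_mul,
      PowerSeries.coeff_C_mul] at hd'
    have e : U * ((((k - s).choose 2 : ℕ) : PowerSeries ℂ) * ψ ^ (k - s - 2) *
          PowerSeries.derivative ℂ ψ) = PowerSeries.C ((k - s).choose 2 : ℂ) *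
          (U * (ψ ^ (k - s - 2) * PowerSeries.derivative ℂ ψ)) := by
      rw [map_natCast]
      ring
    rw [e, PowerSeries.coeff_C_mul, hc2]
    have hc' : (k.choose (s + 1) : ℂ) = k.choose s * (k - s : ℕ) / (s + 1) := by
      rw [eq_div_iff hs1, hc]
    rw [hc']
    have h3 : ((k - s - 1 : ℕ) : ℂ) * PowerSeries.coeff s (U * (ψ ^ (k - s - 2) *
        PowerSeries.derivative ℂ ψ)) = PowerSeries.coeff (s + 1) (U * ψ ^ (k - s - 1)) * (s + 1) -
        p * PowerSeries.coeff s (U' * ψ ^ (k - s - 1)) := by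
      rw [hd']; ring
    field_simp
    linear_combination (k.choose s : ℂ) * ((k - s : ℕ) : ℂ) * h3
  simp only [mul_sub]
  rw [Finset.sum_sub_distrib, Finset.sum_congr rfl hterm, Finset.sum_range_succ,
    Finset.sum_range_succ' (fun s : ℕ => (k.choose s : ℂ) * ((s : ℂ) / 2 *
      PowerSeries.coeff s (U * ψ ^ (k - s))))]
  simp only [Nat.choose_succ_self, Nat.cast_zero, zero_mul, zero_div, mul_zero, add_zero, mul_sub,
    Finset.sum_sub_distrib, Nat.sub_sub]
  push_cast
  ring

/-- The term (1-q)/(2u) is a balance of two effects on the coefficients with u^{k-q-1}: integration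
by parts gives -(k-q)/2, the passage from factorial to ordinary powers gives (k-1)/2, and the sum is
-(1-q)/2. -/
theorem correctionValue_add_limitValue {Ψ Φ : ℂ → ℂ} (hΨ : AnalyticAt ℂ Ψ 1)
    (hΦ : AnalyticAt ℂ Φ 1) (q : ℝ) (k : ℕ) :
    correctionValue k q (taylorAt 1 (deriv Ψ)) (taylorAt 1 (deriv Φ)) +
      k.choose 2 * limitValue (k - 1) q (taylorAt 1 (deriv Ψ)) = infinitesimalMoment Ψ Φ q k := by
  rw [infinitesimalMoment_eq_sum hΨ hΦ, correctionValue, limitValue]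
  set ψ := taylorAt 1 (deriv Ψ)
  set φ := taylorAt 1 (deriv Φ)
  set U := taylorAt 1 (fun u : ℂ => u ^ ((k : ℂ) - q)) with hU
  have h1 := sum_choose_mul_leibniz k U _ ψ _ (derivative_taylorAt_cpow _)
  set U' := taylorAt 1 (fun u : ℂ => u ^ ((k : ℂ) - q - 1)) with hU'
  have h2 : ∀ s ∈ Finset.range (k + 1), (k.choose s : ℂ) *
    ((1 / (s + 1).factorial) * (s.factorial * PowerSeries.coeff s
      (U * (((k - s : ℕ) : PowerSeries ℂ) * ψ ^ (k - s - 1) * φ +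
        (((k - s).choose 2 : ℕ) : PowerSeries ℂ) * ψ ^ (k - s - 2) * PowerSeries.derivative ℂ ψ))) +
      (-(s / (2 * s.factorial))) * (s.factorial * PowerSeries.coeff s (U * ψ ^ (k - s)))) =
      (k.choose (s + 1) : ℂ) * PowerSeries.coeff s (U * φ * ψ ^ (k - s - 1)) +
      (k.choose s : ℂ) * (1 / (s + 1) * PowerSeries.coeff s
        (U * ((((k - s).choose 2 : ℕ) : PowerSeries ℂ) * ψ ^ (k - s - 2) *
          PowerSeries.derivative ℂ ψ)) - s / 2 * PowerSeries.coeff s (U * ψ ^ (k - s))) := by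
    intro s hs
    have hsk : s ≤ k := Nat.lt_succ_iff.1 (Finset.mem_range.1 hs)
    have hs1 : (s : ℂ) + 1 ≠ 0 := by exact_mod_cast s.succ_ne_zero
    have hf : (s.factorial : ℂ) ≠ 0 := by exact_mod_cast s.factorial_ne_zero
    have hc : (k.choose (s + 1) : ℂ) * (s + 1) = k.choose s * (k - s : ℕ) := by
      exact_mod_cast Nat.choose_succ_right_eq k s
    have hc' : (k.choose (s + 1) : ℂ) = k.choose s * (k - s : ℕ) / (s + 1) := by
      rw [eq_div_iff hs1, hc]
    have e : U * (((k - s : ℕ) : PowerSeries ℂ) * ψ ^ (k - s - 1) * φ +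
        (((k - s).choose 2 : ℕ) : PowerSeries ℂ) * ψ ^ (k - s - 2) * PowerSeries.derivative ℂ ψ) =
        PowerSeries.C ((k - s : ℕ) : ℂ) * (U * φ * ψ ^ (k - s - 1)) +
        U * ((((k - s).choose 2 : ℕ) : PowerSeries ℂ) * ψ ^ (k - s - 2) *
          PowerSeries.derivative ℂ ψ) := by
      rw [map_natCast]
      ring
    rw [e, map_add, PowerSeries.coeff_C_mul, hc', Nat.factorial_succ]
    push_cast
    field_simp
    ring
  rw [Finset.sum_congr rfl h2, Finset.sum_add_distrib, h1, Finset.sum_range_succ]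
  rcases k with _ | k
  · simp
  · have h3 : ∀ s ∈ Finset.range (k + 1), ((k.choose s : ℂ) / (s + 1).factorial *
        (s.factorial * PowerSeries.coeff s (taylorAt 1 (fun u : ℂ => u ^ ((k : ℂ) - q)) *
          ψ ^ (k - s)))) * ((k + 1).choose 2 : ℂ) =
        ((k + 1).choose (s + 1) : ℂ) * (k / 2 * PowerSeries.coeff s (U' * ψ ^ (k + 1 - s - 1))) := by
      intro s _
      have hs1 : (s : ℂ) + 1 ≠ 0 := by exact_mod_cast s.succ_ne_zero
      have hf : (s.factorial : ℂ) ≠ 0 := by exact_mod_cast s.factorial_ne_zero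
      have hc : ((k + 1).choose (s + 1) : ℂ) = (k + 1) * k.choose s / (s + 1) := by
        rw [eq_div_iff hs1]
        exact_mod_cast (Nat.add_one_mul_choose_eq k s).symm
      have hc2 : ((k + 1).choose 2 : ℂ) = (k + 1) * k / 2 := by
        rw [eq_div_iff two_ne_zero]
        exact_mod_cast (by
          rw [Nat.choose_two_right]
          exact Nat.div_mul_cancel (Nat.even_mul_pred_self _).two_dvd :
          (k + 1).choose 2 * 2 = (k + 1) * k)
      have hu : U' = taylorAt 1 (fun u : ℂ => u ^ ((k : ℂ) - q)) := by
        rw [hU']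
        congr 2
        funext u
        congr 1
        push_cast
        ring
      have he : k + 1 - s - 1 = k - s := by omega
      rw [hc, hc2, hu, Nat.factorial_succ, he]
      push_cast
      field_simp
    simp only [Nat.add_sub_cancel]
    rw [mul_comm ((k + 1).choose 2 : ℂ), Finset.sum_mul, Finset.sum_congr rfl h3]
    simp only [Nat.choose_succ_self, Nat.cast_zero, zero_mul, add_zero]
    rw [← Finset.sum_neg_distrib, ← Finset.sum_add_distrib, ← Finset.sum_add_distrib]
    refine Finset.sum_congr rfl fun s _ => ?_
    push_cast
    ring

/-! ### Lagrange inversion -/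

theorem analyticAt_fun_self (c : ℂ) : AnalyticAt ℂ (fun u : ℂ => u) c := analyticAt_id

theorem analyticAt_sub_one (c : ℂ) : AnalyticAt ℂ (fun u : ℂ => u - 1) c :=
  (analyticAt_fun_self c).fun_sub analyticAt_const

theorem AnalyticAt.exists_eq_add_mul {w : ℂ → ℂ} (hw : AnalyticAt ℂ w 0) :
    ∃ v : ℂ → ℂ, AnalyticAt ℂ v 0 ∧ (∀ z, w z = w 0 + z * v z) ∧
      ∀ k, PowerSeries.coeff k (taylorAt 0 v) = PowerSeries.coeff (k + 1) (taylorAt 0 w) := by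
  obtain ⟨p, hp⟩ := hw
  have hv : AnalyticAt ℂ (dslope w 0) 0 := ⟨_, hp.has_fpower_series_dslope_fslope⟩
  have he : ∀ z, w z = w 0 + z * dslope w 0 z := fun z => by
    have := sub_smul_dslope w 0 z
    rw [sub_zero, smul_eq_mul] at this
    rw [this]; ring
  refine ⟨dslope w 0, hv, he, fun k => ?_⟩
  have h1 : taylorAt 0 w = PowerSeries.C (w 0) + PowerSeries.X * taylorAt 0 (dslope w 0) := by
    have : taylorAt 0 w = taylorAt 0 fun z => w 0 + z * dslope w 0 z :=
      taylorAt_congr (Eventually.of_forall he)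
    rw [this, taylorAt_add analyticAt_const ((analyticAt_fun_self 0).fun_mul hv), taylorAt_const,
      taylorAt_mul (analyticAt_fun_self 0) hv]
    congr 2
    have := taylorAt_id 0
    rw [map_zero, zero_add] at this
    exact this
  rw [h1, map_add, PowerSeries.coeff_succ_X_mul, PowerSeries.coeff_C, if_neg k.succ_ne_zero,
    zero_add]

theorem taylorAt_one_sub_one_mul {f : ℂ → ℂ} (hf : AnalyticAt ℂ f 1) :
    taylorAt 1 (fun u => (u - 1) * f u) = PowerSeries.X * taylorAt 1 f := by
  rw [taylorAt_mul (analyticAt_sub_one 1) hf,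
    taylorAt_sub (analyticAt_fun_self 1) analyticAt_const, taylorAt_id, taylorAt_const]
  simp

/-- For z = (u-1)/H(u) this is the residue of z' z^{-k-1} at u = 1, written without Laurent series.
For positive index it vanishes because z' z^{-k-1} is a derivative; concretely, (H^{k+1})' = (k+1)
H' H^k makes the two terms cancel. -/
theorem coeff_taylorAt_deriv_mul_pow {H : ℂ → ℂ} (hH : AnalyticAt ℂ H 1) (h1 : H 1 = 1) (k : ℕ) :
    PowerSeries.coeff k (taylorAt 1 fun u => deriv (fun u => (u - 1) / H u) u * H u ^ (k + 1)) =
      if k = 0 then 1 else 0 := by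
  have hne : H 1 ≠ 0 := by rw [h1]; exact one_ne_zero
  have hd : (fun u => deriv (fun u => (u - 1) / H u) u) =ᶠ[𝓝 1]
      fun u => (H u - (u - 1) * deriv H u) / H u ^ 2 := by
    filter_upwards [hH.eventually_analyticAt, hH.continuousAt.eventually_ne hne] with u hu hu0
    have hs : DifferentiableAt ℂ (fun u : ℂ => u - 1) u := by fun_prop
    rw [deriv_fun_div hs hu.differentiableAt hu0]
    simp
  rcases k with _ | k
  · rw [if_pos rfl, PowerSeries.coeff_zero_eq_constantCoeff_apply, constantCoeff_taylorAt,
      h1]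
    exact (congrArg (· * (1 : ℂ) ^ (0 + 1)) hd.self_of_nhds).trans (by simp [h1])
  · rw [if_neg k.succ_ne_zero]
    have e : taylorAt 1 (fun u => deriv (fun u => (u - 1) / H u) u * H u ^ (k + 1 + 1)) =
        taylorAt 1 fun u => H u ^ (k + 1) - (u - 1) * (deriv H u * H u ^ k) := by
      refine taylorAt_congr ?_
      filter_upwards [hd, hH.continuousAt.eventually_ne hne] with u hu hu0
      rw [hu]
      field_simp
      ring
    have hHd := hH.deriv.fun_mul (hH.fun_pow k)
    rw [e, taylorAt_sub (hH.fun_pow _) ((analyticAt_sub_one 1).fun_mul hHd),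
      taylorAt_one_sub_one_mul hHd, map_sub, PowerSeries.coeff_succ_X_mul,
      taylorAt_mul hH.deriv (hH.fun_pow k), taylorAt_deriv, taylorAt_pow hH, taylorAt_pow hH]
    have h2 := congrArg (PowerSeries.coeff k)
      (Derivation.leibniz_pow (PowerSeries.derivative ℂ) (taylorAt 1 H) (k + 1))
    rw [PowerSeries.coeff_derivative, Nat.add_sub_cancel, smul_eq_mul, nsmul_eq_mul,
      ← map_natCast (PowerSeries.C (R := ℂ)), PowerSeries.coeff_C_mul] at h2
    have hk : (k : ℂ) + 1 ≠ 0 := by exact_mod_cast k.succ_ne_zero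
    push_cast at h2
    rw [mul_comm (PowerSeries.derivative ℂ _), sub_eq_zero]
    exact mul_left_cancel₀ hk (by rw [← h2]; ring)

/-- Residues are invariant under the change of variables `z = (u - 1) / H u`. -/
theorem coeff_taylorAt_comp_mul_deriv {H : ℂ → ℂ} (hH : AnalyticAt ℂ H 1) (h1 : H 1 = 1) (k : ℕ)
    {w : ℂ → ℂ} (hw : AnalyticAt ℂ w 0) :
    PowerSeries.coeff k (taylorAt 1 fun u =>
      w ((u - 1) / H u) * (deriv (fun u => (u - 1) / H u) u * H u ^ (k + 1))) =
      PowerSeries.coeff k (taylorAt 0 w) := by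
  have hne : H 1 ≠ 0 := by rw [h1]; exact one_ne_zero
  have hz : AnalyticAt ℂ (fun u => (u - 1) / H u) 1 :=
    (analyticAt_sub_one 1).fun_div hH hne
  induction k generalizing w with
  | zero =>
    have h2 := coeff_taylorAt_deriv_mul_pow hH h1 0
    rw [PowerSeries.coeff_zero_eq_constantCoeff_apply, constantCoeff_taylorAt] at h2 ⊢
    rw [h2, PowerSeries.coeff_zero_eq_constantCoeff_apply, constantCoeff_taylorAt]
    simp
  | succ k ih =>
    -- Write w(z) = w(0) + z v(z). The constant has no residue here, and z·H(u) = u - 1 lowers both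
    -- the power of H and the coefficient index by one.
    obtain ⟨v, hv, hwv, hcoeff⟩ := hw.exists_eq_add_mul
    have hvz : AnalyticAt ℂ (fun u => v ((u - 1) / H u)) 1 :=
      AnalyticAt.fun_comp (by simpa using hv) hz
    have e : taylorAt 1 (fun u => w ((u - 1) / H u) *
        (deriv (fun u => (u - 1) / H u) u * H u ^ (k + 1 + 1))) =
        taylorAt 1 fun u => w 0 * (deriv (fun u => (u - 1) / H u) u * H u ^ (k + 1 + 1)) +
          (u - 1) * (v ((u - 1) / H u) * (deriv (fun u => (u - 1) / H u) u * H u ^ (k + 1))) := by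
      refine taylorAt_congr ?_
      filter_upwards [hH.continuousAt.eventually_ne hne] with u hu0
      rw [hwv ((u - 1) / H u)]
      field_simp
      ring
    have ha := hvz.fun_mul (hz.deriv.fun_mul (hH.fun_pow (k + 1)))
    have hb := analyticAt_const (v := w 0) |>.fun_mul (hz.deriv.fun_mul (hH.fun_pow (k + 1 + 1)))
    have hc := analyticAt_sub_one 1
    rw [e, taylorAt_add hb (hc.fun_mul ha), taylorAt_const_mul, taylorAt_one_sub_one_mul ha,
      map_add, PowerSeries.coeff_C_mul, PowerSeries.coeff_succ_X_mul, ih hv,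
      coeff_taylorAt_deriv_mul_pow hH h1, if_neg k.succ_ne_zero, mul_zero, zero_add, hcoeff]

/-- A local inverse of `u ↦ (u - 1) / H u`. -/
theorem exists_inverse_sub_one_div {H : ℂ → ℂ} (hH : AnalyticAt ℂ H 1) (h1 : H 1 = 1) :
    ∃ v : ℂ → ℂ, AnalyticAt ℂ v 0 ∧ v 0 = 1 ∧ (∀ᶠ u in 𝓝 1, v ((u - 1) / H u) = u) := by
  have hne : H 1 ≠ 0 := by rw [h1]; exact one_ne_zero
  have hz : AnalyticAt ℂ (fun u => (u - 1) / H u) 1 :=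
    (analyticAt_sub_one 1).fun_div hH hne
  have hd : deriv (fun u => (u - 1) / H u) 1 ≠ 0 := by
    have hs : DifferentiableAt ℂ (fun u : ℂ => u - 1) 1 := by fun_prop
    rw [deriv_fun_div hs hH.differentiableAt hne]
    simp [h1]
  have h2 := hz.analyticAt_localInverse hd
  have h3 := (hz.hasStrictDerivAt.hasStrictFDerivAt_equiv hd).eventually_left_inverse
  refine ⟨_, by simpa using h2, ?_, h3⟩
  have := h3.self_of_nhds
  simpa using this

/-- The Lagrange-Bürmann formula. -/
theorem coeff_taylorAt_mul_pow {H g v : ℂ → ℂ} (hH : AnalyticAt ℂ H 1) (h1 : H 1 = 1)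
    (hg : AnalyticAt ℂ g 1) (hv : AnalyticAt ℂ v 0) (hv0 : v 0 = 1)
    (hinv : ∀ᶠ u in 𝓝 1, v ((u - 1) / H u) = u) (k : ℕ) :
    PowerSeries.coeff k (taylorAt 1 fun u => g u * H u ^ (k + 1)) =
      PowerSeries.coeff k (taylorAt 0 fun z => g (v z) * deriv v z) := by
  have hne : H 1 ≠ 0 := by rw [h1]; exact one_ne_zero
  have hz : AnalyticAt ℂ (fun u => (u - 1) / H u) 1 :=
    (analyticAt_sub_one 1).fun_div hH hne
  have hw : AnalyticAt ℂ (fun z => g (v z) * deriv v z) 0 :=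
    (AnalyticAt.fun_comp (by rwa [hv0]) hv).fun_mul hv.deriv
  rw [← coeff_taylorAt_comp_mul_deriv hH h1 k hw]
  congr 1
  refine taylorAt_congr ?_
  have hva : ∀ᶠ u in 𝓝 1, AnalyticAt ℂ v ((u - 1) / H u) :=
    hz.continuousAt.eventually (by simpa using hv.eventually_analyticAt)
  filter_upwards [hinv, hinv.eventually_nhds, hva, hz.eventually_analyticAt] with u hu hu' hvu hzu
  have hc : deriv v ((u - 1) / H u) * deriv (fun u => (u - 1) / H u) u = 1 := by
    have h2 := (HasDerivAt.comp u hvu.differentiableAt.hasDerivAt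
      hzu.differentiableAt.hasDerivAt).deriv
    have h3 : (v ∘ fun u => (u - 1) / H u) =ᶠ[𝓝 u] fun u => u := hu'
    rw [← h2, h3.deriv_eq]
    simp
  rw [hu]
  linear_combination (-(g u) * H u ^ (k + 1)) * hc

/-! ### The generating functions of the limiting moments -/

/-- Binomial expansion of (Xψ + 1)^{k+1}: the factor X^{k-s} moves the coefficient from k to s, and
the top term X^{k+1} is invisible at index k. This brings moment formulas into the form required by
Lagrange inversion. -/
theorem sum_choose_mul_coeff (k : ℕ) (A ψ : PowerSeries ℂ) :
    ∑ s ∈ Finset.range (k + 1), ((k + 1).choose (s + 1) : ℂ) *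
      PowerSeries.coeff s (A * ψ ^ (k - s)) =
      PowerSeries.coeff k (A * (PowerSeries.X * ψ + 1) ^ (k + 1)) := by
  have h : (PowerSeries.X * ψ + 1) ^ (k + 1) = PowerSeries.X ^ (k + 1) * ψ ^ (k + 1) +
      ∑ s ∈ Finset.range (k + 1), PowerSeries.C ((k + 1).choose (s + 1) : ℂ) *
        (PowerSeries.X ^ (k - s) * ψ ^ (k - s)) := by
    rw [add_comm (PowerSeries.X * ψ), add_pow, Finset.sum_range_succ', add_comm]
    congr 1
    · simp [mul_pow]
    · refine Finset.sum_congr rfl fun s _ => ?_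
      rw [one_pow, one_mul, Nat.add_sub_add_right, mul_pow, map_natCast]
      ring
  rw [h, mul_add, map_add, mul_left_comm, PowerSeries.coeff_X_pow_mul',
    if_neg (by omega), zero_add, Finset.mul_sum, map_sum]
  refine Finset.sum_congr rfl fun s hs => ?_
  have hsk : s ≤ k := Nat.lt_succ_iff.1 (Finset.mem_range.1 hs)
  rw [mul_left_comm, PowerSeries.coeff_C_mul, mul_left_comm, PowerSeries.coeff_X_pow_mul',
    if_pos (by omega), show k - (k - s) = s by omega]

/-- The function `u * ((u - 1) * ψ + 1)`. -/
noncomputable def inversionKernel (ψ : ℂ → ℂ) (u : ℂ) : ℂ := u * ((u - 1) * ψ u + 1)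

theorem analyticAt_inversionKernel {ψ : ℂ → ℂ} (hψ : AnalyticAt ℂ ψ 1) :
    AnalyticAt ℂ (inversionKernel ψ) 1 := by
  unfold inversionKernel
  fun_prop

theorem taylorAt_mul_inversionKernel_pow {ψ g f : ℂ → ℂ} (hψ : AnalyticAt ℂ ψ 1)
    (hf : AnalyticAt ℂ f 1) (k : ℕ) (hfg : ∀ᶠ u in 𝓝 1, f u = g u * u ^ k) :
    taylorAt 1 (fun u => g u * inversionKernel ψ u ^ k) =
      taylorAt 1 f * (PowerSeries.X * taylorAt 1 ψ + 1) ^ k := by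
  have h1 : AnalyticAt ℂ (fun u => (u - 1) * ψ u + 1) 1 := by fun_prop
  have h2 : taylorAt 1 (fun u => (u - 1) * ψ u + 1) = PowerSeries.X * taylorAt 1 ψ + 1 := by
    rw [taylorAt_add (by fun_prop) (by fun_prop), taylorAt_one_sub_one_mul hψ, taylorAt_const,
      map_one]
  rw [← h2, ← taylorAt_pow h1, ← taylorAt_mul hf (h1.fun_pow k)]
  refine taylorAt_congr ?_
  filter_upwards [hfg] with u hu
  rw [hu, inversionKernel, mul_pow]
  ring

theorem eventually_ne_zero_one : ∀ᶠ u : ℂ in 𝓝 1, u ≠ 0 :=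
  continuousAt_id.eventually_ne (one_ne_zero (α := ℂ))

/-- The factor k + 1 turns binom(k,s)/(s+1) into binom(k+1,s+1), completing the binomial expansion;
at q = 0 the power u^k is u⁻¹ u^{k+1}, and u^{k+1} is absorbed into the kernel. -/
theorem succ_mul_limitMoment_zero {Ψ : ℂ → ℂ} (hΨ : AnalyticAt ℂ Ψ 1) (k : ℕ) :
    ((k : ℂ) + 1) * limitMoment Ψ 0 k =
      PowerSeries.coeff k (taylorAt 1 fun u => u⁻¹ * inversionKernel (deriv Ψ) u ^ (k + 1)) := by
  rw [taylorAt_mul_inversionKernel_pow hΨ.deriv (analyticAt_cpow_one ((k : ℂ) - (0 : ℝ))),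
    ← sum_choose_mul_coeff, limitMoment_eq_limitValue hΨ, limitValue, Finset.mul_sum]
  · refine Finset.sum_congr rfl fun s _ => ?_
    have hs1 : (s : ℂ) + 1 ≠ 0 := by exact_mod_cast s.succ_ne_zero
    have hf : (s.factorial : ℂ) ≠ 0 := by exact_mod_cast s.factorial_ne_zero
    have hc : ((k + 1).choose (s + 1) : ℂ) = (k + 1) * k.choose s / (s + 1) := by
      rw [eq_div_iff hs1]
      exact_mod_cast (Nat.add_one_mul_choose_eq k s).symm
    rw [hc, Nat.factorial_succ]
    push_cast
    field_simp
  · filter_upwards [eventually_ne_zero_one] with u hu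
    rw [Complex.ofReal_zero, sub_zero, Complex.cpow_natCast, pow_succ]
    field_simp

theorem infinitesimalMoment_succ {Ψ Φ : ℂ → ℂ} (hΨ : AnalyticAt ℂ Ψ 1) (hΦ : AnalyticAt ℂ Φ 1)
    (q : ℝ) (k : ℕ) :
    infinitesimalMoment Ψ Φ q (k + 1) = PowerSeries.coeff k (taylorAt 1 fun u =>
      u ^ (-(q : ℂ)) * (deriv Φ u - (1 - q) / (2 * u)) * inversionKernel (deriv Ψ) u ^ (k + 1)) := by
  have hf : AnalyticAt ℂ (fun u : ℂ => u ^ (((k + 1 : ℕ) : ℂ) - q) *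
      (deriv Φ u - (1 - q) / (2 * u))) 1 := by
    refine (analyticAt_cpow_one _).fun_mul (hΦ.deriv.fun_sub (analyticAt_const.fun_div
      (analyticAt_const.fun_mul analyticAt_id) (by simp)))
  rw [taylorAt_mul_inversionKernel_pow hΨ.deriv hf, ← sum_choose_mul_coeff, infinitesimalMoment]
  · refine Finset.sum_congr rfl fun s _ => ?_
    have hs : (s.factorial : ℂ) ≠ 0 := by exact_mod_cast s.factorial_ne_zero
    rw [iteratedDeriv_eq_coeff_taylorAt, taylorAt_mul hf (hΨ.deriv.fun_pow _),
      taylorAt_pow hΨ.deriv, show k + 1 - s - 1 = k - s by omega, ← mul_assoc,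
      div_mul_cancel₀ _ hs]
  · filter_upwards [eventually_ne_zero_one] with u hu
    rw [sub_eq_add_neg, Complex.cpow_add _ _ hu, Complex.cpow_natCast]
    ring

theorem infinitesimalMoment_zero (Ψ Φ : ℂ → ℂ) (q : ℝ) : infinitesimalMoment Ψ Φ q 0 = 0 := by
  simp [infinitesimalMoment]

theorem exp_mul_identity {e e' q z v v' φ : ℂ} (he : e * e' = 1) (hv : v ≠ 0) :
    e * (z ^ 2 * (e' * (φ - (1 - q) / (2 * v)) * v')) =
      z ^ 2 * (1 * (φ - (1 - 0) / (2 * v)) * v') + q / 2 * (z ^ 2 * (v⁻¹ * v')) := by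
  have : e * (z ^ 2 * (e' * (φ - (1 - q) / (2 * v)) * v')) =
      (e * e') * (z ^ 2 * ((φ - (1 - q) / (2 * v)) * v')) := by ring
  rw [this, he]
  field_simp
  ring

/-- With v the local inverse of (u-1)/H(u), Lagrange-Bürmann identifies (k+1) μ_k^{(0)} with the
coefficients of v'/v = (log v)', and the infinitesimal moments with those of v^{-q}(Φ'(v) -
(1-q)/(2v)) v'. All four series thus represent explicit functions of v, and the identity is v^q
v^{-q} = 1 together with (1-q)/(2v) = 1/(2v) - q/(2v). -/
theorem eventually_generating_identity {Ψ Φ : ℂ → ℂ} (hΨ : AnalyticAt ℂ Ψ 1)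
    (hΦ : AnalyticAt ℂ Φ 1) (q : ℝ) :
    ∀ᶠ z in 𝓝 (0 : ℂ),
      Summable (fun k : ℕ => limitMoment Ψ 0 k * z ^ (k + 1)) ∧
      Summable (fun k : ℕ => infinitesimalMoment Ψ Φ 0 k * z ^ (k + 1)) ∧
      Summable (fun k : ℕ => infinitesimalMoment Ψ Φ q k * z ^ (k + 1)) ∧
      Summable (fun k : ℕ => ((k : ℂ) + 1) * limitMoment Ψ 0 k * z ^ (k + 2)) ∧
      Complex.exp (q * ∑' k : ℕ, limitMoment Ψ 0 k * z ^ (k + 1)) *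
          (∑' k : ℕ, infinitesimalMoment Ψ Φ q k * z ^ (k + 1)) =
        (∑' k : ℕ, infinitesimalMoment Ψ Φ 0 k * z ^ (k + 1)) +
          (q : ℂ) / 2 * (∑' k : ℕ, ((k : ℂ) + 1) * limitMoment Ψ 0 k * z ^ (k + 2)) := by
  have hH := analyticAt_inversionKernel hΨ.deriv
  have h1 : inversionKernel (deriv Ψ) 1 = 1 := by simp [inversionKernel]
  obtain ⟨v, hv, hv0, hinv⟩ := exists_inverse_sub_one_div hH h1
  have hvs : v 0 ∈ Complex.slitPlane := by rw [hv0]; simp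
  have hlog : AnalyticAt ℂ (fun z => Complex.log (v z)) 0 := hv.clog hvs
  have hvslit : ∀ᶠ z in 𝓝 (0 : ℂ), v z ∈ Complex.slitPlane :=
    hv.continuousAt.eventually (Complex.isOpen_slitPlane.mem_nhds hvs)
  have hginv : AnalyticAt ℂ (fun u : ℂ => u⁻¹) 1 := analyticAt_id.fun_inv one_ne_zero
  have hg : ∀ q : ℝ, AnalyticAt ℂ (fun u : ℂ => u ^ (-(q : ℂ)) *
      (deriv Φ u - (1 - q) / (2 * u))) 1 := fun q =>
    (analyticAt_cpow_one _).fun_mul (hΦ.deriv.fun_sub (analyticAt_const.fun_div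
      (analyticAt_const.fun_mul analyticAt_id) (by simp)))
  have hcomp : ∀ {g : ℂ → ℂ}, AnalyticAt ℂ g 1 →
      AnalyticAt ℂ (fun z => g (v z) * deriv v z) 0 := fun hg =>
    (AnalyticAt.fun_comp (by rwa [hv0]) hv).fun_mul hv.deriv
  have hμ : ∀ k : ℕ, ((k : ℂ) + 1) * limitMoment Ψ 0 k =
      PowerSeries.coeff k (taylorAt 0 fun z => (v z)⁻¹ * deriv v z) := fun k => by
    rw [succ_mul_limitMoment_zero hΨ, coeff_taylorAt_mul_pow hH h1 hginv hv hv0 hinv]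
  have hμ' : ∀ (q : ℝ) (k : ℕ), infinitesimalMoment Ψ Φ q (k + 1) = PowerSeries.coeff k
      (taylorAt 0 fun z => v z ^ (-(q : ℂ)) * (deriv Φ (v z) - (1 - q) / (2 * v z)) *
        deriv v z) := fun q k => by
    rw [infinitesimalMoment_succ hΨ hΦ, coeff_taylorAt_mul_pow hH h1 (hg q) hv hv0 hinv]
  have hderiv : taylorAt 0 (fun z => (v z)⁻¹ * deriv v z) =
      PowerSeries.derivative ℂ (taylorAt 0 fun z => Complex.log (v z)) := by
    rw [← taylorAt_deriv]
    refine taylorAt_congr ?_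
    filter_upwards [hvslit, hv.eventually_analyticAt] with z hz hvz
    rw [(hvz.differentiableAt.hasDerivAt.clog hz).deriv]
    ring
  have hlogc : ∀ k : ℕ, limitMoment Ψ 0 k =
      PowerSeries.coeff (k + 1) (taylorAt 0 fun z => Complex.log (v z)) := fun k => by
    have hk : (k : ℂ) + 1 ≠ 0 := by exact_mod_cast k.succ_ne_zero
    refine mul_left_cancel₀ hk ?_
    rw [hμ, hderiv, PowerSeries.coeff_derivative, mul_comm]
  filter_upwards [hvslit, hlog.eventually_hasSum_taylorAt,
    (hcomp hginv).eventually_hasSum_taylorAt, (hcomp (hg q)).eventually_hasSum_taylorAt,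
    (hcomp (hg 0)).eventually_hasSum_taylorAt] with z hz hs1 hs2 hs3 hs4
  simp only [zero_add] at hs1 hs2 hs3 hs4
  have hz0 : v z ≠ 0 := Complex.slitPlane_ne_zero hz
  have hS1 : HasSum (fun k : ℕ => limitMoment Ψ 0 k * z ^ (k + 1)) (Complex.log (v z)) := by
    have := (hasSum_nat_add_iff' 1).2 hs1
    simp only [Finset.sum_range_one, pow_zero, mul_one,
      PowerSeries.coeff_zero_eq_constantCoeff_apply, constantCoeff_taylorAt, hv0, Complex.log_one,
      sub_zero] at this
    simpa only [hlogc] using this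
  have hS2 : HasSum (fun k : ℕ => ((k : ℂ) + 1) * limitMoment Ψ 0 k * z ^ (k + 2))
      (z ^ 2 * ((v z)⁻¹ * deriv v z)) := by
    refine (hs2.mul_left (z ^ 2)).congr_fun fun k => ?_
    rw [hμ]
    ring
  have hS3 : ∀ q : ℝ, HasSum (fun k => PowerSeries.coeff k (taylorAt 0 fun z =>
      v z ^ (-(q : ℂ)) * (deriv Φ (v z) - (1 - q) / (2 * v z)) * deriv v z) * z ^ k)
      (v z ^ (-(q : ℂ)) * (deriv Φ (v z) - (1 - q) / (2 * v z)) * deriv v z) →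
      HasSum (fun k : ℕ => infinitesimalMoment Ψ Φ q k * z ^ (k + 1)) (z ^ 2 *
        (v z ^ (-(q : ℂ)) * (deriv Φ (v z) - (1 - q) / (2 * v z)) * deriv v z)) := fun q hq => by
    -- The infinitesimal moment of order 0 vanishes, so the series starts at z²; hence the prefactor
    -- z².
    refine (hasSum_nat_add_iff' 1).1 ?_
    simp only [Finset.sum_range_one, infinitesimalMoment_zero, zero_mul, sub_zero]
    refine (hq.mul_left (z ^ 2)).congr_fun fun k => ?_
    rw [hμ']
    ring
  have hSq := hS3 q hs3
  have hS0 := hS3 0 hs4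
  refine ⟨hS1.summable, hS0.summable, hSq.summable, hS2.summable, ?_⟩
  rw [hS1.tsum_eq, hSq.tsum_eq, hS0.tsum_eq, hS2.tsum_eq, Complex.cpow_def_of_ne_zero hz0,
    Complex.ofReal_zero, neg_zero, Complex.cpow_zero]
  refine exp_mul_identity ?_ hz0
  rw [← Complex.exp_add, ← Complex.exp_zero]
  congr 1
  ring

/-! ### The difference operators -/

/-- `V⁻¹ ∑ᵢ uᵢ^(n-q) ∂ᵢⁿ V` applied to `f`, where `V` is the Vandermonde product. Only the factor
of `V` depending on `uᵢ` is kept in the `i`-th summand. -/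
noncomputable def diffOp {N : ℕ} (n : ℕ) (q : ℂ) (f : (Fin N → ℂ) → ℂ) (u : Fin N → ℂ) : ℂ :=
  ∑ i, u i ^ ((n : ℂ) - q) * (∏ j ∈ Finset.univ.erase i, (u i - u j))⁻¹ *
    iteratedDeriv n (fun z => (∏ j ∈ Finset.univ.erase i, (z - u j)) * f (Function.update u i z))
      (u i)

/-- A ray starting at `1^N`, with distinct coordinates away from its origin. -/
noncomputable def ray (N : ℕ) (ε : ℂ) : Fin N → ℂ := fun j => 1 + ε * (j : ℕ)

/-- `diffOp n q f` tends to `L` along the ray. -/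
def HasDiffOpValue {N : ℕ} (n : ℕ) (q : ℂ) (f : (Fin N → ℂ) → ℂ) (L : ℂ) : Prop :=
  Tendsto (fun ε => diffOp n q f (ray N ε)) (𝓝[≠] 0) (𝓝 L)

/-- `f` is holomorphic in a neighbourhood of `1^N`. -/
def HolNearOne {N : ℕ} (f : (Fin N → ℂ) → ℂ) : Prop :=
  ∀ᶠ u in 𝓝 (1 : Fin N → ℂ), DifferentiableAt ℂ f u

theorem tendsto_ray (N : ℕ) : Tendsto (ray N) (𝓝 0) (𝓝 1) := by
  have : Continuous (ray N) := by unfold ray; fun_prop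
  have h := this.tendsto 0
  have e : ray N 0 = 1 := by ext j; simp [ray]
  rwa [e] at h

theorem ray_sub_ray (N : ℕ) (ε : ℂ) (i j : Fin N) :
    ray N ε i - ray N ε j = ε * ((i : ℕ) - (j : ℕ)) := by
  simp only [ray]; ring

theorem natCast_fin_sub_ne_zero {N : ℕ} {i j : Fin N} (h : i ≠ j) :
    (((i : ℕ) : ℂ) - ((j : ℕ) : ℂ)) ≠ 0 := by
  rw [sub_ne_zero]
  exact_mod_cast fun h' => h (Fin.ext h')

theorem ray_sub_ray_ne_zero {N : ℕ} {ε : ℂ} (hε : ε ≠ 0) {i j : Fin N} (h : i ≠ j) :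
    ray N ε i - ray N ε j ≠ 0 := by
  rw [ray_sub_ray]
  exact mul_ne_zero hε (natCast_fin_sub_ne_zero h)

theorem HolNearOne.analyticAt_update {N : ℕ} {f : (Fin N → ℂ) → ℂ} (hf : HolNearOne f) :
    ∀ᶠ u in 𝓝 (1 : Fin N → ℂ), ∀ i, AnalyticAt ℂ (fun z => f (Function.update u i z)) (u i) := by
  filter_upwards [hf.eventually_nhds] with u hu i
  rw [Complex.analyticAt_iff_eventually_differentiableAt]
  have hc : Tendsto (fun z => Function.update u i z) (𝓝 (u i)) (𝓝 u) := by
    have : Continuous fun z => Function.update u i z := continuous_const.update i continuous_id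
    have h := this.tendsto (u i)
    rwa [Function.update_eq_self] at h
  filter_upwards [hc.eventually hu] with z hz
  have hd : DifferentiableAt ℂ (fun z => Function.update u i z) z :=
    (hasFDerivAt_update u z).differentiableAt
  exact DifferentiableAt.comp z hz hd

theorem HolNearOne.sum {N : ℕ} {ι : Type*} (s : Finset ι) (c : ι → ℂ)
    {f : ι → (Fin N → ℂ) → ℂ} (hf : ∀ a ∈ s, HolNearOne (f a)) :
    HolNearOne fun u => ∑ a ∈ s, c a * f a u := by
  have : ∀ᶠ u in 𝓝 (1 : Fin N → ℂ), ∀ a ∈ s, DifferentiableAt ℂ (f a) u :=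
    (Finset.eventually_all s).2 hf
  filter_upwards [this] with u hu
  exact DifferentiableAt.fun_sum fun a ha => (hu a ha).const_mul _

theorem HasDiffOpValue.sum {N n : ℕ} {q : ℂ} {ι : Type*} (s : Finset ι) (c : ι → ℂ)
    {f : ι → (Fin N → ℂ) → ℂ} {L : ι → ℂ} (hf : ∀ a ∈ s, HolNearOne (f a))
    (h : ∀ a ∈ s, HasDiffOpValue n q (f a) (L a)) :
    HasDiffOpValue n q (fun u => ∑ a ∈ s, c a * f a u) (∑ a ∈ s, c a * L a) := by
  have h1 : Tendsto (fun ε => ∑ a ∈ s, c a * diffOp n q (f a) (ray N ε)) (𝓝[≠] 0)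
      (𝓝 (∑ a ∈ s, c a * L a)) :=
    tendsto_finsetSum _ fun a ha => (h a ha).const_mul (c a)
  refine h1.congr' ?_
  have h2 : ∀ᶠ u in 𝓝 (1 : Fin N → ℂ), ∀ a ∈ s, ∀ i,
      AnalyticAt ℂ (fun z => f a (Function.update u i z)) (u i) :=
    (Finset.eventually_all s).2 fun a ha => (hf a ha).analyticAt_update
  filter_upwards [((tendsto_ray N).mono_left nhdsWithin_le_nhds).eventually h2] with ε hε
  simp only [diffOp, Finset.mul_sum]
  rw [Finset.sum_comm]
  refine Finset.sum_congr rfl fun i _ => ?_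
  rw [iteratedDeriv_fun_sum, Finset.mul_sum]
  · refine Finset.sum_congr rfl fun a ha => ?_
    have e : (fun z => (∏ j ∈ Finset.univ.erase i, (z - ray N ε j)) *
        (c a * f a (Function.update (ray N ε) i z))) = fun z => c a *
        ((∏ j ∈ Finset.univ.erase i, (z - ray N ε j)) * f a (Function.update (ray N ε) i z)) := by
      funext z; ring
    rw [e, iteratedDeriv_const_mul_field]
    ring
  · intro a ha
    have h3 := hε a ha i
    have h4 : AnalyticAt ℂ (fun z => ∏ j ∈ Finset.univ.erase i, (z - ray N ε j)) (ray N ε i) := by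
      fun_prop
    exact (h4.fun_mul (analyticAt_const.fun_mul h3)).contDiffAt

theorem HasDiffOpValue.add {N n : ℕ} {q : ℂ} {f g : (Fin N → ℂ) → ℂ} {L M : ℂ}
    (hf : HolNearOne f) (hg : HolNearOne g) (h : HasDiffOpValue n q f L)
    (h' : HasDiffOpValue n q g M) : HasDiffOpValue n q (fun u => f u + g u) (L + M) := by
  have := HasDiffOpValue.sum (Finset.univ : Finset Bool) (fun _ => 1)
    (f := fun b => cond b f g) (L := fun b => cond b L M)
    (fun a _ => by cases a <;> assumption) (fun a _ => by cases a <;> assumption)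
  simpa using this

theorem HasDiffOpValue.const_mul {N n : ℕ} {q : ℂ} {f : (Fin N → ℂ) → ℂ} {L : ℂ} (c : ℂ)
    (hf : HolNearOne f) (h : HasDiffOpValue n q f L) :
    HasDiffOpValue n q (fun u => c * f u) (c * L) := by
  have := HasDiffOpValue.sum (Finset.univ : Finset Unit) (fun _ => c)
    (f := fun _ => f) (L := fun _ => L) (fun _ _ => hf) (fun _ _ => h)
  simpa using this

theorem HasDiffOpValue.unique {N n : ℕ} {q : ℂ} {f : (Fin N → ℂ) → ℂ} {L M : ℂ}
    (h : HasDiffOpValue n q f L) (h' : HasDiffOpValue n q f M) : L = M :=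
  tendsto_nhds_unique h h'

/-- The operator of order `n` kills functions vanishing to order `k ≥ n`. -/
theorem HasDiffOpValue.of_isLittleO {N n k : ℕ} {q : ℂ} {f : (Fin N → ℂ) → ℂ} (hf : HolNearOne f)
    (hnk : n ≤ k) (ho : f =o[𝓝 1] fun u => ‖u - 1‖ ^ k) : HasDiffOpValue n q f 0 := by
  -- On the disc of radius ‖ε‖ around a coordinate of the ray, both the distance of the modified
  -- point from 1^N and the factors z - u_j are at most ‖ε‖(N + 1).
  set B : ℝ := N + 1 with hB
  have hB1 : 1 ≤ B := by rw [hB]; linarith [(Nat.cast_nonneg N : (0 : ℝ) ≤ N)]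
  set C : ℝ := N * (2 * (n.factorial * B ^ (N - 1 + k))) with hC
  have hC0 : 0 ≤ C := by positivity
  have key : ∀ c > 0, ∀ᶠ ε in 𝓝[≠] (0 : ℂ), ‖diffOp n q f (ray N ε)‖ ≤ C * c := by
    intro c hc
    have h1 : ∀ᶠ u in 𝓝 (1 : Fin N → ℂ), DifferentiableAt ℂ f u ∧ ‖f u‖ ≤ c * ‖u - 1‖ ^ k := by
      filter_upwards [hf, ho.bound hc] with u hu hu'
      refine ⟨hu, ?_⟩
      simpa using hu'
    obtain ⟨δ, hδ, hball⟩ := Metric.eventually_nhds_iff.1 h1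
    have hpow : ∀ᶠ u in 𝓝 (1 : Fin N → ℂ), ∀ i, ‖u i ^ ((n : ℂ) - q)‖ ≤ 2 := by
      rw [eventually_all]
      intro i
      have : Tendsto (fun u : Fin N → ℂ => ‖u i ^ ((n : ℂ) - q)‖) (𝓝 1)
          (𝓝 ‖(1 : ℂ) ^ ((n : ℂ) - q)‖) :=
        ((analyticAt_cpow_one ((n : ℂ) - q)).continuousAt.tendsto.comp
          ((continuous_apply i).tendsto (1 : Fin N → ℂ))).norm
      rw [Complex.one_cpow, norm_one] at this
      exact this.eventually (ge_mem_nhds one_lt_two)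
    have hsmall : ∀ᶠ ε in 𝓝 (0 : ℂ), ‖ε‖ < min 1 (δ / B) := by
      have : Tendsto (fun ε : ℂ => ‖ε‖) (𝓝 0) (𝓝 0) := by
        simpa using (continuous_norm.tendsto (0 : ℂ))
      exact this.eventually (gt_mem_nhds (by positivity))
    filter_upwards [nhdsWithin_le_nhds hsmall, self_mem_nhdsWithin,
      ((tendsto_ray N).mono_left nhdsWithin_le_nhds).eventually hpow] with ε hε hε0 hεp
    have hε0' : ε ≠ 0 := hε0
    have he : 0 < ‖ε‖ := norm_pos_iff.2 hε0'
    have he1 : ‖ε‖ < 1 := lt_of_lt_of_le hε (min_le_left _ _)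
    have heδ : ‖ε‖ * B < δ := (lt_div_iff₀ (by positivity)).1 (lt_of_lt_of_le hε (min_le_right _ _))
    have hdist : ∀ (i : Fin N) (z : ℂ), ‖z - ray N ε i‖ ≤ ‖ε‖ →
        ‖Function.update (ray N ε) i z - 1‖ ≤ ‖ε‖ * B := by
      intro i z hz
      refine (pi_norm_le_iff_of_nonneg (by positivity)).2 fun j => ?_
      have hj : ‖ε * ((j : ℕ) : ℂ)‖ ≤ ‖ε‖ * N := by
        rw [norm_mul, Complex.norm_natCast]
        gcongr
        exact j.2.le
      by_cases hji : j = i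
      · subst hji
        have : (Function.update (ray N ε) j z - 1) j = (z - ray N ε j) + ε * ((j : ℕ) : ℂ) := by
          simp only [Pi.sub_apply, Function.update_self, Pi.one_apply, ray]
          ring
        rw [this]
        calc _ ≤ ‖z - ray N ε j‖ + ‖ε * ((j : ℕ) : ℂ)‖ := norm_add_le _ _
          _ ≤ ‖ε‖ + ‖ε‖ * N := add_le_add hz hj
          _ = ‖ε‖ * B := by rw [hB]; ring
      · have : (Function.update (ray N ε) i z - 1) j = ε * ((j : ℕ) : ℂ) := by
          simp [ray, Function.update_of_ne hji]
        rw [this]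
        refine hj.trans ?_
        gcongr
        rw [hB]; linarith
    have hterm : ∀ i : Fin N, ‖ray N ε i ^ ((n : ℂ) - q) *
        (∏ j ∈ Finset.univ.erase i, (ray N ε i - ray N ε j))⁻¹ *
        iteratedDeriv n (fun z => (∏ j ∈ Finset.univ.erase i, (z - ray N ε j)) *
          f (Function.update (ray N ε) i z)) (ray N ε i)‖ ≤
        2 * (n.factorial * B ^ (N - 1 + k)) * c := by
      intro i
      have hcard : (Finset.univ.erase i).card = N - 1 := by
        rw [Finset.card_erase_of_mem (Finset.mem_univ i), Finset.card_univ, Fintype.card_fin]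
      have hprod : ‖ε‖ ^ (N - 1) ≤ ‖∏ j ∈ Finset.univ.erase i, (ray N ε i - ray N ε j)‖ := by
        rw [norm_prod, ← hcard, ← Finset.prod_const]
        refine Finset.prod_le_prod (fun _ _ => he.le) fun j hj => ?_
        rw [ray_sub_ray, norm_mul]
        refine le_mul_of_one_le_right he.le ?_
        have hij : (i : ℕ) ≠ (j : ℕ) := fun h => (Finset.ne_of_mem_erase hj) (Fin.ext h.symm)
        have : (((i : ℕ) : ℂ) - ((j : ℕ) : ℂ)) = (((i : ℤ) - (j : ℤ) : ℤ) : ℂ) := by push_cast; rfl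
        rw [this, Complex.norm_intCast]
        have h2 : (1 : ℤ) ≤ |(i : ℤ) - (j : ℤ)| := Int.one_le_abs (by omega)
        exact_mod_cast h2
      have hdiff : DiffContOnCl ℂ (fun z => (∏ j ∈ Finset.univ.erase i, (z - ray N ε j)) *
          f (Function.update (ray N ε) i z)) (Metric.ball (ray N ε i) ‖ε‖) := by
        refine DifferentiableOn.diffContOnCl fun z hz => ?_
        rw [closure_ball _ he.ne', Metric.mem_closedBall, dist_eq_norm] at hz
        have hz1 := hdist i z hz
        have hz2 := (hball (y := Function.update (ray N ε) i z)
          (by rw [dist_eq_norm]; exact hz1.trans_lt heδ)).1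
        have hd : DifferentiableAt ℂ (fun z => Function.update (ray N ε) i z) z :=
          (hasFDerivAt_update (ray N ε) z).differentiableAt
        have h4 : DifferentiableAt ℂ (fun z => ∏ j ∈ Finset.univ.erase i, (z - ray N ε j)) z := by
          fun_prop
        exact (h4.fun_mul (DifferentiableAt.comp z hz2 hd)).differentiableWithinAt
      have hbound : ∀ z ∈ Metric.sphere (ray N ε i) ‖ε‖,
          ‖(∏ j ∈ Finset.univ.erase i, (z - ray N ε j)) * f (Function.update (ray N ε) i z)‖ ≤
          (‖ε‖ * B) ^ (N - 1) * (c * (‖ε‖ * B) ^ k) := by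
        intro z hz
        rw [mem_sphere_iff_norm] at hz
        have hz1 := hdist i z hz.le
        have hz2 := (hball (y := Function.update (ray N ε) i z)
          (by rw [dist_eq_norm]; exact hz1.trans_lt heδ)).2
        rw [norm_mul]
        refine mul_le_mul ?_ (hz2.trans (by gcongr)) (norm_nonneg _) (by positivity)
        rw [norm_prod, ← hcard, ← Finset.prod_const]
        refine Finset.prod_le_prod (fun _ _ => norm_nonneg _) fun j _ => ?_
        have : z - ray N ε j = (z - ray N ε i) + ε * ((i : ℕ) - (j : ℕ)) := by
          rw [← ray_sub_ray]; ring
        rw [this]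
        refine (norm_add_le _ _).trans ?_
        rw [hz, norm_mul]
        have h3 : ‖((i : ℕ) : ℂ) - ((j : ℕ) : ℂ)‖ ≤ N := by
          have : (((i : ℕ) : ℂ) - ((j : ℕ) : ℂ)) = (((i : ℤ) - (j : ℤ) : ℤ) : ℂ) := by
            push_cast; rfl
          rw [this, Complex.norm_intCast]
          have h2 : |(i : ℤ) - (j : ℤ)| ≤ (N : ℤ) := by
            rw [abs_le]
            constructor <;> have := i.2 <;> have := j.2 <;> omega
          exact_mod_cast h2
        rw [hB]
        nlinarith
      -- Cauchy's estimate on a circle of radius ‖ε‖. The powers of ‖ε‖ are -(N-1) from the inverse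
      -- product, N-1 from the product, k from f and -n from the estimate, hence k - n ≥ 0 in total.
      have hcauchy := Complex.norm_iteratedDeriv_le_of_forall_mem_sphere_norm_le n he hdiff hbound
      rw [norm_mul, norm_mul, norm_inv]
      have hinv : ‖∏ j ∈ Finset.univ.erase i, (ray N ε i - ray N ε j)‖⁻¹ ≤ (‖ε‖ ^ (N - 1))⁻¹ :=
        inv_anti₀ (by positivity) hprod
      calc _ ≤ 2 * (‖ε‖ ^ (N - 1))⁻¹ * (n.factorial * ((‖ε‖ * B) ^ (N - 1) *
            (c * (‖ε‖ * B) ^ k)) / ‖ε‖ ^ n) :=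
            mul_le_mul (mul_le_mul (hεp i) hinv (by positivity) (by norm_num)) hcauchy
              (norm_nonneg _) (by positivity)
        _ = 2 * (n.factorial * B ^ (N - 1 + k)) * c * ‖ε‖ ^ (k - n) := by
            have : ‖ε‖ ^ k = ‖ε‖ ^ (k - n) * ‖ε‖ ^ n := by rw [← pow_add]; congr 1; omega
            rw [mul_pow, mul_pow, this, pow_add]
            field_simp
        _ ≤ 2 * (n.factorial * B ^ (N - 1 + k)) * c :=
            mul_le_of_le_one_right (by positivity) (pow_le_one₀ he.le he1.le)
    rw [diffOp]
    refine (norm_sum_le _ _).trans ((Finset.sum_le_sum fun i _ => hterm i).trans ?_)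
    rw [Finset.sum_const, Finset.card_univ, Fintype.card_fin, nsmul_eq_mul, hC]
    linarith
  rw [HasDiffOpValue, tendsto_zero_iff_norm_tendsto_zero, Metric.tendsto_nhds]
  intro e he
  filter_upwards [key (e / (2 * (C + 1))) (by positivity)] with ε hε
  rw [Real.dist_0_eq_abs, abs_of_nonneg (norm_nonneg _)]
  refine hε.trans_lt ?_
  rw [mul_div_assoc', div_lt_iff₀ (by positivity)]
  nlinarith

theorem HasDiffOpValue.congr_of_isLittleO {N n k : ℕ} {q : ℂ} {f g : (Fin N → ℂ) → ℂ} {L : ℂ}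
    (hf : HolNearOne f) (hg : HolNearOne g) (hnk : n ≤ k)
    (ho : (fun u => g u - f u) =o[𝓝 1] fun u => ‖u - 1‖ ^ k) (h : HasDiffOpValue n q f L) :
    HasDiffOpValue n q g L := by
  have hgf : HolNearOne fun u => g u - f u := by
    filter_upwards [hf, hg] with u hu hu' using hu'.fun_sub hu
  have := h.add hf hgf (HasDiffOpValue.of_isLittleO (q := q) hgf hnk ho)
  simpa using this

/-! ### The value on multiplicative functions -/

theorem taylorAt_sum {c : ℂ} {ι : Type*} (s : Finset ι) {f : ι → ℂ → ℂ}
    (hf : ∀ a ∈ s, AnalyticAt ℂ (f a) c) :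
    taylorAt c (fun u => ∑ a ∈ s, f a u) = ∑ a ∈ s, taylorAt c (f a) := by
  ext n
  rw [map_sum, coeff_taylorAt, iteratedDeriv_fun_sum fun a ha => (hf a ha).contDiffAt,
    Finset.sum_div]
  exact Finset.sum_congr rfl fun a _ => (coeff_taylorAt _ _ _).symm

theorem taylorAt_sub_pow (c : ℂ) (m : ℕ) : taylorAt c (fun u => (u - c) ^ m) = PowerSeries.X ^ m := by
  rw [taylorAt_pow ((analyticAt_fun_self c).fun_sub analyticAt_const),
    taylorAt_sub (analyticAt_fun_self c) analyticAt_const, taylorAt_id, taylorAt_const,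
    add_sub_cancel_left]

/-- Split each factor as (z - c) + (c - x_j); J is the set of factors that contribute z - c. -/
theorem iteratedDeriv_prod_sub {ι : Type*} [DecidableEq ι] (A : Finset ι) (x : ι → ℂ) (c : ℂ)
    (s : ℕ) :
    iteratedDeriv s (fun z => ∏ j ∈ A, (z - x j)) c =
      s.factorial * ∑ J ∈ A.powersetCard s, ∏ j ∈ A \ J, (c - x j) := by
  have e : (fun z => ∏ j ∈ A, (z - x j)) =
      fun z => ∑ J ∈ A.powerset, (∏ j ∈ A \ J, (c - x j)) * (z - c) ^ J.card := by
    funext z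
    have h : ∀ j ∈ A, z - x j = (z - c) + (c - x j) := fun j _ => by ring
    rw [Finset.prod_congr rfl h, Finset.prod_add]
    refine Finset.sum_congr rfl fun J _ => ?_
    rw [Finset.prod_const, mul_comm]
  rw [iteratedDeriv_eq_coeff_taylorAt, e, taylorAt_sum _ fun J _ => by fun_prop, map_sum,
    Finset.powersetCard_eq_filter, Finset.sum_filter]
  congr 1
  refine Finset.sum_congr rfl fun J _ => ?_
  rw [taylorAt_const_mul, taylorAt_sub_pow, PowerSeries.coeff_C_mul, PowerSeries.coeff_X_pow]
  by_cases h : s = J.card <;> simp [h, eq_comm]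

theorem sum_sum_powersetCard_erase {ι M : Type*} [Fintype ι] [DecidableEq ι] [AddCommMonoid M]
    (s : ℕ) (F : ι → Finset ι → M) :
    ∑ i, ∑ J ∈ (Finset.univ.erase i).powersetCard s, F i J =
      ∑ K ∈ Finset.univ.powersetCard (s + 1), ∑ i ∈ K, F i (K.erase i) := by
  rw [Finset.sum_sigma', Finset.sum_sigma']
  refine Finset.sum_bij' (fun p _ => ⟨insert p.1 p.2, p.1⟩) (fun p _ => ⟨p.2, p.1.erase p.2⟩)
    ?_ ?_ ?_ ?_ ?_
  · rintro ⟨i, J⟩ h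
    simp only [Finset.mem_sigma, Finset.mem_univ, true_and, Finset.mem_powersetCard,
      Finset.subset_univ] at h ⊢
    have hi : i ∉ J := fun hi => Finset.notMem_erase i _ (h.1 hi)
    exact ⟨by rw [Finset.card_insert_of_notMem hi, h.2], Finset.mem_insert_self _ _⟩
  · rintro ⟨K, i⟩ h
    simp only [Finset.mem_sigma, Finset.mem_univ, true_and, Finset.mem_powersetCard,
      Finset.subset_univ] at h ⊢
    exact ⟨Finset.erase_subset_erase _ (Finset.subset_univ _),
      by rw [Finset.card_erase_of_mem h.2, h.1, Nat.add_sub_cancel]⟩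
  · rintro ⟨i, J⟩ h
    simp only [Finset.mem_sigma, Finset.mem_univ, true_and, Finset.mem_powersetCard] at h
    have hi : i ∉ J := fun hi => Finset.notMem_erase i _ (h.1 hi)
    simp [Finset.erase_insert hi]
  · rintro ⟨K, i⟩ h
    simp only [Finset.mem_sigma] at h
    simp [Finset.insert_erase h.2]
  · rintro ⟨i, J⟩ h
    simp only [Finset.mem_sigma, Finset.mem_univ, true_and, Finset.mem_powersetCard] at h
    have hi : i ∉ J := fun hi => Finset.notMem_erase i _ (h.1 hi)
    simp [Finset.erase_insert hi]

/-- Leibniz' rule puts s derivatives on the Vandermonde factor and n - s on g. After division by the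
full product only the differences over an s-element set J remain in the denominator, and grouping
the pairs (i, J) by K = J ∪ {i} exhibits divided differences of u^{n-q} g^{(n-s)}/g over K. -/
theorem diffOp_prod {N : ℕ} (n : ℕ) (q : ℂ) {g : ℂ → ℂ} {u : Fin N → ℂ}
    (hu : ∀ i j, i ≠ j → u i - u j ≠ 0) (hg : ∀ i, AnalyticAt ℂ g (u i)) (hg0 : ∀ i, g (u i) ≠ 0) :
    diffOp n q (fun u => ∏ j, g (u j)) u = (∏ j, g (u j)) * ∑ s ∈ Finset.range (n + 1),
      (n.choose s : ℂ) * s.factorial * ∑ K ∈ Finset.univ.powersetCard (s + 1), ∑ i ∈ K,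
        (u i ^ ((n : ℂ) - q) * (iteratedDeriv (n - s) g (u i) / g (u i))) *
          (∏ j ∈ K.erase i, (u i - u j))⁻¹ := by
  have hterm : ∀ i : Fin N, u i ^ ((n : ℂ) - q) * (∏ j ∈ Finset.univ.erase i, (u i - u j))⁻¹ *
      iteratedDeriv n (fun z => (∏ j ∈ Finset.univ.erase i, (z - u j)) *
        ∏ j, g (Function.update u i z j)) (u i) =
      ∑ s ∈ Finset.range (n + 1), ∑ J ∈ (Finset.univ.erase i).powersetCard s,
        ((∏ j, g (u j)) * ((n.choose s : ℂ) * s.factorial *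
        ((u i ^ ((n : ℂ) - q) * (iteratedDeriv (n - s) g (u i) / g (u i))) *
          (∏ j ∈ J, (u i - u j))⁻¹))) := by
    intro i
    have e : (fun z => (∏ j ∈ Finset.univ.erase i, (z - u j)) *
        ∏ j, g (Function.update u i z j)) = fun z => (∏ j ∈ Finset.univ.erase i, (z - u j)) *
        (g z * ∏ j ∈ Finset.univ.erase i, g (u j)) := by
      funext z
      rw [← Finset.mul_prod_erase _ _ (Finset.mem_univ i), Function.update_self]
      congr 2
      refine Finset.prod_congr rfl fun j hj => ?_
      rw [Function.update_of_ne (Finset.ne_of_mem_erase hj)]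
    have hP : AnalyticAt ℂ (fun z => ∏ j ∈ Finset.univ.erase i, (z - u j)) (u i) := by fun_prop
    rw [e, iteratedDeriv_fun_mul hP.contDiffAt ((hg i).fun_mul analyticAt_const).contDiffAt,
      Finset.mul_sum]
    refine Finset.sum_congr rfl fun s _ => ?_
    rw [iteratedDeriv_prod_sub, iteratedDeriv_mul_const_field, Finset.mul_sum,
      Finset.mul_sum, Finset.sum_mul, Finset.mul_sum]
    refine Finset.sum_congr rfl fun J hJ => ?_
    have hsub := (Finset.mem_powersetCard.1 hJ).1
    have hA : ∏ j ∈ Finset.univ.erase i, (u i - u j) ≠ 0 :=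
      Finset.prod_ne_zero_iff.2 fun j hj => hu _ _ (Finset.ne_of_mem_erase hj).symm
    have hJ0 : ∏ j ∈ J, (u i - u j) ≠ 0 :=
      Finset.prod_ne_zero_iff.2 fun j hj => hu _ _ (Finset.ne_of_mem_erase (hsub hj)).symm
    rw [← Finset.mul_prod_erase Finset.univ (fun j => g (u j)) (Finset.mem_univ i)]
    have h2 := Finset.prod_sdiff (f := fun j => u i - u j) hsub
    rw [← h2] at hA ⊢
    have hA' := left_ne_zero_of_mul hA
    have hgi := hg0 i
    field_simp
  rw [diffOp, Finset.sum_congr rfl fun i _ => hterm i, Finset.sum_comm, Finset.mul_sum]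
  refine Finset.sum_congr rfl fun s _ => ?_
  rw [sum_sum_powersetCard_erase]
  simp only [Finset.mul_sum]

theorem AnalyticAt.exists_eq_taylorAt_add_pow_mul {w : ℂ → ℂ} (hw : AnalyticAt ℂ w 0) (s : ℕ) :
    ∃ v : ℂ → ℂ, AnalyticAt ℂ v 0 ∧ v 0 = PowerSeries.coeff s (taylorAt 0 w) ∧
      ∀ z, w z = ∑ m ∈ Finset.range s, PowerSeries.coeff m (taylorAt 0 w) * z ^ m + z ^ s * v z := by
  induction s generalizing w with
  | zero =>
    refine ⟨w, hw, ?_, fun z => by simp⟩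
    rw [PowerSeries.coeff_zero_eq_constantCoeff_apply, constantCoeff_taylorAt]
  | succ s ih =>
    obtain ⟨v, hv, hwv, hcoeff⟩ := hw.exists_eq_add_mul
    obtain ⟨r, hr, hr0, hvr⟩ := ih hv
    refine ⟨r, hr, by rw [hr0, hcoeff], fun z => ?_⟩
    rw [hwv z, hvr z, Finset.sum_range_succ', PowerSeries.coeff_zero_eq_constantCoeff_apply,
      constantCoeff_taylorAt]
    simp only [hcoeff, mul_add, Finset.mul_sum, pow_zero, mul_one, pow_succ]
    rw [Finset.sum_congr rfl fun m _ => (by ring :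
      z * (PowerSeries.coeff (m + 1) (taylorAt 0 w) * z ^ m) =
        PowerSeries.coeff (m + 1) (taylorAt 0 w) * (z ^ m * z))]
    ring

theorem taylorAt_comp_const_add (c : ℂ) (f : ℂ → ℂ) :
    taylorAt 0 (fun z => f (c + z)) = taylorAt c f := by
  ext n
  rw [coeff_taylorAt, coeff_taylorAt, iteratedDeriv_comp_const_add]
  simp

/-- The left side is the coefficient of degree |K| - 1 of the Lagrange interpolant of x^m, which is
x^m itself because m < |K|. -/
theorem sum_pow_div_prod {ι : Type*} [DecidableEq ι] {K : Finset ι} {x : ι → ℂ}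
    (hx : Set.InjOn x K) {m : ℕ} (hm : m < K.card) :
    ∑ i ∈ K, x i ^ m * (∏ j ∈ K.erase i, (x i - x j))⁻¹ = if m = K.card - 1 then 1 else 0 := by
  have h := Lagrange.coeff_eq_sum hx (P := (X : ℂ[X]) ^ m) (by
    rw [degree_X_pow]; exact_mod_cast hm)
  rw [coeff_X_pow] at h
  simp only [eval_pow, eval_X, div_eq_mul_inv] at h
  rw [← h]
  simp [eq_comm]

/-- Divided differences of a function at confluent nodes. -/
theorem tendsto_dividedDifference {N s : ℕ} {h : ℂ → ℂ} (hh : AnalyticAt ℂ h 1)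
    {K : Finset (Fin N)} (hK : K.card = s + 1) :
    Tendsto (fun ε => ∑ i ∈ K, h (ray N ε i) * (∏ j ∈ K.erase i, (ray N ε i - ray N ε j))⁻¹)
      (𝓝[≠] 0) (𝓝 (iteratedDeriv s h 1 / s.factorial)) := by
  have hw : AnalyticAt ℂ (fun z => h (1 + z)) 0 :=
    AnalyticAt.fun_comp (by simpa using hh) (analyticAt_const.fun_add (analyticAt_fun_self 0))
  -- Taylor terms of degree below s have divided difference exactly 0 for every ε ≠ 0. In the
  -- remainder z^s v(z) the powers of ε cancel, leaving v(0) in the limit.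
  obtain ⟨v, hv, hv0, hwv⟩ := hw.exists_eq_taylorAt_add_pow_mul s
  rw [taylorAt_comp_const_add] at hv0 hwv
  set x : Fin N → ℂ := fun i => ((i : ℕ) : ℂ) with hxdef
  have hx : Set.InjOn x K := fun i _ j _ hij => Fin.ext (Nat.cast_injective (R := ℂ) hij)
  have h1 : Tendsto (fun ε => ∑ i ∈ K, v (ε * x i) * (x i ^ s * (∏ j ∈ K.erase i, (x i - x j))⁻¹))
      (𝓝[≠] 0) (𝓝 (∑ i ∈ K, v 0 * (x i ^ s * (∏ j ∈ K.erase i, (x i - x j))⁻¹))) := by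
    refine tendsto_finsetSum _ fun i _ => Tendsto.mul_const _ ?_
    have : Tendsto (fun ε : ℂ => ε * x i) (𝓝[≠] 0) (𝓝 0) := by
      have h2 : Continuous fun ε : ℂ => ε * x i := by fun_prop
      have h3 := h2.tendsto 0
      rw [zero_mul] at h3
      exact h3.mono_left nhdsWithin_le_nhds
    exact hv.continuousAt.tendsto.comp this
  rw [← Finset.mul_sum, sum_pow_div_prod hx (by omega), if_pos (by omega), mul_one, hv0,
    coeff_taylorAt] at h1
  refine h1.congr' ?_
  filter_upwards [self_mem_nhdsWithin] with ε hε
  have hε0 : ε ≠ 0 := hε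
  have hp : ∀ i ∈ K, (∏ j ∈ K.erase i, (ray N ε i - ray N ε j))⁻¹ =
      (ε ^ s)⁻¹ * (∏ j ∈ K.erase i, (x i - x j))⁻¹ := by
    intro i hi
    simp only [ray_sub_ray]
    rw [Finset.prod_mul_distrib, Finset.prod_const, Finset.card_erase_of_mem hi, hK,
      Nat.add_sub_cancel, mul_inv]
  have hterm : ∀ i ∈ K, h (ray N ε i) * (∏ j ∈ K.erase i, (ray N ε i - ray N ε j))⁻¹ =
      (∑ m ∈ Finset.range s, PowerSeries.coeff m (taylorAt 1 h) * (ε ^ m * (ε ^ s)⁻¹) *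
        (x i ^ m * (∏ j ∈ K.erase i, (x i - x j))⁻¹)) +
      v (ε * x i) * (x i ^ s * (∏ j ∈ K.erase i, (x i - x j))⁻¹) := by
    intro i hi
    have := hwv (ε * x i)
    rw [hp i hi, show h (ray N ε i) = h (1 + ε * x i) from rfl, this, add_mul, Finset.sum_mul]
    congr 1
    · refine Finset.sum_congr rfl fun m _ => ?_
      rw [mul_pow]
      ring
    · rw [mul_pow]
      field_simp
  rw [Finset.sum_congr rfl hterm, Finset.sum_add_distrib, Finset.sum_comm,
    Finset.sum_eq_zero (s := Finset.range s), zero_add]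
  intro m hm
  have hm' := Finset.mem_range.1 hm
  rw [← Finset.mul_sum, sum_pow_div_prod hx (by omega), if_neg (by omega), mul_zero]

theorem hasDiffOpValue_prod (N n : ℕ) (q : ℂ) {g : ℂ → ℂ} (hg : AnalyticAt ℂ g 1) (h1 : g 1 = 1) :
    HasDiffOpValue n q (fun u : Fin N → ℂ => ∏ j, g (u j)) (productValue N n q g) := by
  have hne : g 1 ≠ 0 := by rw [h1]; exact one_ne_zero
  have hray : ∀ i, Tendsto (fun ε => ray N ε i) (𝓝[≠] 0) (𝓝 1) := fun i =>
    ((continuous_apply i).tendsto (1 : Fin N → ℂ)).comp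
      ((tendsto_ray N).mono_left nhdsWithin_le_nhds)
  have hprod : Tendsto (fun ε => ∏ j, g (ray N ε j)) (𝓝[≠] 0) (𝓝 1) := by
    have : Tendsto (fun ε => ∏ j, g (ray N ε j)) (𝓝[≠] 0) (𝓝 (∏ _j : Fin N, g 1)) :=
      tendsto_finsetProd _ fun j _ => hg.continuousAt.tendsto.comp (hray j)
    simpa [h1] using this
  have hsum : Tendsto (fun ε => ∑ s ∈ Finset.range (n + 1), (n.choose s : ℂ) * s.factorial *
      ∑ K ∈ Finset.univ.powersetCard (s + 1), ∑ i ∈ K,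
        (ray N ε i ^ ((n : ℂ) - q) * (iteratedDeriv (n - s) g (ray N ε i) / g (ray N ε i))) *
          (∏ j ∈ K.erase i, (ray N ε i - ray N ε j))⁻¹) (𝓝[≠] 0)
      (𝓝 (productValue N n q g)) := by
    refine tendsto_finsetSum _ fun s _ => ?_
    have hh : AnalyticAt ℂ (fun u => u ^ ((n : ℂ) - q) * (iteratedDeriv (n - s) g u / g u)) 1 :=
      (analyticAt_cpow_one _).fun_mul ((analyticAt_iteratedDeriv hg _).fun_div hg hne)
    have h2 := (tendsto_finsetSum (Finset.univ.powersetCard (s + 1)) fun K hK =>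
      tendsto_dividedDifference (N := N) hh (Finset.mem_powersetCard.1 hK).2).const_mul
        ((n.choose s : ℂ) * s.factorial)
    -- The confluent limit depends only on |K| = s + 1, so the sum over K contributes the factor
    -- binom(N, s+1).
    rw [Finset.sum_const, Finset.card_powersetCard, Finset.card_univ, Fintype.card_fin,
      nsmul_eq_mul] at h2
    convert h2 using 2
    have hf : (s.factorial : ℂ) ≠ 0 := by exact_mod_cast s.factorial_ne_zero
    field_simp
  have h3 := hprod.mul hsum
  rw [one_mul] at h3
  refine h3.congr' ?_
  have hga : ∀ᶠ ε in 𝓝[≠] (0 : ℂ), ∀ i, AnalyticAt ℂ g (ray N ε i) ∧ g (ray N ε i) ≠ 0 :=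
    eventually_all.2 fun i => (hray i).eventually
      (hg.eventually_analyticAt.and (hg.continuousAt.eventually_ne hne))
  filter_upwards [self_mem_nhdsWithin, hga] with ε hε hgε
  exact (diffOp_prod n q (fun i j hij => ray_sub_ray_ne_zero hε hij) (fun i => (hgε i).1)
    fun i => (hgε i).2).symm

theorem holNearOne_prod (N : ℕ) {g : ℂ → ℂ} (hg : AnalyticAt ℂ g 1) :
    HolNearOne fun u : Fin N → ℂ => ∏ j, g (u j) := by
  have : ∀ᶠ u in 𝓝 (1 : Fin N → ℂ), ∀ j, AnalyticAt ℂ g (u j) :=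
    eventually_all.2 fun j => ((continuous_apply j).tendsto (1 : Fin N → ℂ)).eventually
      hg.eventually_analyticAt
  filter_upwards [this] with u hu
  have hd : ∀ j, DifferentiableAt ℂ (fun u : Fin N → ℂ => g (u j)) u := fun j =>
    DifferentiableAt.comp u (hu j).differentiableAt (differentiableAt_apply j u)
  fun_prop

/-! ### The value on characters -/

/-- `∏_{i<j} (uᵢ - uⱼ)`. -/
noncomputable def vandermondeProd {N : ℕ} (u : Fin N → ℂ) : ℂ :=
  ∏ p : Fin N × Fin N with p.1 < p.2, (u p.1 - u p.2)

theorem vandermondeProd_ne_zero {N : ℕ} {u : Fin N → ℂ} (hu : ∀ i j, i ≠ j → u i - u j ≠ 0) :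
    vandermondeProd u ≠ 0 :=
  Finset.prod_ne_zero_iff.2 fun _ hp => hu _ _ (Finset.mem_filter.1 hp).2.ne

theorem det_vandermonde_eq_vandermondeProd {N : ℕ} (u : Fin N → ℂ) :
    (Matrix.vandermonde u).det =
      (-1) ^ (Finset.univ.filter fun p : Fin N × Fin N => p.1 < p.2).card * vandermondeProd u := by
  rw [Matrix.det_vandermonde, vandermondeProd, ← Finset.prod_const, ← Finset.prod_mul_distrib,
    Finset.prod_filter, Fintype.prod_prod_type]
  refine Finset.prod_congr rfl fun i _ => ?_
  rw [← Finset.prod_filter]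
  refine Finset.prod_congr (by ext; simp) fun j _ => by ring

/-- As a function of its i-th variable, V is a constant times the factors involving that variable.
This justifies keeping only those factors in `diffOp`; the constant also collects the signs of the
pairs (j, i) with j < i. -/
theorem exists_vandermondeProd_update {N : ℕ} {u : Fin N → ℂ}
    (hu : ∀ i j, i ≠ j → u i - u j ≠ 0) (i : Fin N) :
    ∃ c : ℂ, c ≠ 0 ∧ ∀ z, vandermondeProd (Function.update u i z) =
      c * ∏ j ∈ Finset.univ.erase i, (z - u j) := by
  set S := Finset.univ.filter fun p : Fin N × Fin N => p.1 < p.2 with hS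
  refine ⟨(∏ p ∈ S.filter (fun p => ¬ (p.1 = i ∨ p.2 = i)), (u p.1 - u p.2)) *
    ∏ j ∈ Finset.univ.erase i, if i < j then 1 else -1, mul_ne_zero ?_ ?_, fun z => ?_⟩
  · exact Finset.prod_ne_zero_iff.2 fun p hp =>
      hu _ _ (Finset.mem_filter.1 (Finset.mem_filter.1 hp).1).2.ne
  · refine Finset.prod_ne_zero_iff.2 fun j _ => ?_
    split_ifs <;> simp
  · rw [vandermondeProd, ← Finset.prod_filter_mul_prod_filter_not S (fun p => p.1 = i ∨ p.2 = i),
      mul_comm, mul_assoc, ← Finset.prod_mul_distrib]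
    congr 1
    · refine Finset.prod_congr rfl fun p hp => ?_
      have h := (Finset.mem_filter.1 hp).2
      rw [not_or] at h
      rw [Function.update_of_ne h.1, Function.update_of_ne h.2]
    · refine Finset.prod_bij' (fun p _ => if p.1 = i then p.2 else p.1)
        (fun j _ => if i < j then (i, j) else (j, i)) ?_ ?_ ?_ ?_ ?_
      · rintro ⟨a, b⟩ hp
        simp only [hS, Finset.mem_filter, Finset.mem_univ, true_and] at hp
        simp only [Finset.mem_erase, Finset.mem_univ, and_true]
        split_ifs with h
        · subst h; exact hp.1.ne'
        · exact h
      · intro j hj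
        have hji := Finset.ne_of_mem_erase hj
        simp only [hS, Finset.mem_filter, Finset.mem_univ, true_and]
        split_ifs with h
        · exact ⟨h, Or.inl rfl⟩
        · exact ⟨lt_of_le_of_ne (not_lt.1 h) hji, Or.inr rfl⟩
      · rintro ⟨a, b⟩ hp
        simp only [hS, Finset.mem_filter, Finset.mem_univ, true_and] at hp
        by_cases h : a = i
        · subst h; simp [hp.1]
        · have hb : b = i := hp.2.resolve_left h
          subst hb
          simp [h, not_lt.2 hp.1.le]
      · intro j hj
        have hji := Finset.ne_of_mem_erase hj
        split_ifs with h <;> simp_all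
      · rintro ⟨a, b⟩ hp
        simp only [hS, Finset.mem_filter, Finset.mem_univ, true_and] at hp
        by_cases h : a = i
        · subst h
          simp [hp.1, Function.update_of_ne hp.1.ne']
        · have hb : b = i := hp.2.resolve_left h
          subst hb
          simp [h, not_lt.2 hp.1.le]

theorem iteratedDeriv_zpow_eq (m : ℤ) (n : ℕ) (x : ℂ) :
    iteratedDeriv n (fun z : ℂ => z ^ m) x = (descPochhammer ℂ n).eval (m : ℂ) * x ^ (m - n) := by
  rw [iteratedDeriv_eq_iterate, iter_deriv_zpow, descPochhammer_eval_eq_prod_range]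

/-- The matrix `(uᵢ ^ mⱼ)`. -/
noncomputable def powerMatrix {N : ℕ} (u : Fin N → ℂ) (m : Fin N → ℂ) :
    Matrix (Fin N) (Fin N) ℂ := Matrix.of fun i j => u i ^ m j

/-- Expand V χ^λ = det(u_i^{m_j}) along row i: each monomial u_i^{m_b} becomes (m_b)_n u_i^{m_b -
q}. For fixed b, summing over i reassembles the expansion along column b of the determinant with m_b
replaced by m_b - q. -/
theorem diffOp_schurChar {N : ℕ} (n : ℕ) (q : ℂ) (lam : Signature N) {u : Fin N → ℂ}
    (hu : ∀ i j, i ≠ j → u i - u j ≠ 0) (hu0 : ∀ i, u i ≠ 0) :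
    vandermondeProd u * diffOp n q (schurChar lam) u =
      ∑ b, (descPochhammer ℂ n).eval (lam.shifted b : ℂ) *
        (powerMatrix u (Function.update (fun j => (lam.shifted j : ℂ)) b
          (lam.shifted b - q))).det := by
  set M : Matrix (Fin N) (Fin N) ℂ := Matrix.of fun i j => u i ^ lam.shifted j with hM
  have hterm : ∀ i, vandermondeProd u * (u i ^ ((n : ℂ) - q) *
      (∏ j ∈ Finset.univ.erase i, (u i - u j))⁻¹ * iteratedDeriv n (fun z =>
        (∏ j ∈ Finset.univ.erase i, (z - u j)) * schurChar lam (Function.update u i z)) (u i)) =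
      ∑ b, (descPochhammer ℂ n).eval (lam.shifted b : ℂ) *
        (M.adjugate b i * u i ^ ((lam.shifted b : ℂ) - q)) := by
    intro i
    obtain ⟨c, hc, hcz⟩ := exists_vandermondeProd_update hu i
    have hV : vandermondeProd u = c * ∏ j ∈ Finset.univ.erase i, (u i - u j) := by
      have := hcz (u i)
      rwa [Function.update_eq_self] at this
    have hP : ∏ j ∈ Finset.univ.erase i, (u i - u j) ≠ 0 :=
      Finset.prod_ne_zero_iff.2 fun j hj => hu _ _ (Finset.ne_of_mem_erase hj).symm
    have he : (fun z => (∏ j ∈ Finset.univ.erase i, (z - u j)) *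
        schurChar lam (Function.update u i z)) =ᶠ[𝓝 (u i)]
        fun z => c⁻¹ * ∑ b, M.adjugate b i * z ^ lam.shifted b := by
      filter_upwards [continuousAt_id.eventually_ne (hu0 i)] with z hz
      have hz' : ∀ j, Function.update u i z j ≠ 0 := by
        intro j
        by_cases h : j = i
        · subst h; rw [Function.update_self]; exact hz
        · rw [Function.update_of_ne h]; exact hu0 j
      have h1 := prod_mul_schurChar lam _ hz'
      have h2 : (Matrix.of fun a b => Function.update u i z a ^ lam.shifted b) =
          M.updateRow i fun b => z ^ lam.shifted b := by
        ext a b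
        by_cases h : a = i
        · subst h; simp
        · simp [hM, Matrix.updateRow_ne h, Function.update_of_ne h]
      have h3 : (M.updateRow i fun b => z ^ lam.shifted b).det =
          ∑ b, M.adjugate b i * z ^ lam.shifted b := by
        rw [← Matrix.cramer_transpose_apply, Matrix.cramer_eq_adjugate_mulVec,
          ← Matrix.adjugate_transpose]
        rfl
      rw [h2, h3] at h1
      have h4 := hcz z
      rw [vandermondeProd] at h4
      rw [h4] at h1
      rw [← h1]
      field_simp
    rw [he.iteratedDeriv_eq, iteratedDeriv_const_mul_field, iteratedDeriv_fun_sum, hV,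
      Finset.mul_sum, Finset.mul_sum, Finset.mul_sum]
    · refine Finset.sum_congr rfl fun b _ => ?_
      rw [iteratedDeriv_const_mul_field, iteratedDeriv_zpow_eq]
      have hpow : u i ^ ((n : ℂ) - q) * u i ^ (lam.shifted b - n) =
          u i ^ ((lam.shifted b : ℂ) - q) := by
        rw [← Complex.cpow_intCast, ← Complex.cpow_add _ _ (hu0 i)]
        congr 1
        push_cast
        ring
      rw [← hpow]
      field_simp
    · intro b _
      have : AnalyticAt ℂ (fun z : ℂ => z ^ lam.shifted b) (u i) :=
        (analyticAt_fun_self (u i)).fun_zpow (hu0 i)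
      exact (analyticAt_const.fun_mul this).contDiffAt
  rw [diffOp, Finset.mul_sum, Finset.sum_congr rfl fun i _ => hterm i, Finset.sum_comm]
  refine Finset.sum_congr rfl fun b _ => ?_
  rw [← Finset.mul_sum]
  congr 1
  have h2 : powerMatrix u (Function.update (fun j => (lam.shifted j : ℂ)) b
      (lam.shifted b - q)) = M.updateCol b fun i => u i ^ ((lam.shifted b : ℂ) - q) := by
    ext i j
    by_cases h : j = b
    · subst h; simp [powerMatrix]
    · simp [powerMatrix, hM, Matrix.updateCol_ne h, Function.update_of_ne h, Complex.cpow_intCast]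
  rw [h2, ← Matrix.cramer_apply, Matrix.cramer_eq_adjugate_mulVec]
  rfl

/-! ### Confluent limits of generalized Vandermonde determinants. -/

theorem coeff_taylorAt_cpow (j : ℕ) (m : ℂ) :
    PowerSeries.coeff j (taylorAt 1 fun u : ℂ => u ^ m) =
      (descPochhammer ℂ j).eval m / j.factorial := by
  induction j generalizing m with
  | zero =>
    rw [PowerSeries.coeff_zero_eq_constantCoeff_apply, constantCoeff_taylorAt]
    simp
  | succ j ih =>
    have h := congrArg (PowerSeries.coeff j) (derivative_taylorAt_cpow m)
    rw [PowerSeries.coeff_derivative, PowerSeries.coeff_C_mul, ih] at h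
    have hj : (j : ℂ) + 1 ≠ 0 := by exact_mod_cast j.succ_ne_zero
    have hf : (j.factorial : ℂ) ≠ 0 := by exact_mod_cast j.factorial_ne_zero
    rw [descPochhammer_succ_left, Nat.factorial_succ, eval_mul, eval_X, eval_comp]
    simp only [eval_sub, eval_X, eval_one]
    push_cast
    rw [← eq_div_iff hj] at h
    rw [h]
    field_simp

/-- The matrix of the first Taylor coefficients at `1` of the functions `u ↦ u ^ mⱼ`. -/
noncomputable def binomialMatrix {N : ℕ} (m : Fin N → ℂ) : Matrix (Fin N) (Fin N) ℂ :=
  Matrix.of fun j b => PowerSeries.coeff (j : ℕ) (taylorAt 1 fun u : ℂ => u ^ m b)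

/-- The entry in row j is binom(m_b, j), a polynomial of degree j in m_b with leading coefficient
1/j!, so the determinant reduces to a Vandermonde determinant in the exponents. -/
theorem det_binomialMatrix {N : ℕ} (m : Fin N → ℂ) :
    (binomialMatrix m).det = (∏ j : Fin N, ((j : ℕ).factorial : ℂ)⁻¹) *
      (Matrix.vandermonde m).det := by
  rw [Matrix.det_eval_matrixOfPolynomials_eq_det_vandermonde m
    (fun j => descPochhammer ℂ j) (fun j => descPochhammer_natDegree ℂ j)
    (fun j => monic_descPochhammer ℂ j), ← Matrix.det_transpose (binomialMatrix m),
    ← Matrix.det_mul_row]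
  congr 1
  ext i j
  simp only [Matrix.transpose_apply, binomialMatrix, Matrix.of_apply, coeff_taylorAt_cpow]
  ring

/-- With x_a = a, the expansion (1 + ε x_a)^{m_b} = ∑_j x_a^j ε^j binom(m_b, j) + O(ε^N) factors the
matrix as Vandermonde × diag(ε^j) × (binomial matrix + o(1)). -/
theorem tendsto_det_powerMatrix {N : ℕ} (m : Fin N → ℂ) :
    Tendsto (fun ε => (∏ j : Fin N, ε ^ (j : ℕ))⁻¹ * (powerMatrix (ray N ε) m).det) (𝓝[≠] 0)
      (𝓝 ((Matrix.vandermonde fun i : Fin N => ((i : ℕ) : ℂ)).det * (binomialMatrix m).det)) := by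
  set x : Fin N → ℂ := fun i => ((i : ℕ) : ℂ) with hx
  have hdet : IsUnit (Matrix.vandermonde x).det := by
    rw [isUnit_iff_ne_zero, Matrix.det_vandermonde_ne_zero_iff]
    exact fun i j hij => Fin.ext (Nat.cast_injective (R := ℂ) hij)
  have hw : ∀ b, AnalyticAt ℂ (fun z : ℂ => (1 + z) ^ m b) 0 := fun b =>
    AnalyticAt.fun_comp (g := fun u : ℂ => u ^ m b) (by simpa using analyticAt_cpow_one (m b))
      (analyticAt_const.fun_add (analyticAt_fun_self 0))
  choose v hv _ hwv using fun b => (hw b).exists_eq_taylorAt_add_pow_mul N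
  have hcoeff : ∀ b, taylorAt 0 (fun z : ℂ => (1 + z) ^ m b) = taylorAt 1 fun u => u ^ m b := fun b =>
    taylorAt_comp_const_add 1 fun u => u ^ m b
  set R : ℂ → Matrix (Fin N) (Fin N) ℂ := fun ε => Matrix.of fun a b => x a ^ N * v b (ε * x a)
    with hR
  have hRlim : Tendsto R (𝓝 0) (𝓝 (R 0)) := by
    refine tendsto_pi_nhds.2 fun a => tendsto_pi_nhds.2 fun b => ?_
    have h2 : Tendsto (fun ε : ℂ => ε * x a) (𝓝 0) (𝓝 (0 * x a)) :=
      (continuous_mul_const (x a)).tendsto 0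
    have h3 : ContinuousAt (v b) (0 * x a) := by rw [zero_mul]; exact (hv b).continuousAt
    exact (h3.tendsto.comp h2).const_mul _
  -- Writing the remainder as Vandermonde × Y moves it behind diag(ε^j), where its row j carries
  -- ε^{N-j}; this tends to 0 because j < N.
  set Y : ℂ → Matrix (Fin N) (Fin N) ℂ := fun ε => (Matrix.vandermonde x)⁻¹ * R ε with hY
  have hYlim : Tendsto Y (𝓝 0) (𝓝 (Y 0)) :=
    ((continuous_const.matrix_mul continuous_id).tendsto (R 0)).comp hRlim
  set T : ℂ → Matrix (Fin N) (Fin N) ℂ := fun ε =>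
    Matrix.of fun j b => binomialMatrix m j b + ε ^ (N - (j : ℕ)) * Y ε j b with hT
  have hTlim : Tendsto T (𝓝 0) (𝓝 (binomialMatrix m)) := by
    refine tendsto_pi_nhds.2 fun j => tendsto_pi_nhds.2 fun b => ?_
    have h1 : Tendsto (fun ε : ℂ => ε ^ (N - (j : ℕ))) (𝓝 0) (𝓝 0) := by
      have := (continuous_pow (M := ℂ) (N - (j : ℕ))).tendsto 0
      rwa [zero_pow (by have := j.2; omega)] at this
    have h2 := (tendsto_pi_nhds.1 (tendsto_pi_nhds.1 hYlim j) b)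
    have h3 := (h1.mul h2).const_add (binomialMatrix m j b)
    rw [zero_mul, add_zero] at h3
    exact h3
  have hdetT : Tendsto (fun ε => (Matrix.vandermonde x).det * (T ε).det) (𝓝[≠] 0)
      (𝓝 ((Matrix.vandermonde x).det * (binomialMatrix m).det)) :=
    ((((continuous_id.matrix_det).tendsto (binomialMatrix m)).comp hTlim).mono_left
      nhdsWithin_le_nhds).const_mul _
  refine hdetT.congr' ?_
  filter_upwards [self_mem_nhdsWithin] with ε hε
  have hε0 : ε ≠ 0 := hε
  have hXY : Matrix.vandermonde x * Y ε = R ε := by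
    rw [hY]
    exact Matrix.mul_nonsing_inv_cancel_left _ _ hdet
  have hfac : powerMatrix (ray N ε) m =
      Matrix.vandermonde x * (Matrix.diagonal (fun j : Fin N => ε ^ (j : ℕ)) * T ε) := by
    ext a b
    have h1 : powerMatrix (ray N ε) m a b = (1 + ε * x a) ^ m b := rfl
    have h2 := congrFun (congrFun hXY a) b
    rw [Matrix.mul_apply] at h2
    have h3 : (R ε) a b = x a ^ N * v b (ε * x a) := rfl
    rw [h1, hwv b (ε * x a), hcoeff, mul_pow, mul_assoc, ← h3, ← h2, Matrix.mul_apply,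
      Finset.mul_sum, ← Fin.sum_univ_eq_sum_range (fun m' => PowerSeries.coeff m'
        (taylorAt 1 fun u => u ^ m b) * (ε * x a) ^ m'), ← Finset.sum_add_distrib]
    refine Finset.sum_congr rfl fun j _ => ?_
    rw [Matrix.diagonal_mul]
    have h4 : ε ^ N = ε ^ (j : ℕ) * ε ^ (N - (j : ℕ)) := by
      rw [← pow_add]; congr 1; have := j.2; omega
    simp only [hT, Matrix.of_apply, Matrix.vandermonde_apply, binomialMatrix]
    rw [h4, mul_pow]
    ring
  have hprod : ∏ j : Fin N, ε ^ (j : ℕ) ≠ 0 :=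
    Finset.prod_ne_zero_iff.2 fun j _ => pow_ne_zero _ hε0
  rw [hfac, Matrix.det_mul, Matrix.det_mul, Matrix.det_diagonal]
  field_simp

theorem Signature.shifted_ne {N : ℕ} (lam : Signature N) {i j : Fin N} (h : i ≠ j) :
    lam.shifted i ≠ lam.shifted j := by
  have key : ∀ i j : Fin N, i < j → lam.shifted j < lam.shifted i := by
    intro i j hij
    have h1 := lam.2 hij.le
    have h2 : (i : ℕ) < (j : ℕ) := hij
    unfold Signature.shifted
    omega
  rcases lt_or_gt_of_ne h with h | h
  · exact (key i j h).ne'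
  · exact (key j i h).ne

theorem Signature.shifted_sub_ne_zero {N : ℕ} (lam : Signature N) (i j : Fin N) (h : i ≠ j) :
    (lam.shifted i : ℂ) - lam.shifted j ≠ 0 := by
  rw [sub_ne_zero]
  exact_mod_cast lam.shifted_ne h

/-- Only the factors containing m_b change, and their quotients are those of the deformed weight. -/
theorem det_vandermonde_update_shifted {N : ℕ} (q : ℝ) (lam : Signature N) (b : Fin N) :
    (Matrix.vandermonde (Function.update (fun j => (lam.shifted j : ℂ)) b
      (lam.shifted b - q))).det =
      (ppWeight q lam b : ℂ) * (Matrix.vandermonde fun j => (lam.shifted j : ℂ)).det := by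
  obtain ⟨c, hc, hcz⟩ := exists_vandermondeProd_update lam.shifted_sub_ne_zero b
  have h1 := hcz (lam.shifted b)
  rw [Function.update_eq_self] at h1
  rw [det_vandermonde_eq_vandermondeProd, det_vandermonde_eq_vandermondeProd, hcz, h1, ppWeight]
  push_cast
  rw [Finset.prod_div_distrib]
  have hP : ∏ j ∈ Finset.univ.erase b, ((lam.shifted b : ℂ) - lam.shifted j) ≠ 0 :=
    Finset.prod_ne_zero_iff.2 fun j hj =>
      lam.shifted_sub_ne_zero _ _ (Finset.ne_of_mem_erase hj).symm
  have e : ∀ j ∈ Finset.univ.erase b, ((lam.shifted b : ℂ) - q - lam.shifted j) =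
      (lam.shifted b : ℂ) - lam.shifted j - q := fun j _ => by ring
  rw [Finset.prod_congr rfl e]
  field_simp

theorem det_vandermonde_shifted_ne_zero {N : ℕ} (lam : Signature N) :
    (Matrix.vandermonde fun j => (lam.shifted j : ℂ)).det ≠ 0 := by
  rw [Matrix.det_vandermonde_ne_zero_iff]
  intro i j hij
  by_contra h
  exact lam.shifted_ne h (Int.cast_injective (α := ℂ) hij)

theorem analyticAt_schurChar {N : ℕ} (lam : Signature N) {u : Fin N → ℂ} (hu : ∀ i, u i ≠ 0) :
    AnalyticAt ℂ (schurChar lam) u := by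
  unfold schurChar
  refine AnalyticAt.fun_div (AnalyticOnNhd.eval_mvPolynomial _ u (Set.mem_univ u)) ?_
    (pow_ne_zero _ (Finset.prod_ne_zero_iff.2 fun i _ => hu i))
  exact (Finset.analyticAt_fun_prod _ fun i _ =>
    (ContinuousLinearMap.proj (R := ℂ) (φ := fun _ : Fin N => ℂ) i).analyticAt u).fun_pow _

theorem eventually_ray_ne_zero (N : ℕ) : ∀ᶠ ε in 𝓝[≠] (0 : ℂ), ∀ i, ray N ε i ≠ 0 := by
  refine eventually_all.2 fun i => ?_
  have h : Tendsto (fun ε => ray N ε i) (𝓝[≠] 0) (𝓝 1) :=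
    ((continuous_apply i).tendsto (1 : Fin N → ℂ)).comp
      ((tendsto_ray N).mono_left nhdsWithin_le_nhds)
  exact h.eventually_ne one_ne_zero

theorem vandermondeProd_mul_schurChar {N : ℕ} (lam : Signature N) {u : Fin N → ℂ}
    (hu : ∀ i, u i ≠ 0) :
    vandermondeProd u * schurChar lam u = (powerMatrix u fun j => (lam.shifted j : ℂ)).det := by
  rw [vandermondeProd, prod_mul_schurChar lam u hu]
  congr 1
  ext i j
  simp [powerMatrix, Complex.cpow_intCast]

theorem det_vandermonde_natCast_ne_zero (N : ℕ) :
    (Matrix.vandermonde fun i : Fin N => ((i : ℕ) : ℂ)).det ≠ 0 := by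
  rw [Matrix.det_vandermonde_ne_zero_iff]
  exact fun i j hij => Fin.ext (Nat.cast_injective (R := ℂ) hij)

theorem det_binomialMatrix_ne_zero {N : ℕ} {m : Fin N → ℂ}
    (hm : (Matrix.vandermonde m).det ≠ 0) : (binomialMatrix m).det ≠ 0 := by
  rw [det_binomialMatrix]
  refine mul_ne_zero (Finset.prod_ne_zero_iff.2 fun j _ => inv_ne_zero ?_) hm
  exact_mod_cast (j : ℕ).factorial_ne_zero

theorem tendsto_schurChar_ray {N : ℕ} (lam : Signature N) :
    Tendsto (fun ε => schurChar lam (ray N ε)) (𝓝[≠] 0) (𝓝 (schurChar lam 1)) :=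
  (analyticAt_schurChar lam fun _ => one_ne_zero).continuousAt.tendsto.comp
    ((tendsto_ray N).mono_left nhdsWithin_le_nhds)

/-- V and V χ^λ vanish to the same order along the ray: after division by the same power of ε both
have nonzero limits, because the exponents m_j are distinct. If χ^λ(1) were 0, the second limit
would be 0. -/
theorem schurChar_one_ne_zero {N : ℕ} (lam : Signature N) : schurChar lam 1 ≠ 0 := by
  intro h0
  have h1 := tendsto_det_powerMatrix fun j : Fin N => (lam.shifted j : ℂ)
  -- The exponents 0, …, N-1 give the Vandermonde determinant itself, which is V up to sign.
  have h2 := tendsto_det_powerMatrix fun j : Fin N => ((j : ℕ) : ℂ)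
  have h3 := h2.mul (tendsto_schurChar_ray lam)
  rw [h0, mul_zero] at h3
  have h4 := h1.const_mul
    ((-1 : ℂ) ^ (Finset.univ.filter fun p : Fin N × Fin N => p.1 < p.2).card)
  refine mul_ne_zero (pow_ne_zero _ (by norm_num : (-1 : ℂ) ≠ 0)) (mul_ne_zero
    (det_vandermonde_natCast_ne_zero N)
    (det_binomialMatrix_ne_zero (det_vandermonde_shifted_ne_zero lam)))
    (tendsto_nhds_unique h4 (h3.congr' ?_))
  filter_upwards [eventually_ray_ne_zero N] with ε hε
  have h5 : powerMatrix (ray N ε) (fun j : Fin N => ((j : ℕ) : ℂ)) =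
      Matrix.vandermonde (ray N ε) := by
    ext i j
    simp [powerMatrix, Matrix.vandermonde_apply]
  rw [h5, det_vandermonde_eq_vandermondeProd, ← vandermondeProd_mul_schurChar lam hε]
  ring

theorem holNearOne_schurChar {N : ℕ} (lam : Signature N) : HolNearOne (schurChar lam) :=
  ((analyticAt_schurChar lam fun _ => one_ne_zero).eventually_analyticAt).mono
    fun _ h => h.differentiableAt

/-- In the quotient of the shifted determinant by the original one, the power of ε, the Vandermonde
determinant of the ray and the factorials cancel, leaving the Vandermonde quotient that defines the
weight. -/
theorem hasDiffOpValue_schurChar {N : ℕ} (n : ℕ) (q : ℝ) (lam : Signature N) :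
    HasDiffOpValue n q (fun u => schurChar lam u / schurChar lam 1)
      (∑ i, (descPochhammer ℂ n).eval (lam.shifted i : ℂ) * (ppWeight q lam i : ℂ)) := by
  have hχ := schurChar_one_ne_zero lam
  have hl := tendsto_det_powerMatrix fun j : Fin N => (lam.shifted j : ℂ)
  have hlim0 : (Matrix.vandermonde fun i : Fin N => ((i : ℕ) : ℂ)).det *
      (binomialMatrix fun j : Fin N => (lam.shifted j : ℂ)).det ≠ 0 := mul_ne_zero
    (det_vandermonde_natCast_ne_zero N)
    (det_binomialMatrix_ne_zero (det_vandermonde_shifted_ne_zero lam))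
  have hsum := tendsto_finsetSum Finset.univ fun (b : Fin N) _ =>
    ((tendsto_det_powerMatrix (Function.update (fun j => (lam.shifted j : ℂ)) b
      (lam.shifted b - q))).div hl hlim0).const_mul
        ((descPochhammer ℂ n).eval (lam.shifted b : ℂ))
  have hval : HasDiffOpValue n q (schurChar lam)
      (schurChar lam 1 * ∑ i, (descPochhammer ℂ n).eval (lam.shifted i : ℂ) *
        (ppWeight q lam i : ℂ)) := by
    have h2 := (tendsto_schurChar_ray lam).mul hsum
    have e : ∀ b : Fin N, (Matrix.vandermonde fun i : Fin N => ((i : ℕ) : ℂ)).det *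
        (binomialMatrix (Function.update (fun j => (lam.shifted j : ℂ)) b
          (lam.shifted b - q))).det / ((Matrix.vandermonde fun i : Fin N => ((i : ℕ) : ℂ)).det *
        (binomialMatrix fun j : Fin N => (lam.shifted j : ℂ)).det) = ppWeight q lam b := by
      intro b
      rw [div_eq_iff hlim0, det_binomialMatrix, det_binomialMatrix,
        det_vandermonde_update_shifted]
      ring
    simp only [e] at h2
    refine h2.congr' ?_
    filter_upwards [eventually_ray_ne_zero N, self_mem_nhdsWithin,
      (tendsto_schurChar_ray lam).eventually_ne hχ] with ε hε hε0 hχε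
    have hε0' : ε ≠ 0 := hε0
    have hu : ∀ i j, i ≠ j → ray N ε i - ray N ε j ≠ 0 := fun i j hij =>
      ray_sub_ray_ne_zero hε0' hij
    have hV := vandermondeProd_ne_zero hu
    have h3 := diffOp_schurChar n q lam hu hε
    have h4 := vandermondeProd_mul_schurChar lam hε
    refine mul_left_cancel₀ hV ?_
    rw [h3, ← mul_assoc, h4, Finset.mul_sum]
    have hprod : ∏ j : Fin N, ε ^ (j : ℕ) ≠ 0 :=
      Finset.prod_ne_zero_iff.2 fun j _ => pow_ne_zero _ hε0'
    have hd : (powerMatrix (ray N ε) fun j => (lam.shifted j : ℂ)).det ≠ 0 := by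
      rw [← h4]; exact mul_ne_zero hV hχε
    refine Finset.sum_congr rfl fun b _ => ?_
    simp only [Pi.div_apply]
    field_simp
  have := hval.const_mul (schurChar lam 1)⁻¹ (holNearOne_schurChar lam)
  rw [inv_mul_cancel_left₀ hχ] at this
  simpa only [div_eq_inv_mul] using this

/-! ### Symmetric functions near `1^N` -/

/-- `f` is invariant under permutations of the coordinates in a neighbourhood of `1^N`. -/
def SymmNearOne {N : ℕ} (f : (Fin N → ℂ) → ℂ) : Prop :=
  ∀ σ : Equiv.Perm (Fin N), (fun u : Fin N → ℂ => f (u ∘ σ)) =ᶠ[𝓝 1] f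

/-- Permutation of the coordinates. -/
noncomputable def permCoord {N : ℕ} (σ : Equiv.Perm (Fin N)) : (Fin N → ℂ) ≃L[ℂ] (Fin N → ℂ) :=
  (LinearEquiv.funCongrLeft ℂ ℂ σ).toContinuousLinearEquiv

theorem SymmNearOne.iteratedFDeriv_perm {N : ℕ} {f : (Fin N → ℂ) → ℂ} (hf : SymmNearOne f)
    (σ : Equiv.Perm (Fin N)) {m : ℕ} (i : Fin m → Fin N) :
    iteratedFDeriv ℂ m f 1 (fun a => Pi.single (σ (i a)) 1) =
      iteratedFDeriv ℂ m f 1 fun a => Pi.single (i a) 1 := by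
  have h1 : iteratedFDeriv ℂ m (f ∘ permCoord σ) 1 = iteratedFDeriv ℂ m f 1 :=
    (Filter.EventuallyEq.iteratedFDeriv ℂ (hf σ) m).eq_of_nhds
  have h3 := (permCoord σ).iteratedFDerivWithin_comp_right f uniqueDiffOn_univ
    (Set.mem_univ (permCoord σ 1)) m
  have h2 : permCoord σ 1 = 1 := rfl
  rw [Set.preimage_univ, iteratedFDerivWithin_univ, iteratedFDerivWithin_univ, h1, h2] at h3
  conv_lhs => rw [h3]
  rw [ContinuousMultilinearMap.compContinuousLinearMap_apply]
  congr 1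
  funext a
  ext b
  simp [permCoord, Pi.single_apply]

theorem coordDir_of_lt {N b : ℕ} (h : b < N) : coordDir N b = Pi.single ⟨b, h⟩ 1 := by
  ext j
  simp [coordDir, Pi.single_apply, Fin.ext_iff]

theorem exists_perm_castLE {N r : ℕ} (j : Fin r → Fin N) (hj : Function.Injective j) :
    ∃ h : r ≤ N, ∃ σ : Equiv.Perm (Fin N), ∀ b, σ (Fin.castLE h b) = j b := by
  classical
  have h : r ≤ N := by simpa using Fintype.card_le_of_injective j hj
  refine ⟨h, ?_⟩
  let e := (Equiv.ofInjective _ (Fin.castLE_injective h)).symm.trans (Equiv.ofInjective j hj)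
  refine ⟨Equiv.extendSubtype e, fun b => ?_⟩
  rw [Equiv.extendSubtype_apply_of_mem e _ ⟨b, rfl⟩]
  have : (⟨Fin.castLE h b, ⟨b, rfl⟩⟩ : Set.range (Fin.castLE h)) =
    Equiv.ofInjective _ (Fin.castLE_injective h) b := rfl
  simp only [e, Equiv.trans_apply]
  rw [this, Equiv.symm_apply_apply]
  rfl

/-- A permutation moves any r distinct coordinates to the first r, so a derivative depends only on
the coincidence pattern κ of its indices. Finitely many derivatives at indices independent of N
therefore determine all those of a given order. -/
theorem SymmNearOne.iteratedFDeriv_coordDir {N : ℕ} {f : (Fin N → ℂ) → ℂ} (hf : SymmNearOne f)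
    {m r : ℕ} (κ : Fin m → Fin r) (j : Fin r → Fin N) (hj : Function.Injective j) :
    iteratedFDeriv ℂ m f 1 (fun a => Pi.single (j (κ a)) 1) =
      iteratedFDeriv ℂ m f 1 fun a => coordDir N (κ a) := by
  obtain ⟨h, σ, hσ⟩ := exists_perm_castLE j hj
  rw [← funext fun a => congrArg (fun t => Pi.single (M := fun _ : Fin N => ℂ) t 1) (hσ (κ a)),
    hf.iteratedFDeriv_perm σ fun a => Fin.castLE h (κ a)]
  congr 1
  funext a
  rw [coordDir_of_lt ((κ a).2.trans_le h)]
  rfl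

/-! ### Taylor expansion in several variables -/

theorem ContDiffAt.isLittleO_sub_taylor {E : Type*} [NormedAddCommGroup E] [NormedSpace ℂ E]
    {f : E → ℂ} {x : E} {k : ℕ} (hf : ContDiffAt ℂ (k + 1) f x) :
    (fun u => f u - ∑ m ∈ Finset.range (k + 1), ((m.factorial : ℂ))⁻¹ *
      iteratedFDeriv ℂ m f x fun _ => u - x) =o[𝓝 x] fun u => ‖u - x‖ ^ k := by
  -- The integral form of the remainder lives on a real segment; the complex derivatives restrict to
  -- the real ones.
  let _ : NormedSpace ℝ E := NormedSpace.restrictScalars ℝ ℂ E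
  have hfR : ContDiffAt ℝ (k + 1) f x := hf.restrict_scalars ℝ
  have hev : ∀ᶠ u in 𝓝 x, ContDiffAt ℝ (k + 1) f u := hfR.eventually (by simp)
  have hcont : ContinuousAt (iteratedFDeriv ℝ (k + 1) f) x :=
    (hfR.iteratedFDeriv_right (i := k + 1) (m := 0) (by simp)).continuousAt
  set C : ℝ := ‖iteratedFDeriv ℝ (k + 1) f x‖ + 1 with hC
  have hbd : ∀ᶠ u in 𝓝 x, ‖iteratedFDeriv ℝ (k + 1) f u‖ < C :=
    hcont.norm.eventually_lt_const (by simp [hC])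
  obtain ⟨δ, hδ, hball⟩ := Metric.eventually_nhds_iff_ball.1 (hev.and hbd)
  have hO : (fun u => f u - ∑ m ∈ Finset.range (k + 1), ((m.factorial : ℂ))⁻¹ *
      iteratedFDeriv ℂ m f x fun _ => u - x) =O[𝓝 x] fun u => ‖u - x‖ ^ (k + 1) := by
    refine Asymptotics.IsBigO.of_bound C ?_
    filter_upwards [Metric.ball_mem_nhds x hδ] with u hu
    have hseg : ∀ t ∈ Set.Icc (0 : ℝ) 1, x + t • (u - x) ∈ Metric.ball x δ := by
      intro t ht
      rw [mem_ball_iff_norm] at hu ⊢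
      rw [add_sub_cancel_left, norm_smul, Real.norm_of_nonneg ht.1]
      exact (mul_le_of_le_one_left (norm_nonneg _) ht.2).trans_lt hu
    have h := map_add_eq_sum_add_integral_iteratedFDeriv (f := f) (x := x) (y := u - x) (n := k)
      fun t ht => (hball _ (hseg t ht)).1
    rw [add_sub_cancel] at h
    have hsum : ∑ m ∈ Finset.range (k + 1), ((m.factorial : ℂ))⁻¹ *
        (iteratedFDeriv ℂ m f x fun _ => u - x) = ∑ m ∈ Finset.range (k + 1),
          ((m.factorial : ℝ))⁻¹ • (iteratedFDeriv ℝ m f x fun _ => u - x) := by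
      refine Finset.sum_congr rfl fun m hm => ?_
      have hm' : ContDiffAt ℂ m f x := hf.of_le (by
        exact_mod_cast (Finset.mem_range.1 hm).le)
      rw [← hm'.restrictScalars_iteratedFDeriv (𝕜 := ℝ)]
      simp [Complex.real_smul]
    rw [hsum, h, add_sub_cancel_left, norm_smul]
    have h1 : ‖∫ t in (0 : ℝ)..1, (1 - t) ^ k •
        iteratedFDeriv ℝ (k + 1) f (x + t • (u - x)) fun _ => u - x‖ ≤
        C * ‖u - x‖ ^ (k + 1) * |(1 : ℝ) - 0| := by
      refine intervalIntegral.norm_integral_le_of_norm_le_const fun t ht => ?_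
      rw [Set.uIoc_of_le zero_le_one] at ht
      rw [norm_smul, norm_pow, Real.norm_of_nonneg (by linarith [ht.2])]
      have h2 : ‖iteratedFDeriv ℝ (k + 1) f (x + t • (u - x)) fun _ => u - x‖ ≤
          C * ‖u - x‖ ^ (k + 1) := by
        refine (ContinuousMultilinearMap.le_opNorm _ _).trans ?_
        rw [Finset.prod_const, Finset.card_univ, Fintype.card_fin]
        gcongr
        exact (hball _ (hseg t ⟨ht.1.le, ht.2⟩)).2.le
      refine (mul_le_of_le_one_left (norm_nonneg _) ?_).trans h2
      exact pow_le_one₀ (by linarith [ht.2]) (by linarith [ht.1])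
    have h3 : ‖((k.factorial : ℝ))⁻¹‖ ≤ 1 := by
      rw [norm_inv, Real.norm_natCast]
      exact inv_le_one_of_one_le₀ (by exact_mod_cast k.factorial_pos)
    rw [norm_pow, norm_norm]
    refine (mul_le_of_le_one_left (norm_nonneg _) h3).trans (h1.trans ?_)
    simp
  refine hO.trans_isLittleO ?_
  have h0 := (Asymptotics.isLittleO_norm_pow_norm_pow (E' := E) (Nat.lt_succ_self k))
  have ht : Tendsto (fun u : E => u - x) (𝓝 x) (𝓝 0) := by
    simpa using (continuous_sub_right x).tendsto x
  exact h0.comp_tendsto ht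

/-! ### Tuples and injections -/

/-- A factorization i = j ∘ κ with κ onto and j injective is the same as a bijection from `Fin r` to
the range of i. -/
theorem card_surjective_injective {m N : ℕ} (r : ℕ) (i : Fin m → Fin N) :
    Nat.card {p : (Fin m → Fin r) × (Fin r → Fin N) // (Function.Surjective p.1 ∧
      Function.Injective p.2) ∧ p.2 ∘ p.1 = i} =
      if r = Nat.card (Set.range i) then r.factorial else 0 := by
  classical
  let e : {p : (Fin m → Fin r) × (Fin r → Fin N) // (Function.Surjective p.1 ∧
      Function.Injective p.2) ∧ p.2 ∘ p.1 = i} ≃ (Fin r ≃ Set.range i) :=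
    { toFun := fun p => (Equiv.ofInjective p.1.2 p.2.1.2).trans (Equiv.setCongr
        ((p.2.1.1.range_comp p.1.2).symm.trans (congrArg Set.range p.2.2)))
      invFun := fun e => ⟨(fun a => e.symm ⟨i a, Set.mem_range_self a⟩, fun b => e b), by
        refine ⟨⟨?_, ?_⟩, ?_⟩
        · intro b
          obtain ⟨a, ha⟩ := (e b).2
          refine ⟨a, ?_⟩
          rw [Equiv.symm_apply_eq]
          exact Subtype.ext ha
        · exact Subtype.val_injective.comp e.injective
        · funext a
          simp⟩
      left_inv := by
        rintro ⟨⟨κ, j⟩, ⟨hκ, hj⟩, rfl⟩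
        refine Subtype.ext (Prod.ext ?_ rfl)
        funext a
        refine (Equiv.symm_apply_eq _).2 (Subtype.ext ?_)
        rfl
      right_inv := by
        intro e
        ext b
        rfl }
  rw [Nat.card_congr e]
  split_ifs with h
  · have e0 : Fin r ≃ Set.range i := Fintype.equivOfCardEq (by
      rw [Fintype.card_fin, h, Nat.card_eq_fintype_card])
    rw [Nat.card_eq_fintype_card, Fintype.card_equiv e0, Fintype.card_fin]
  · have : IsEmpty (Fin r ≃ Set.range i) := ⟨fun e0 => h (by
      rw [← Nat.card_congr e0, Nat.card_fin])⟩
    exact Nat.card_of_isEmpty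

-- Groups tuples by coincidence pattern: each tuple is counted r! times when r is the number of its
-- values, and not at all for other r.
open Classical in
theorem sum_tuple_eq_sum_surjective_injective {m N : ℕ} (F : (Fin m → Fin N) → ℂ) :
    ∑ i, F i = ∑ r ∈ Finset.range (m + 1), ((r.factorial : ℂ))⁻¹ *
      ∑ κ : Fin m → Fin r with Function.Surjective κ,
        ∑ j : Fin r → Fin N with Function.Injective j, F (j ∘ κ) := by
  have h1 : ∀ r, ∑ κ : Fin m → Fin r with Function.Surjective κ,
      ∑ j : Fin r → Fin N with Function.Injective j, F (j ∘ κ) =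
      ∑ i, (if r = Nat.card (Set.range i) then (r.factorial : ℂ) else 0) * F i := by
    intro r
    rw [← Finset.sum_product', ← Finset.sum_fiberwise _ fun p => p.2 ∘ p.1]
    refine Finset.sum_congr rfl fun i _ => ?_
    rw [Finset.sum_congr rfl (g := fun _ => F i)
      (fun p hp => by rw [(Finset.mem_filter.1 hp).2]), Finset.sum_const, nsmul_eq_mul]
    congr 1
    have h2 := card_surjective_injective r i
    rw [Nat.card_eq_fintype_card, Fintype.card_subtype] at h2
    rw [show ((if r = Nat.card (Set.range i) then (r.factorial : ℂ) else 0)) =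
      ((if r = Nat.card (Set.range i) then r.factorial else 0 : ℕ) : ℂ) by split_ifs <;> simp,
      ← h2]
    congr 2
    ext p
    simp
  simp_rw [h1, Finset.mul_sum]
  rw [Finset.sum_comm]
  refine Finset.sum_congr rfl fun i _ => ?_
  have hle : Nat.card (Set.range i) ∈ Finset.range (m + 1) := by
    rw [Finset.mem_range, Nat.lt_succ_iff]
    simpa using Finite.card_range_le i
  rw [Finset.sum_eq_single_of_mem _ hle fun r _ hr => by rw [if_neg hr]; ring, if_pos rfl]
  have : ((Nat.card (Set.range i)).factorial : ℂ) ≠ 0 := by exact_mod_cast Nat.factorial_ne_zero _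
  field_simp

/-- A combination of evaluations at 0, …, k that extracts the linear coefficient of polynomials of
degree at most k; it exists because the Vandermonde matrix of the nodes is invertible. -/
theorem exists_interpolation_functional (k : ℕ) :
    ∃ γ : Fin (k + 1) → ℂ, ∀ n ≤ k, ∑ t, γ t * ((t : ℕ) : ℂ) ^ n = if n = 1 then 1 else 0 := by
  set V := Matrix.vandermonde fun t : Fin (k + 1) => ((t : ℕ) : ℂ) with hV
  have hdet : IsUnit V.det := isUnit_iff_ne_zero.2 (det_vandermonde_natCast_ne_zero (k + 1))
  refine ⟨Matrix.vecMul (fun n : Fin (k + 1) => if (n : ℕ) = 1 then 1 else 0) V⁻¹, fun n hn => ?_⟩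
  have h := congrFun (Matrix.vecMul_vecMul
    (fun n : Fin (k + 1) => if (n : ℕ) = 1 then (1 : ℂ) else 0) V⁻¹ V) ⟨n, Nat.lt_succ_of_le hn⟩
  rw [Matrix.nonsing_inv_mul _ hdet, Matrix.vecMul_one] at h
  exact h

/-! ### Jets of symmetric functions -/

/-- The colouring of `Fin N` associated with an injective tuple of length `r`. -/
noncomputable def colouring {N r : ℕ} (j : Fin r → Fin N) : Fin N → Option (Fin r) :=
  Function.partialInv j

theorem colouring_eq_some {N r : ℕ} {j : Fin r → Fin N} (hj : Function.Injective j) (n : Fin N)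
    (b : Fin r) : colouring j n = some b ↔ j b = n :=
  hj.isPartialInv b n

open Classical in
theorem sum_colouring {N r : ℕ} (v : Option (Fin r) → Fin N → ℂ) (hv : ∀ n, v none n = 1) :
    ∑ c : Fin N → Option (Fin r) with ∀ b, (Finset.univ.filter fun n => c n = some b).card = 1,
      ∏ n, v (c n) n =
    ∑ j : Fin r → Fin N with Function.Injective j, ∏ b, v (some b) (j b) := by
  symm
  refine Finset.sum_bij (fun j _ => colouring j) ?_ ?_ ?_ ?_
  · intro j hj
    have hj' := (Finset.mem_filter.1 hj).2
    refine Finset.mem_filter.2 ⟨Finset.mem_univ _, fun b => ?_⟩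
    rw [Finset.card_eq_one]
    refine ⟨j b, ?_⟩
    ext n
    simp [colouring_eq_some hj', eq_comm]
  · intro j hj j' hj' h
    funext b
    have h1 := (colouring_eq_some (Finset.mem_filter.1 hj).2 (j b) b).2 rfl
    rw [h] at h1
    exact ((colouring_eq_some (Finset.mem_filter.1 hj').2 (j b) b).1 h1).symm
  · intro c hc
    have hc' := (Finset.mem_filter.1 hc).2
    choose j hj using fun b => Finset.card_eq_one.1 (hc' b)
    have hcj : ∀ n b, c n = some b ↔ j b = n := by
      intro n b
      have := Finset.ext_iff.1 (hj b) n
      simp only [Finset.mem_filter, Finset.mem_univ, true_and, Finset.mem_singleton] at this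
      rw [this, eq_comm]
    have hinj : Function.Injective j := by
      intro b b' h
      have h1 := (hcj (j b) b).2 rfl
      have h2 := (hcj (j b) b').2 h.symm
      rw [h1] at h2
      exact Option.some.inj h2
    refine ⟨j, Finset.mem_filter.2 ⟨Finset.mem_univ _, hinj⟩, ?_⟩
    funext n
    ext b
    rw [colouring_eq_some hinj, hcj]
  · intro j hj
    have hj' := (Finset.mem_filter.1 hj).2
    rw [← Finset.prod_subset (Finset.subset_univ (Finset.univ.image j)),
      Finset.prod_image fun a _ b _ h => hj' h]
    · refine Finset.prod_congr rfl fun b _ => ?_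
      rw [(colouring_eq_some hj' (j b) b).2 rfl]
    · intro n _ hn
      have : colouring j n = none := by
        rw [Option.eq_none_iff_forall_not_mem]
        intro b hb
        exact hn (Finset.mem_image.2 ⟨b, Finset.mem_univ _, (colouring_eq_some hj' n b).1 hb⟩)
      rw [this, hv]

theorem prod_option_elim_eq {N r : ℕ} (c : Fin N → Option (Fin r)) (x : Fin r → ℂ) :
    ∏ n, (c n).elim 1 x = ∏ b, x b ^ (Finset.univ.filter fun n => c n = some b).card := by
  have h : ∀ n, (c n).elim 1 x = ∏ b, if c n = some b then x b else 1 := by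
    intro n
    cases h : c n with
    | none => simp
    | some b => simp [Finset.prod_ite_eq]
  simp_rw [h]
  rw [Finset.prod_comm]
  refine Finset.prod_congr rfl fun b _ => ?_
  rw [← Finset.prod_filter, Finset.prod_const]

/-- Expanding the product over n, each n chooses the term 1 or one b, that is, a colour. Then x_b
occurs to the power of the number of n coloured b, and the weighted node sum factors over b. -/
theorem sum_node_prod {N r k : ℕ} (γ : Fin (k + 1) → ℂ) (w : Fin r → Fin N → ℂ) :
    ∑ x : Fin r → Fin (k + 1), (∏ b, γ (x b)) * ∏ n, (1 + ∑ b, ((x b : ℕ) : ℂ) * w b n) =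
      ∑ c : Fin N → Option (Fin r),
        (∏ b, ∑ t, γ t * ((t : ℕ) : ℂ) ^ (Finset.univ.filter fun n => c n = some b).card) *
          ∏ n, (c n).elim 1 fun b => w b n := by
  have h1 : ∀ x : Fin r → Fin (k + 1), ∏ n, (1 + ∑ b, ((x b : ℕ) : ℂ) * w b n) =
      ∑ c : Fin N → Option (Fin r),
        (∏ b, ((x b : ℕ) : ℂ) ^ (Finset.univ.filter fun n => c n = some b).card) *
          ∏ n, (c n).elim 1 fun b => w b n := by
    intro x
    have h2 : ∀ n, 1 + ∑ b, ((x b : ℕ) : ℂ) * w b n =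
        ∑ o : Option (Fin r), (o.elim 1 fun b => ((x b : ℕ) : ℂ)) * o.elim 1 fun b => w b n := by
      intro n
      rw [Fintype.sum_option]
      simp
    simp_rw [h2]
    rw [Finset.prod_univ_sum, Fintype.piFinset_univ]
    refine Finset.sum_congr rfl fun c _ => ?_
    rw [Finset.prod_mul_distrib, prod_option_elim_eq]
  simp_rw [h1, Finset.mul_sum]
  rw [Finset.sum_comm]
  refine Finset.sum_congr rfl fun c _ => ?_
  rw [Finset.prod_univ_sum, Fintype.piFinset_univ, Finset.sum_mul]
  refine Finset.sum_congr rfl fun x _ => ?_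
  rw [Finset.prod_mul_distrib, mul_assoc]

theorem isLittleO_prod_pow {N r k : ℕ} {s : Fin r → ℕ} (hs : ∀ b, 1 ≤ s b)
    (c : Fin N → Option (Fin r)) (b : Fin r)
    (hb : k < (Finset.univ.filter fun n => c n = some b).card) :
    (fun y : Fin N → ℂ => ∏ n, (c n).elim 1 fun b => y n ^ s b) =o[𝓝 0] fun y => ‖y‖ ^ k := by
  set d : Fin N → ℕ := fun n => (c n).elim 0 s with hd
  have hdeg : k < ∑ n, d n := by
    refine hb.trans_le ?_
    rw [Finset.card_eq_sum_ones, Finset.sum_filter]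
    refine Finset.sum_le_sum fun n _ => ?_
    split_ifs with h
    · simp [hd, h, hs b]
    · exact Nat.zero_le _
  have hO : (fun y : Fin N → ℂ => ∏ n, (c n).elim 1 fun b => y n ^ s b) =O[𝓝 0]
      fun y => ‖y‖ ^ ∑ n, d n := by
    refine Asymptotics.IsBigO.of_bound 1 (Eventually.of_forall fun y => ?_)
    rw [one_mul, norm_pow, norm_norm, norm_prod, ← Finset.prod_pow_eq_pow_sum]
    refine Finset.prod_le_prod (fun _ _ => norm_nonneg _) fun n _ => ?_
    cases h : c n with
    | none => simp [hd, h]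
    | some b =>
      simp only [hd, h, Option.elim, norm_pow]
      exact pow_le_pow_left₀ (norm_nonneg _) (norm_le_pi_norm y n) _
  exact hO.trans_isLittleO (Asymptotics.isLittleO_norm_pow_norm_pow (E' := Fin N → ℂ) hdeg)

open Classical in
/-- Sums over injective tuples of monomials are, up to terms of high degree, linear combinations of
products of functions of one variable, uniformly in the number of variables. -/
theorem isLittleO_sum_node_sub_sum_injective {N r k : ℕ} {γ : Fin (k + 1) → ℂ}
    (hγ : ∀ n ≤ k, ∑ t, γ t * ((t : ℕ) : ℂ) ^ n = if n = 1 then 1 else 0) (hk : 1 ≤ k)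
    {s : Fin r → ℕ} (hs : ∀ b, 1 ≤ s b) :
    (fun y : Fin N → ℂ => (∑ j : Fin r → Fin N with Function.Injective j, ∏ b, y (j b) ^ s b) -
      ∑ x : Fin r → Fin (k + 1), (∏ b, γ (x b)) *
        ∏ n, (1 + ∑ b, ((x b : ℕ) : ℂ) * y n ^ s b)) =o[𝓝 0] fun y => ‖y‖ ^ k := by
  have h1 : ∀ y : Fin N → ℂ,
      (∑ j : Fin r → Fin N with Function.Injective j, ∏ b, y (j b) ^ s b) -
      ∑ x : Fin r → Fin (k + 1), (∏ b, γ (x b)) *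
        ∏ n, (1 + ∑ b, ((x b : ℕ) : ℂ) * y n ^ s b) =
      ∑ c : Fin N → Option (Fin r) with
        ¬ ∀ b, (Finset.univ.filter fun n => c n = some b).card = 1,
        -((∏ b, ∑ t, γ t * ((t : ℕ) : ℂ) ^ (Finset.univ.filter fun n => c n = some b).card) *
          ∏ n, (c n).elim 1 fun b => y n ^ s b) := by
    intro y
    have h2 := sum_colouring (fun o n => o.elim 1 fun b : Fin r => y n ^ s b) fun n => rfl
    simp only [Option.elim] at h2
    rw [sum_node_prod γ fun b n => y n ^ s b, ← Finset.sum_filter_add_sum_filter_not Finset.univ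
      fun c : Fin N → Option (Fin r) =>
        ∀ b, (Finset.univ.filter fun n => c n = some b).card = 1, Finset.sum_neg_distrib]
    have h3 : ∑ c : Fin N → Option (Fin r) with
        ∀ b, (Finset.univ.filter fun n => c n = some b).card = 1,
        (∏ b, ∑ t, γ t * ((t : ℕ) : ℂ) ^ (Finset.univ.filter fun n => c n = some b).card) *
          ∏ n, (c n).elim 1 (fun b => y n ^ s b) =
        ∑ j : Fin r → Fin N with Function.Injective j, ∏ b, y (j b) ^ s b := by
      refine Eq.trans (Finset.sum_congr rfl fun c hc => ?_) h2
      have hc' := (Finset.mem_filter.1 hc).2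
      rw [Finset.prod_eq_one fun b _ => by rw [hc' b, hγ 1 hk, if_pos rfl], one_mul]
      rfl
    rw [h3]
    ring
  simp_rw [h1]
  refine Asymptotics.IsLittleO.fun_sum fun c hc => Asymptotics.isLittleO_neg_left.2 ?_
  have hc' := (Finset.mem_filter.1 hc).2
  push Not at hc'
  obtain ⟨b, hb⟩ := hc'
  -- Some colour is not used exactly once. If it is used at most k times, γ annihilates the term;
  -- otherwise the monomial has degree greater than k.
  by_cases hbk : (Finset.univ.filter fun n => c n = some b).card ≤ k
  · have h0 : ∏ b, ∑ t, γ t * ((t : ℕ) : ℂ) ^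
        (Finset.univ.filter fun n => c n = some b).card = 0 :=
      Finset.prod_eq_zero (Finset.mem_univ b) (by rw [hγ _ hbk, if_neg hb])
    simp only [h0, zero_mul]
    exact Asymptotics.isLittleO_zero _ _
  · exact (isLittleO_prod_pow hs c b (not_le.1 hbk)).const_mul_left _

theorem iteratedFDeriv_diag_eq_sum {N m : ℕ} (f : (Fin N → ℂ) → ℂ) (y : Fin N → ℂ) :
    (iteratedFDeriv ℂ m f 1 fun _ => y) = ∑ i : Fin m → Fin N,
      (∏ a, y (i a)) * iteratedFDeriv ℂ m f 1 fun a => Pi.single (i a) 1 := by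
  have hy : y = ∑ j, y j • (Pi.single j 1 : Fin N → ℂ) := by
    ext n
    simp [Finset.sum_apply, Pi.single_apply]
  conv_lhs => rw [hy]
  rw [ContinuousMultilinearMap.map_sum]
  refine Finset.sum_congr rfl fun i _ => ?_
  rw [ContinuousMultilinearMap.map_smul_univ, smul_eq_mul]

theorem prod_comp_eq_prod_pow {N m r : ℕ} (κ : Fin m → Fin r) (j : Fin r → Fin N)
    (y : Fin N → ℂ) : ∏ a, y (j (κ a)) =
      ∏ b, y (j b) ^ (Finset.univ.filter fun a => κ a = b).card := by
  rw [← Finset.prod_fiberwise Finset.univ κ]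
  refine Finset.prod_congr rfl fun b _ => ?_
  rw [Finset.prod_congr rfl (g := fun _ => y (j b))
    (fun a ha => by rw [(Finset.mem_filter.1 ha).2]), Finset.prod_const]

/-- The indices in the expansion of symmetric functions to the order `k`. -/
abbrev JetIndex (k : ℕ) : Type :=
  Σ m : Fin k, Σ r : Fin (m + 2), {κ : Fin (m + 1) → Fin r // Function.Surjective κ}

open Classical in
noncomputable instance (k : ℕ) : Fintype (JetIndex k) :=
  inferInstanceAs (Fintype (Σ m : Fin k, Σ r : Fin (m + 2),
    {κ : Fin (m + 1) → Fin r // Function.Surjective κ}))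

/-- The order of derivation. -/
abbrev JetIndex.order {k : ℕ} (s : JetIndex k) : ℕ := s.1 + 1

/-- The function of one variable attached to an index and a node. -/
noncomputable def JetIndex.factor {k : ℕ} (s : JetIndex k) (x : Fin s.2.1 → Fin (k + 1)) (z : ℂ) :
    ℂ :=
  1 + ∑ b, ((x b : ℕ) : ℂ) * (z - 1) ^ (Finset.univ.filter fun a => s.2.2.1 a = b).card

theorem JetIndex.card_fiber_pos {k : ℕ} (s : JetIndex k) (b : Fin s.2.1) :
    1 ≤ (Finset.univ.filter fun a => s.2.2.1 a = b).card := by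
  obtain ⟨a, ha⟩ := s.2.2.2 b
  exact Finset.card_pos.2 ⟨a, by simp [ha]⟩

theorem JetIndex.factor_one {k : ℕ} (s : JetIndex k) (x : Fin s.2.1 → Fin (k + 1)) :
    s.factor x 1 = 1 := by
  rw [JetIndex.factor, Finset.sum_eq_zero, add_zero]
  intro b _
  rw [sub_self, zero_pow (Nat.one_le_iff_ne_zero.1 (s.card_fiber_pos b)), mul_zero]

theorem JetIndex.analyticAt_factor {k : ℕ} (s : JetIndex k) (x : Fin s.2.1 → Fin (k + 1)) (z : ℂ) :
    AnalyticAt ℂ (s.factor x) z := by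
  unfold JetIndex.factor
  fun_prop

open Classical in
theorem JetIndex.sum_eq {k : ℕ} (F : JetIndex k → ℂ) :
    ∑ s, F s = ∑ m : Fin k, ∑ r : Fin (m + 2),
      ∑ κ : {κ : Fin (m + 1) → Fin r // Function.Surjective κ}, F ⟨m, r, κ⟩ := by
  rw [← Fintype.sum_equiv (Equiv.refl (JetIndex k)) F F fun _ => rfl]
  refine (Fintype.sum_sigma F).trans (Finset.sum_congr rfl fun m _ => ?_)
  exact Fintype.sum_sigma _

-- Taylor's formula, grouped by coincidence pattern, writes the jet of a symmetric function in terms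
-- of sums of monomials over injective tuples. Up to order k each such sum is the multilinear
-- coefficient of ∏_n (1 + ∑_b x_b (u_n - 1)^{s_b}) in the x_b, and finitely many integer nodes
-- extract it. The weights do not involve N, which makes the later limits uniform in the number of
-- variables.
open Classical in
theorem exists_symmetric_jet {k : ℕ} (hk : 1 ≤ k) :
    ∃ γ : ∀ s : JetIndex k, (Fin s.2.1 → Fin (k + 1)) → ℂ, (∀ s, ∑ x, γ s x = 0) ∧
      ∀ (N : ℕ) (f : (Fin N → ℂ) → ℂ), ContDiffAt ℂ (k + 1) f 1 → SymmNearOne f →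
        (fun u => f u - (f 1 + ∑ s : JetIndex k,
          (iteratedFDeriv ℂ s.order f 1 fun a => coordDir N (s.2.2.1 a)) *
            ∑ x, γ s x * ∏ n, s.factor x (u n))) =o[𝓝 1] fun u => ‖u - 1‖ ^ k := by
  obtain ⟨γ, hγ⟩ := exists_interpolation_functional k
  refine ⟨fun s x => ((s.order.factorial : ℂ))⁻¹ * (((s.2.1 : ℕ).factorial : ℂ))⁻¹ *
    ∏ b, γ (x b), fun s => ?_, fun N f hf hsymm => ?_⟩
  · rw [← Finset.mul_sum]
    -- The weights form a product, so their sum factors into copies of ∑_t γ_t = 0, the degree 0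
    -- interpolation condition. There is at least one copy since κ has nonempty source.
    have h0 : ∑ x : Fin s.2.1 → Fin (k + 1), ∏ b, γ (x b) = ∏ _b : Fin s.2.1, ∑ t, γ t := by
      rw [Finset.prod_univ_sum, Fintype.piFinset_univ]
    have h1 : ∑ t, γ t = 0 := by simpa using hγ 0 (Nat.zero_le _)
    obtain ⟨b⟩ : Nonempty (Fin s.2.1) := ⟨s.2.2.1 0⟩
    rw [h0, Finset.prod_eq_zero (Finset.mem_univ b) h1, mul_zero]
  · have hT := hf.isLittleO_sub_taylor
    have hlim : Tendsto (fun u : Fin N → ℂ => u - 1) (𝓝 1) (𝓝 0) := by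
      simpa using (continuous_sub_right (1 : Fin N → ℂ)).tendsto 1
    have hjet : ∀ s : JetIndex k, (fun u : Fin N → ℂ =>
        (iteratedFDeriv ℂ s.order f 1 fun a => coordDir N (s.2.2.1 a)) *
        (((s.order.factorial : ℂ))⁻¹ * (((s.2.1 : ℕ).factorial : ℂ))⁻¹) *
        ((∑ j : Fin s.2.1 → Fin N with Function.Injective j,
          ∏ b, (u - 1) (j b) ^ (Finset.univ.filter fun a => s.2.2.1 a = b).card) -
        ∑ x : Fin s.2.1 → Fin (k + 1), (∏ b, γ (x b)) * ∏ n, s.factor x (u n))) =o[𝓝 1]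
        fun u => ‖u - 1‖ ^ k := fun s => Asymptotics.IsLittleO.const_mul_left
      ((isLittleO_sum_node_sub_sum_injective (N := N) hγ hk s.card_fiber_pos).comp_tendsto hlim) _
    refine (hT.add (Asymptotics.IsLittleO.fun_sum fun s (_ : s ∈ Finset.univ) => hjet s)).congr_left
      fun u => ?_
    have hsum : ∑ m ∈ Finset.range (k + 1), ((m.factorial : ℂ))⁻¹ *
        (iteratedFDeriv ℂ m f 1 fun _ => u - 1) = f 1 + ∑ s : JetIndex k,
        (iteratedFDeriv ℂ s.order f 1 fun a => coordDir N (s.2.2.1 a)) *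
        (((s.order.factorial : ℂ))⁻¹ * (((s.2.1 : ℕ).factorial : ℂ))⁻¹) *
        (∑ j : Fin s.2.1 → Fin N with Function.Injective j,
          ∏ b, (u - 1) (j b) ^ (Finset.univ.filter fun a => s.2.2.1 a = b).card) := by
      rw [Finset.sum_range_succ', add_comm]
      congr 1
      · simp
      · rw [← Fin.sum_univ_eq_sum_range (fun m => (((m + 1).factorial : ℂ))⁻¹ *
          (iteratedFDeriv ℂ (m + 1) f 1 fun _ => u - 1)), JetIndex.sum_eq]
        refine Finset.sum_congr rfl fun m _ => ?_
        rw [iteratedFDeriv_diag_eq_sum, sum_tuple_eq_sum_surjective_injective, Finset.mul_sum,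
          ← Fin.sum_univ_eq_sum_range (fun r => (((m : ℕ) + 1).factorial : ℂ)⁻¹ *
            ((r.factorial : ℂ)⁻¹ * ∑ κ : Fin (m + 1) → Fin r with Function.Surjective κ,
            ∑ j : Fin r → Fin N with Function.Injective j, (∏ a, (u - 1) ((j ∘ κ) a)) *
            iteratedFDeriv ℂ (m + 1) f 1 fun a => Pi.single ((j ∘ κ) a) 1))]
        refine Finset.sum_congr rfl fun r _ => ?_
        rw [Finset.sum_subtype (p := fun κ : Fin (m + 1) → Fin r => Function.Surjective κ) _
          (fun κ => by simp), Finset.mul_sum, Finset.mul_sum]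
        refine Finset.sum_congr rfl fun κ _ => ?_
        rw [Finset.mul_sum, Finset.mul_sum, Finset.mul_sum]
        refine Finset.sum_congr rfl fun j hj => ?_
        have hsy := hsymm.iteratedFDeriv_coordDir κ.1 j (Finset.mem_filter.1 hj).2
        simp only [Function.comp_apply]
        rw [hsy, prod_comp_eq_prod_pow]
        simp only [JetIndex.order]
        ring
    rw [hsum]
    have hd : ∀ s : JetIndex k,
        (iteratedFDeriv ℂ s.order f 1 fun a => coordDir N (s.2.2.1 a)) *
        ∑ x, (((s.order.factorial : ℂ))⁻¹ * (((s.2.1 : ℕ).factorial : ℂ))⁻¹ *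
          ∏ b, γ (x b)) * ∏ n, s.factor x (u n) =
        (iteratedFDeriv ℂ s.order f 1 fun a => coordDir N (s.2.2.1 a)) *
        (((s.order.factorial : ℂ))⁻¹ * (((s.2.1 : ℕ).factorial : ℂ))⁻¹) *
        ∑ x : Fin s.2.1 → Fin (k + 1), (∏ b, γ (x b)) * ∏ n, s.factor x (u n) := by
      intro s
      rw [mul_assoc, Finset.mul_sum]
      simp only [mul_assoc]
      simp only [Finset.mul_sum]
    simp_rw [hd, mul_sub, Finset.sum_sub_distrib]
    ring

/-! ### Locally uniform limits of holomorphic functions of several variables -/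

/-- Weierstrass' theorem in several variables: a Cauchy-type estimate on small balls bounds the
derivative of a difference by its oscillation, so the derivatives are locally uniformly Cauchy. -/
theorem tendstoLocallyUniformlyOn_fderiv {E F ι : Type*} [NormedAddCommGroup E] [NormedSpace ℂ E]
    [LocallyCompactSpace E] [NormedAddCommGroup F] [NormedSpace ℂ F] [CompleteSpace F] {l : Filter ι} [l.NeBot]
    {U : Set E} (hU : IsOpen U) {f : ι → E → F} {g : E → F}
    (hf : TendstoLocallyUniformlyOn f g l U) (hd : ∀ i, DifferentiableOn ℂ (f i) U) :
    DifferentiableOn ℂ g U ∧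
      TendstoLocallyUniformlyOn (fun i => fderiv ℂ (f i)) (fderiv ℂ g) l U := by
  have hloc : ∀ x ∈ U, ∃ t ∈ 𝓝 x, UniformCauchySeqOn (fun i => fderiv ℂ (f i)) l t := by
    intro x hx
    obtain ⟨t, htc, hxt, htU⟩ := exists_compact_subset hU hx
    have htu := (tendstoLocallyUniformlyOn_iff_forall_isCompact hU).1 hf t htU htc
    have ht : t ∈ 𝓝 x := mem_interior_iff_mem_nhds.1 hxt
    obtain ⟨r, hr, hrt⟩ := Metric.mem_nhds_iff.1 (Filter.inter_mem ht (hU.mem_nhds hx))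
    refine ⟨Metric.ball x (r / 2), Metric.ball_mem_nhds x (half_pos hr), ?_⟩
    intro V hV
    obtain ⟨ε, hε, hεV⟩ := Metric.mem_uniformity_dist.1 hV
    -- With ε r/8 the difference varies by at most ε r/4 on a ball of radius r/2, so its derivative
    -- is at most ε/2.
    have hc := htu.uniformCauchySeqOn {p | dist p.1 p.2 < ε * r / 8}
      (Metric.dist_mem_uniformity (by positivity))
    filter_upwards [hc] with p hp y hy
    apply hεV
    have hsub : Metric.ball y (r / 2) ⊆ Metric.ball x r := by
      refine Metric.ball_subset_ball' ?_
      have := Metric.mem_ball.1 hy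
      linarith
    have hdi : ∀ i, DifferentiableOn ℂ (f i) (Metric.ball y (r / 2)) := fun i =>
      (hd i).mono (hsub.trans (hrt.trans Set.inter_subset_right))
    have hyb : y ∈ Metric.ball y (r / 2) := Metric.mem_ball_self (half_pos hr)
    have hat : ∀ i, DifferentiableAt ℂ (f i) y := fun i =>
      (hdi i).differentiableAt (Metric.ball_mem_nhds y (half_pos hr))
    have hle := Complex.norm_fderiv_le_div_of_mapsTo_ball (c := y) (R₁ := r / 2)
      (R₂ := ε * r / 4) ((hdi p.1).sub (hdi p.2)) (fun z hz => by
        have h1 := hp z (hrt (hsub hz)).1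
        have h2 := hp y (hrt (hsub hyb)).1
        simp only [dist_eq_norm] at h1 h2
        rw [mem_closedBall_iff_norm]
        simp only [Pi.sub_apply]
        refine (norm_sub_le _ _).trans ?_
        linarith) (half_pos hr)
    rw [fderiv_sub (hat _) (hat _)] at hle
    rw [dist_eq_norm]
    refine hle.trans_lt ?_
    rw [div_lt_iff₀ (half_pos hr)]
    nlinarith [mul_pos hε hr]
  have hlim : ∀ x ∈ U, ∃ L, Tendsto (fun i => fderiv ℂ (f i) x) l (𝓝 L) := by
    intro x hx
    obtain ⟨t, ht, htc⟩ := hloc x hx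
    exact cauchy_map_iff_exists_tendsto.1 (htc.cauchy_map (mem_of_mem_nhds ht))
  classical
  let g' : E → E →L[ℂ] F := fun x => if h : x ∈ U then (hlim x h).choose else 0
  have hg' : ∀ x ∈ U, Tendsto (fun i => fderiv ℂ (f i) x) l (𝓝 (g' x)) := by
    intro x hx
    simp only [g', dif_pos hx]
    exact (hlim x hx).choose_spec
  have hconv : TendstoLocallyUniformlyOn (fun i => fderiv ℂ (f i)) g' l U := by
    intro V hV x hx
    obtain ⟨t, ht, htc⟩ := hloc x hx
    refine ⟨t ∩ U, mem_nhdsWithin_of_mem_nhds (Filter.inter_mem ht (hU.mem_nhds hx)), ?_⟩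
    have h1 : UniformCauchySeqOn (fun i => fderiv ℂ (f i)) l (t ∩ U) :=
      htc.mono Set.inter_subset_left
    exact h1.tendstoUniformlyOn_of_tendsto (fun y hy => hg' y hy.2) V hV
  have hder : ∀ x ∈ U, HasFDerivAt g (g' x) x := fun x hx =>
    hasFDerivAt_of_tendstoLocallyUniformlyOn hU hconv
      (fun i y hy => ((hd i).differentiableAt (hU.mem_nhds hy)).hasFDerivAt)
      (fun y hy => hf.tendsto_at hy) hx
  exact ⟨fun x hx => (hder x hx).differentiableAt.differentiableWithinAt,
    hconv.congr_right fun x hx => (hder x hx).fderiv.symm⟩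

/-- Iteration of the first order statement; the target space is quantified inside the induction
because it changes to a space of linear maps at each step. -/
theorem contDiffOn_of_tendstoLocallyUniformlyOn {E ι : Type} [NormedAddCommGroup E]
    [NormedSpace ℂ E] [LocallyCompactSpace E] {l : Filter ι} [l.NeBot] {U : Set E} (hU : IsOpen U)
    (n : ℕ) :
    ∀ {F : Type} [NormedAddCommGroup F] [NormedSpace ℂ F] [CompleteSpace F] {f : ι → E → F}
      {g : E → F}, TendstoLocallyUniformlyOn f g l U → (∀ i, ContDiffOn ℂ n (f i) U) →
      ContDiffOn ℂ n g U ∧ ∀ x ∈ U,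
        Tendsto (fun i => iteratedFDeriv ℂ n (f i) x) l (𝓝 (iteratedFDeriv ℂ n g x)) := by
  induction n with
  | zero =>
    intro F _ _ _ f g hf hd
    refine ⟨contDiffOn_zero.2 (hf.continuousOn (Eventually.of_forall fun i =>
      (hd i).continuousOn).frequently), fun x hx => ?_⟩
    simp only [iteratedFDeriv_zero_eq_comp, Function.comp_apply]
    exact ((continuousMultilinearCurryFin0 ℂ E F).symm.continuous.tendsto _).comp
      (hf.tendsto_at hx)
  | succ n ih =>
    intro F _ _ _ f g hf hd
    have hd' := fun i => (contDiffOn_succ_iff_fderiv_of_isOpen (n := (n : WithTop ℕ∞)) hU).1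
      (by exact_mod_cast hd i)
    obtain ⟨h1, h2⟩ := tendstoLocallyUniformlyOn_fderiv hU hf fun i => (hd' i).1
    obtain ⟨h3, h4⟩ := ih h2 fun i => (hd' i).2.2
    refine ⟨?_, fun x hx => ?_⟩
    · have := (contDiffOn_succ_iff_fderiv_of_isOpen (n := (n : WithTop ℕ∞)) hU).2
        ⟨h1, by simp, h3⟩
      exact_mod_cast this
    · simp only [iteratedFDeriv_succ_eq_comp_right, Function.comp_apply]
      exact ((continuousMultilinearCurryRightEquiv' ℂ n E F).symm.continuous.tendsto _).comp
        (h4 x hx)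

/-! ### The Schur generating function near `1^N` -/

theorem vandermondePoly_ne_zero (N : ℕ) : vandermondePoly N ≠ 0 :=
  Finset.prod_ne_zero_iff.2 fun _ hp => (irreducible_X_sub_X (Finset.mem_filter.1 hp).2.ne).ne_zero

theorem eval_vandermondePoly {N : ℕ} (u : Fin N → ℂ) :
    MvPolynomial.eval u (vandermondePoly N) = vandermondeProd u := by
  simp [vandermondePoly, vandermondeProd, map_prod]

theorem vandermondeProd_perm {N : ℕ} (σ : Equiv.Perm (Fin N)) (u : Fin N → ℂ) :
    vandermondeProd (u ∘ σ) = (Equiv.Perm.sign σ : ℤ) * vandermondeProd u := by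
  have h1 := det_vandermonde_eq_vandermondeProd u
  have h2 := det_vandermonde_eq_vandermondeProd (u ∘ σ)
  have h3 : (Matrix.vandermonde (u ∘ σ)).det = (Equiv.Perm.sign σ : ℤ) * (Matrix.vandermonde u).det :=
    Matrix.det_permute σ (Matrix.vandermonde u)
  rw [h3, h1, mul_left_comm] at h2
  exact (mul_left_cancel₀ (pow_ne_zero _ (by norm_num)) h2).symm

theorem eval_alternantQuotient_perm {N : ℕ} (e : Fin N → ℕ) (σ : Equiv.Perm (Fin N))
    (u : Fin N → ℂ) : MvPolynomial.eval (u ∘ σ) (alternantQuotient e) =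
      MvPolynomial.eval u (alternantQuotient e) := by
  have halt : ∀ v : Fin N → ℂ, MvPolynomial.eval v (alternant e) =
      (Matrix.of fun i j => v i ^ e j).det := by
    intro v
    rw [alternant, RingHom.map_det]
    congr 1
    ext i j
    simp
  -- Both sides of the quotient are antisymmetric. The Vandermonde product is cancelled as a
  -- polynomial, since its value at u may be 0.
  have h : MvPolynomial.rename σ (alternantQuotient e) = alternantQuotient e := by
    refine mul_left_cancel₀ (vandermondePoly_ne_zero N) (MvPolynomial.funext fun v => ?_)
    have h1 := congrArg (MvPolynomial.eval v) (vandermondePoly_mul_alternantQuotient e)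
    have h2 := congrArg (MvPolynomial.eval (v ∘ σ)) (vandermondePoly_mul_alternantQuotient e)
    have h3 : (Matrix.of fun i j => (v ∘ σ) i ^ e j).det =
        (Equiv.Perm.sign σ : ℤ) * (Matrix.of fun i j => v i ^ e j).det :=
      Matrix.det_permute σ (Matrix.of fun i j => v i ^ e j)
    rw [map_mul, eval_vandermondePoly, halt] at h1 h2
    rw [vandermondeProd_perm, h3, ← h1, mul_assoc] at h2
    have h4 : ((Equiv.Perm.sign σ : ℤ) : ℂ) ≠ 0 := by
      exact_mod_cast (Equiv.Perm.sign σ).ne_zero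
    rw [map_mul, map_mul, eval_vandermondePoly, MvPolynomial.eval_rename]
    exact mul_left_cancel₀ h4 h2
  rw [← MvPolynomial.eval_rename, h]

theorem schurChar_perm {N : ℕ} (lam : Signature N) (σ : Equiv.Perm (Fin N)) (u : Fin N → ℂ) :
    schurChar lam (u ∘ σ) = schurChar lam u := by
  rw [schurChar, schurChar, eval_alternantQuotient_perm]
  congr 2
  exact Equiv.prod_comp σ u

theorem contDiffOn_schurTerm {N : ℕ} (ρ : PMF (Signature N)) (lam : Signature N)
    (n : WithTop ℕ∞) : ContDiffOn ℂ n (schurTerm ρ lam) {u | ∀ i, u i ≠ 0} := by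
  intro u hu
  unfold schurTerm
  exact (analyticAt_const.fun_mul (AnalyticAt.fun_div (analyticAt_schurChar lam hu)
    analyticAt_const (schurChar_one_ne_zero lam))).contDiffAt.contDiffWithinAt

theorem isOpen_forall_ne_zero (N : ℕ) : IsOpen {u : Fin N → ℂ | ∀ i, u i ≠ 0} := by
  simp only [Set.ofPred_forall]
  exact isOpen_iInter_of_finite fun i => isOpen_ne_fun (continuous_apply i) continuous_const

theorem SchurGenConverges.exists_open {N : ℕ} {ρ : PMF (Signature N)} (hρ : SchurGenConverges ρ) :
    ∃ U : Set (Fin N → ℂ), IsOpen U ∧ 1 ∈ U ∧ U ⊆ {u | ∀ i, u i ≠ 0} ∧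
      TendstoLocallyUniformlyOn (fun (s : Finset (Signature N)) u => ∑ lam ∈ s, schurTerm ρ lam u)
        (schurGen ρ) atTop U := by
  obtain ⟨U, hU, hs⟩ := hρ
  obtain ⟨V, hVU, hV, h1⟩ := mem_nhds_iff.1 hU
  refine ⟨V ∩ {u | ∀ i, u i ≠ 0}, hV.inter (isOpen_forall_ne_zero N), ⟨h1, fun i => one_ne_zero⟩,
    Set.inter_subset_right, ?_⟩
  exact (hasSumUniformlyOn_iff_tendstoUniformlyOn.1
    hs.hasSumUniformlyOn).tendstoLocallyUniformlyOn.mono (Set.inter_subset_left.trans hVU)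

theorem SchurGenConverges.contDiffAt {N : ℕ} {ρ : PMF (Signature N)} (hρ : SchurGenConverges ρ)
    (n : ℕ) : ContDiffAt ℂ n (schurGen ρ) 1 := by
  obtain ⟨U, hU, h1, hU0, hlim⟩ := hρ.exists_open
  exact (contDiffOn_of_tendstoLocallyUniformlyOn hU n hlim fun s =>
    ContDiffOn.sum fun lam _ => (contDiffOn_schurTerm ρ lam n).mono hU0).1.contDiffAt
      (hU.mem_nhds h1)

theorem SchurGenConverges.hasSum_iteratedFDeriv {N : ℕ} {ρ : PMF (Signature N)}
    (hρ : SchurGenConverges ρ) (n : ℕ) (v : Fin n → Fin N → ℂ) :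
    HasSum (fun lam => iteratedFDeriv ℂ n (schurTerm ρ lam) 1 v)
      (iteratedFDeriv ℂ n (schurGen ρ) 1 v) := by
  obtain ⟨U, hU, h1, hU0, hlim⟩ := hρ.exists_open
  have h2 := (contDiffOn_of_tendstoLocallyUniformlyOn hU n hlim fun s =>
    ContDiffOn.sum fun lam _ => (contDiffOn_schurTerm ρ lam n).mono hU0).2 1 h1
  have h3 := ((ContinuousMultilinearMap.apply ℂ (fun _ : Fin n => Fin N → ℂ) ℂ v).continuous.tendsto
    _).comp h2
  refine h3.congr fun s => ?_
  have h4 : ∀ lam ∈ s, ContDiffAt ℂ n (schurTerm ρ lam) 1 := fun lam _ =>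
    (contDiffOn_schurTerm ρ lam n).contDiffAt ((isOpen_forall_ne_zero N).mem_nhds
      fun i => one_ne_zero)
  simp only [Function.comp_apply, ContinuousMultilinearMap.apply_apply]
  rw [iteratedFDeriv_fun_sum_apply h4, sum_apply]

theorem schurTerm_one {N : ℕ} (ρ : PMF (Signature N)) (lam : Signature N) :
    schurTerm ρ lam 1 = ((ρ lam).toReal : ℂ) := by
  rw [schurTerm, div_self (schurChar_one_ne_zero lam), mul_one]

theorem hasSum_toReal {α : Type*} (ρ : PMF α) : HasSum (fun x => (ρ x).toReal) 1 := by
  have h := ρ.tsum_coe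
  have h1 : Summable fun x => (ρ x).toReal := ENNReal.summable_toReal (by rw [h]; simp)
  have h2 := ENNReal.tsum_toReal_eq (f := ρ) fun x => ρ.apply_ne_top x
  rw [h, ENNReal.toReal_one] at h2
  rw [h2]
  exact h1.hasSum

theorem schurGen_one {N : ℕ} (ρ : PMF (Signature N)) : schurGen ρ 1 = 1 := by
  simp only [schurGen, schurTerm_one]
  rw [← Complex.ofReal_tsum, (hasSum_toReal ρ).tsum_eq, Complex.ofReal_one]

theorem schurGen_perm {N : ℕ} (ρ : PMF (Signature N)) (σ : Equiv.Perm (Fin N)) (u : Fin N → ℂ) :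
    schurGen ρ (u ∘ σ) = schurGen ρ u := by
  simp only [schurGen, schurTerm, schurChar_perm]

theorem ContDiffAt.holNearOne {N : ℕ} {f : (Fin N → ℂ) → ℂ} (hf : ContDiffAt ℂ 1 f 1) :
    HolNearOne f :=
  (hf.eventually (by simp)).mono fun _ hu => hu.differentiableAt (by simp)

theorem contDiffAt_prod_apply {N : ℕ} {g : ℂ → ℂ} (hg : AnalyticAt ℂ g 1) (n : WithTop ℕ∞) :
    ContDiffAt ℂ n (fun u : Fin N → ℂ => ∏ j, g (u j)) 1 :=
  contDiffAt_prod fun j _ => ContDiffAt.comp (1 : Fin N → ℂ) (g := g) (f := fun u => u j)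
    hg.contDiffAt (contDiffAt_apply ℂ ℂ j 1)

/-- The operator values of symmetric functions. -/
theorem exists_hasDiffOpValue_symm (n : ℕ) (q : ℂ) :
    ∃ γ : ∀ s : JetIndex (n + 1), (Fin s.2.1 → Fin (n + 2)) → ℂ, (∀ s, ∑ x, γ s x = 0) ∧
      ∀ (N : ℕ) (f : (Fin N → ℂ) → ℂ) (g : ℂ → ℂ), (∀ m : ℕ, ContDiffAt ℂ m f 1) →
        SymmNearOne f → AnalyticAt ℂ g 1 → g 1 = 1 →
        HasDiffOpValue n q (fun u => f u * ∏ j, g (u j)) (f 1 * productValue N n q g +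
          ∑ s : JetIndex (n + 1),
            (iteratedFDeriv ℂ s.order f 1 fun a => coordDir N (s.2.2.1 a)) *
              ∑ x, γ s x * productValue N n q fun z => s.factor x z * g z) := by
  -- The order n + 1 is at least n, so the operator kills the remainder, and it is positive even for
  -- n = 0.
  obtain ⟨γ, hγ, h⟩ := exists_symmetric_jet (k := n + 1) (Nat.le_add_left 1 n)
  refine ⟨γ, hγ, fun N f g hf hs hg hg1 => ?_⟩
  have hjet := h N f (by exact_mod_cast hf (n + 1 + 1)) hs
  have hgf : ∀ (s : JetIndex (n + 1)) x, AnalyticAt ℂ (fun z => s.factor x z * g z) 1 :=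
    fun s x => (s.analyticAt_factor x 1).fun_mul hg
  have hbd : (fun u : Fin N → ℂ => ∏ j, g (u j)) =O[𝓝 1] fun _ => (1 : ℝ) :=
    (contDiffAt_prod_apply hg 0).continuousAt.isBigO_one ℝ
  have ho := hjet.mul_isBigO hbd
  simp only [mul_one] at ho
  set c : Option (Σ s : JetIndex (n + 1), Fin s.2.1 → Fin (n + 2)) → ℂ := fun o =>
    o.elim (f 1) fun p => (iteratedFDeriv ℂ p.1.order f 1 fun a => coordDir N (p.1.2.2.1 a)) *
      γ p.1 p.2 with hc
  set G : Option (Σ s : JetIndex (n + 1), Fin s.2.1 → Fin (n + 2)) → ℂ → ℂ := fun o =>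
    o.elim g fun p z => p.1.factor p.2 z * g z with hG
  have hGa : ∀ o, AnalyticAt ℂ (G o) 1 := by
    rintro (_ | ⟨s, x⟩)
    · exact hg
    · exact hgf s x
  have hG1 : ∀ o, G o 1 = 1 := by
    rintro (_ | ⟨s, x⟩)
    · exact hg1
    · simp [hG, s.factor_one, hg1]
  have hsum := HasDiffOpValue.sum Finset.univ c (n := n) (q := q)
    (f := fun o (u : Fin N → ℂ) => ∏ j, G o (u j)) (L := fun o => productValue N n q (G o))
    (fun o _ => holNearOne_prod N (hGa o)) fun o _ => hasDiffOpValue_prod N n q (hGa o) (hG1 o)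
  have hL : ∑ o, c o * productValue N n q (G o) = f 1 * productValue N n q g +
      ∑ s : JetIndex (n + 1),
        (iteratedFDeriv ℂ s.order f 1 fun a => coordDir N (s.2.2.1 a)) *
          ∑ x, γ s x * productValue N n q fun z => s.factor x z * g z := by
    rw [Fintype.sum_option, Fintype.sum_sigma]
    simp only [hc, hG, Option.elim, Finset.mul_sum, mul_assoc]
  rw [hL] at hsum
  refine HasDiffOpValue.congr_of_isLittleO
    (HolNearOne.sum Finset.univ c fun o _ => holNearOne_prod N (hGa o)) ?_ (Nat.le_succ n) ?_ hsum
  · exact ((hf 1).mul (contDiffAt_prod_apply hg _)).holNearOne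
  · refine ho.congr_left fun u => ?_
    have hsig : ∀ F : (Σ s : JetIndex (n + 1), Fin s.2.1 → Fin (n + 2)) → ℂ,
        ∑ p, F p = ∑ s, ∑ x, F ⟨s, x⟩ := Fintype.sum_sigma
    rw [Fintype.sum_option, hsig]
    simp only [hc, hG, Option.elim, Finset.prod_mul_distrib]
    rw [sub_mul, add_mul, Finset.sum_mul]
    congr 2
    refine Finset.sum_congr rfl fun s _ => ?_
    rw [mul_assoc, Finset.sum_mul, Finset.mul_sum]
    refine Finset.sum_congr rfl fun x _ => ?_
    ring

/-- The moments of the weights are the operator values of the Schur generating function. -/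
theorem SchurGenConverges.exists_hasSum {N : ℕ} {ρ : PMF (Signature N)} (hρ : SchurGenConverges ρ)
    (n : ℕ) (q : ℝ) : ∃ T : ℂ, HasDiffOpValue n q (schurGen ρ) T ∧
      HasSum (fun lam => ((ρ lam).toReal : ℂ) * ∑ i,
        (descPochhammer ℂ n).eval (lam.shifted i : ℂ) * (ppWeight q lam i : ℂ)) T := by
  obtain ⟨γ, -, h⟩ := exists_hasDiffOpValue_symm n q
  have hterm : ∀ lam, ∀ m : ℕ, ContDiffAt ℂ m (schurTerm ρ lam) 1 := fun lam m =>
    (contDiffOn_schurTerm ρ lam m).contDiffAt ((isOpen_forall_ne_zero N).mem_nhds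
      fun i => one_ne_zero)
  -- An explicit linear functional of finitely many derivatives at 1^N. It therefore commutes with
  -- the sum over λ, because the series for S_ρ can be differentiated termwise.
  set T : ((Fin N → ℂ) → ℂ) → ℂ := fun f => f 1 * productValue N n q (fun _ => 1) +
    ∑ s : JetIndex (n + 1), (iteratedFDeriv ℂ s.order f 1 fun a => coordDir N (s.2.2.1 a)) *
      ∑ x, γ s x * productValue N n q (s.factor x) with hT
  have key : ∀ f : (Fin N → ℂ) → ℂ, (∀ m : ℕ, ContDiffAt ℂ m f 1) → SymmNearOne f →
      HasDiffOpValue n q f (T f) := by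
    intro f hf hs
    have := h N f (fun _ => 1) hf hs analyticAt_const rfl
    simpa only [Finset.prod_const_one, mul_one] using this
  refine ⟨T (schurGen ρ), key _ hρ.contDiffAt
    fun σ => Eventually.of_forall fun u => schurGen_perm ρ σ u, ?_⟩
  have h3 : ∀ lam, ((ρ lam).toReal : ℂ) * ∑ i,
      (descPochhammer ℂ n).eval (lam.shifted i : ℂ) * (ppWeight q lam i : ℂ) =
      T (schurTerm ρ lam) := by
    intro lam
    have hhol : HolNearOne fun u => schurChar lam u / schurChar lam 1 :=
      by
      simp only [div_eq_mul_inv]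
      exact (holNearOne_schurChar lam).mono fun u hu => hu.mul_const _
    -- On a single summand the operator value is known in two ways; uniqueness of limits equates T
    -- with the factorial moment.
    have h4 := (hasDiffOpValue_schurChar n q lam).const_mul ((ρ lam).toReal : ℂ) hhol
    exact h4.unique (key _ (hterm lam)
      fun σ => Eventually.of_forall fun u => by simp only [schurChar_perm])
  simp only [h3, hT]
  refine HasSum.add (HasSum.mul_right _ ?_) (hasSum_sum fun s _ => HasSum.mul_right _
    (hρ.hasSum_iteratedFDeriv _ _))
  simpa using hρ.hasSum_iteratedFDeriv 0 Fin.elim0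

/-! ### The logarithm of the Schur generating function -/

theorem iteratedFDeriv_comp_affine {E F G : Type*} [NormedAddCommGroup E] [NormedSpace ℂ E]
    [NormedAddCommGroup F] [NormedSpace ℂ F] [NormedAddCommGroup G] [NormedSpace ℂ G] {f : F → G}
    (L : E →L[ℂ] F) (c : F) (x : E) {m : ℕ} (hf : ContDiffAt ℂ m f (c + L x)) :
    iteratedFDeriv ℂ m (fun y => f (c + L y)) x =
      (iteratedFDeriv ℂ m f (c + L x)).compContinuousLinearMap fun _ => L := by
  set f' : F → G := fun w => f (c + w) with hf'
  have hfc : ContDiffAt ℂ m f' (L x) := by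
    have h : ContDiffAt ℂ m (fun w : F => c + w) (L x) := contDiffAt_const.add contDiffAt_id
    exact ContDiffAt.comp (L x) hf h
  obtain ⟨s, hs, hso, hxs⟩ := eventually_nhds_iff.1 (hfc.eventually (by simp))
  have h1 := L.iteratedFDerivWithin_comp_right (f := f') (n := m)
    (fun y hy => (hs y hy).contDiffWithinAt) hso.uniqueDiffOn
    (hso.preimage L.continuous).uniqueDiffOn hxs le_rfl
  rw [iteratedFDerivWithin_of_isOpen (𝕜 := ℂ) m hso hxs,
    iteratedFDerivWithin_of_isOpen (𝕜 := ℂ) m (hso.preimage L.continuous) hxs] at h1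
  have h2 : iteratedFDeriv ℂ m f' (L x) = iteratedFDeriv ℂ m f (c + L x) :=
    iteratedFDeriv_comp_add_left m c (L x)
  rw [h2] at h1
  exact h1

/-- The Schur generating function on the line through `1^N` in the direction of the first
coordinate. -/
noncomputable def axisGen {N : ℕ} (ρ : PMF (Signature N)) (z : ℂ) : ℂ :=
  schurGen ρ (1 + (z - 1) • coordDir N 0)

/-- The difference between `log S_ρ` and its approximation by a sum of functions of one variable. -/
noncomputable def logRemainder {N : ℕ} (ρ : PMF (Signature N)) (u : Fin N → ℂ) : ℂ :=
  Complex.log (schurGen ρ u) - ∑ j, Complex.log (axisGen ρ (u j))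

theorem axisGen_one {N : ℕ} (ρ : PMF (Signature N)) : axisGen ρ 1 = 1 := by
  rw [axisGen, sub_self, zero_smul, add_zero, schurGen_one]

theorem axisGen_eq {N : ℕ} (ρ : PMF (Signature N)) (z : ℂ) :
    axisGen ρ z = schurGen ρ ((1 - coordDir N 0) +
      ContinuousLinearMap.toSpanSingleton ℂ (coordDir N 0) z) := by
  rw [axisGen, ContinuousLinearMap.toSpanSingleton_apply, sub_smul, one_smul]
  congr 1
  abel

theorem axis_base {N : ℕ} : (1 - coordDir N 0) +
    ContinuousLinearMap.toSpanSingleton ℂ (coordDir N 0) 1 = (1 : Fin N → ℂ) := by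
  simp

namespace SchurGenConverges

variable {N : ℕ} {ρ : PMF (Signature N)}

theorem analyticAt_axisGen (hρ : SchurGenConverges ρ) : AnalyticAt ℂ (axisGen ρ) 1 := by
  rw [Complex.analyticAt_iff_eventually_differentiableAt]
  have h1 := (hρ.contDiffAt 1).holNearOne
  have ht : Tendsto (fun z : ℂ => 1 + (z - 1) • coordDir N 0) (𝓝 1) (𝓝 1) := by
    have hc : Continuous fun z : ℂ => 1 + (z - 1) • coordDir N 0 := by fun_prop
    have := hc.tendsto 1
    simpa using this
  filter_upwards [ht.eventually h1] with z hz
  exact DifferentiableAt.comp z (f := fun z : ℂ => 1 + (z - 1) • coordDir N 0) hz (by fun_prop)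

theorem contDiffAt_log (hρ : SchurGenConverges ρ) (m : ℕ) :
    ContDiffAt ℂ m (fun u => Complex.log (schurGen ρ u)) 1 :=
  (Complex.contDiffAt_log (by rw [schurGen_one]; exact Complex.one_mem_slitPlane)).comp 1
    (hρ.contDiffAt m)

theorem analyticAt_log_axisGen (hρ : SchurGenConverges ρ) :
    AnalyticAt ℂ (fun z => Complex.log (axisGen ρ z)) 1 :=
  hρ.analyticAt_axisGen.clog (by rw [axisGen_one]; exact Complex.one_mem_slitPlane)

theorem iteratedDeriv_log_axisGen (hρ : SchurGenConverges ρ) (m : ℕ) :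
    iteratedDeriv m (fun z => Complex.log (axisGen ρ z)) 1 =
      logSchurDeriv ρ fun _ : Fin m => 0 := by
  have h := iteratedFDeriv_comp_affine (f := fun u => Complex.log (schurGen ρ u))
    (ContinuousLinearMap.toSpanSingleton ℂ (coordDir N 0)) (1 - coordDir N 0) 1 (m := m)
    (by rw [axis_base]; exact hρ.contDiffAt_log m)
  rw [axis_base] at h
  simp only [axisGen_eq]
  rw [iteratedDeriv_eq_iteratedFDeriv, h, ContinuousMultilinearMap.compContinuousLinearMap_apply,
    logSchurDeriv]
  simp

theorem contDiffAt_log_axisGen_apply (hρ : SchurGenConverges ρ) (j : Fin N) (m : ℕ) :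
    ContDiffAt ℂ m (fun u : Fin N → ℂ => Complex.log (axisGen ρ (u j))) 1 := by
  have h : ContDiffAt ℂ m (fun z => Complex.log (axisGen ρ z)) ((1 : Fin N → ℂ) j) :=
    hρ.analyticAt_log_axisGen.contDiffAt
  exact h.comp (1 : Fin N → ℂ) (contDiffAt_apply ℂ ℂ j 1)

theorem contDiffAt_logRemainder (hρ : SchurGenConverges ρ) (m : ℕ) :
    ContDiffAt ℂ m (logRemainder ρ) 1 :=
  (hρ.contDiffAt_log m).sub (ContDiffAt.sum fun j _ => hρ.contDiffAt_log_axisGen_apply j m)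

theorem iteratedFDeriv_logRemainder (hρ : SchurGenConverges ρ) {m : ℕ} (i : Fin m → ℕ) :
    (iteratedFDeriv ℂ m (logRemainder ρ) 1 fun a => coordDir N (i a)) =
      logSchurDeriv ρ i - (∑ j : Fin N, ∏ a, coordDir N (i a) j) *
        logSchurDeriv ρ fun _ : Fin m => 0 := by
  have h1 : iteratedFDeriv ℂ m (logRemainder ρ) 1 =
      iteratedFDeriv ℂ m (fun u => Complex.log (schurGen ρ u)) 1 -
        ∑ j, iteratedFDeriv ℂ m (fun u : Fin N → ℂ => Complex.log (axisGen ρ (u j))) 1 := by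
    rw [← iteratedFDeriv_fun_sum_apply fun j _ => hρ.contDiffAt_log_axisGen_apply j m]
    exact iteratedFDeriv_sub_apply (hρ.contDiffAt_log m)
      (ContDiffAt.sum fun j _ => hρ.contDiffAt_log_axisGen_apply j m)
  rw [h1, sub_apply, sum_apply, Finset.sum_mul]
  congr 1
  refine Finset.sum_congr rfl fun j _ => ?_
  have h2 := iteratedFDeriv_comp_affine (f := fun z => Complex.log (axisGen ρ z))
    (ContinuousLinearMap.proj (R := ℂ) (φ := fun _ : Fin N => ℂ) j) 0 1 (m := m)
    (by simpa using hρ.analyticAt_log_axisGen.contDiffAt)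
  simp only [ContinuousLinearMap.proj_apply, zero_add, Pi.one_apply] at h2
  rw [h2, ContinuousMultilinearMap.compContinuousLinearMap_apply,
    iteratedFDeriv_apply_eq_iteratedDeriv_mul_prod, iteratedDeriv_log_axisGen hρ, smul_eq_mul]
  rfl

theorem exp_logRemainder_mul (hρ : SchurGenConverges ρ) :
    (fun u => Complex.exp (logRemainder ρ u) * ∏ j, axisGen ρ (u j)) =ᶠ[𝓝 1] schurGen ρ := by
  have h1 : ∀ᶠ u in 𝓝 (1 : Fin N → ℂ), schurGen ρ u ≠ 0 :=
    (hρ.contDiffAt 0).continuousAt.eventually_ne (by rw [schurGen_one]; exact one_ne_zero)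
  have h2 : ∀ᶠ u in 𝓝 (1 : Fin N → ℂ), ∀ j, axisGen ρ (u j) ≠ 0 :=
    eventually_all.2 fun j => ((continuous_apply j).tendsto (1 : Fin N → ℂ)).eventually
      (hρ.analyticAt_axisGen.continuousAt.eventually_ne (by rw [axisGen_one]; exact one_ne_zero))
  filter_upwards [h1, h2] with u hu hu'
  rw [logRemainder, Complex.exp_sub, Complex.exp_log hu, Complex.exp_sum,
    Finset.prod_congr rfl fun j _ => Complex.exp_log (hu' j),
    div_mul_cancel₀ _ (Finset.prod_ne_zero_iff.2 fun j _ => hu' j)]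

end SchurGenConverges

theorem logRemainder_one {N : ℕ} (ρ : PMF (Signature N)) : logRemainder ρ 1 = 0 := by
  simp [logRemainder, schurGen_one, axisGen_one]

theorem logRemainder_perm {N : ℕ} (ρ : PMF (Signature N)) (σ : Equiv.Perm (Fin N))
    (u : Fin N → ℂ) : logRemainder ρ (u ∘ σ) = logRemainder ρ u := by
  have h := Equiv.sum_comp σ fun j => Complex.log (axisGen ρ (u j))
  simp only [logRemainder, schurGen_perm, Function.comp_apply]
  rw [h]

/-- Mixed derivatives do not see the sum of one-variable functions, so they tend to 0 by hypothesis.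
A pure derivative in direction c is that of log S_ρ in direction c minus that in direction 0; both
are N a_k + b_k + o(1), so even the terms of order N cancel. -/
theorem tendsto_iteratedFDeriv_logRemainder {ρ : ∀ N : ℕ, PMF (Signature N)}
    (hρ : ∀ N, SchurGenConverges (ρ N)) {a b : ℕ → ℂ}
    (hpure : ∀ i k : ℕ, 1 ≤ k →
      Tendsto (fun N : ℕ => logSchurDeriv (ρ N) (fun _ : Fin k => i) - N * a k) atTop (𝓝 (b k)))
    (hmixed : ∀ (m : ℕ) (i : Fin m → ℕ), 2 ≤ (Set.range i).ncard →
      Tendsto (fun N : ℕ => logSchurDeriv (ρ N) i) atTop (𝓝 0))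
    {m : ℕ} (hm : 1 ≤ m) (i : Fin m → ℕ) :
    Tendsto (fun N => iteratedFDeriv ℂ m (logRemainder (ρ N)) 1 fun s => coordDir N (i s))
      atTop (𝓝 0) := by
  simp only [(hρ _).iteratedFDeriv_logRemainder]
  by_cases hc : ∃ s t, i s ≠ i t
  · obtain ⟨s, t, hst⟩ := hc
    have h2 : 2 ≤ (Set.range i).ncard := by
      rw [← Set.ncard_pair hst]
      exact Set.ncard_le_ncard (by rintro x (rfl | rfl) <;> exact Set.mem_range_self _)
        (Set.finite_range i)
    have h0 : ∀ N : ℕ, ∑ j : Fin N, ∏ s, coordDir N (i s) j = 0 := by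
      intro N
      refine Finset.sum_eq_zero fun j _ => ?_
      by_cases hj : (j : ℕ) = i s
      · refine Finset.prod_eq_zero (Finset.mem_univ t) ?_
        rw [coordDir, if_neg fun h => hst (hj.symm.trans h)]
      · exact Finset.prod_eq_zero (Finset.mem_univ s) (by rw [coordDir, if_neg hj])
    simpa [h0] using hmixed m i h2
  · push Not at hc
    have hi : i = fun _ => i ⟨0, hm⟩ := funext fun s => hc s _
    rw [hi]
    set c := i ⟨0, hm⟩
    have h := (hpure c m hm).sub (hpure 0 m hm)
    rw [sub_self] at h
    refine h.congr' ?_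
    filter_upwards [eventually_gt_atTop c] with N hN
    have h1 : ∑ j : Fin N, ∏ _s : Fin m, coordDir N c j = 1 := by
      rw [Finset.sum_eq_single ⟨c, hN⟩]
      · simp [coordDir]
      · intro j _ hj
        refine Finset.prod_eq_zero (Finset.mem_univ ⟨0, hm⟩) ?_
        rw [coordDir, if_neg fun h => hj (Fin.ext h)]
      · simp
    rw [h1]
    ring

/-! ### Exponentials of functions with small derivatives -/

/-- By the Faà di Bruno bound, ‖F^{(i)}(0)‖ ≤ D^i for 1 ≤ i ≤ m gives at most m!·C·D^m, with C
depending only on derivatives of exp at 0; D can be taken arbitrarily small. -/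
theorem tendsto_norm_iteratedFDeriv_exp {E : Type*} [NormedAddCommGroup E] [NormedSpace ℂ E]
    {F : ℕ → E → ℂ} (hF : ∀ᶠ N in atTop, ∀ m : ℕ, ContDiffAt ℂ m (F N) 0)
    (h0 : ∀ᶠ N in atTop, F N 0 = 0)
    (hlim : ∀ m : ℕ, 1 ≤ m → Tendsto (fun N => ‖iteratedFDeriv ℂ m (F N) 0‖) atTop (𝓝 0))
    {m : ℕ} (hm : 1 ≤ m) :
    Tendsto (fun N => ‖iteratedFDeriv ℂ m (fun y => Complex.exp (F N y)) 0‖) atTop (𝓝 0) := by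
  set C : ℝ := ∑ i ∈ Finset.range (m + 1), ‖iteratedFDeriv ℂ i Complex.exp 0‖ with hC
  have hC0 : 0 ≤ C := Finset.sum_nonneg fun _ _ => norm_nonneg _
  have key : ∀ D : ℝ, 0 < D → ∀ᶠ N in atTop,
      ‖iteratedFDeriv ℂ m (fun y => Complex.exp (F N y)) 0‖ ≤ m.factorial * C * D ^ m := by
    intro D hD
    have h1 : ∀ᶠ N in atTop, ∀ i ∈ Finset.Icc 1 m, ‖iteratedFDeriv ℂ i (F N) 0‖ < D ^ i :=
      (Finset.eventually_all _).2 fun i hi =>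
        (hlim i (Finset.mem_Icc.1 hi).1).eventually_lt_const (pow_pos hD i)
    filter_upwards [hF, h0, h1] with N hFN h0N h1N
    obtain ⟨s, hs, hso, hxs⟩ := eventually_nhds_iff.1 ((hFN m).eventually (by simp))
    have h2 := norm_iteratedFDerivWithin_comp_le (𝕜 := ℂ) (g := Complex.exp) (f := F N) (n := m)
      (s := s) (t := Set.univ) (x := 0) (N := m) Complex.contDiff_exp.contDiffOn
      (fun y hy => (hs y hy).contDiffWithinAt) le_rfl uniqueDiffOn_univ hso.uniqueDiffOn
      (fun _ _ => Set.mem_univ _) hxs (C := C) (D := D)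
      (fun i hi => by
        rw [iteratedFDerivWithin_univ, h0N]
        exact Finset.single_le_sum (f := fun i => ‖iteratedFDeriv ℂ i Complex.exp 0‖)
          (fun _ _ => norm_nonneg _) (Finset.mem_range.2 (Nat.lt_succ_of_le hi)))
      (fun i hi1 hi => by
        rw [iteratedFDerivWithin_of_isOpen (𝕜 := ℂ) i hso hxs]
        exact (h1N i (Finset.mem_Icc.2 ⟨hi1, hi⟩)).le)
    rw [iteratedFDerivWithin_of_isOpen (𝕜 := ℂ) m hso hxs] at h2
    exact h2
  rw [Metric.tendsto_nhds]
  intro ε hε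
  set A : ℝ := m.factorial * C with hA
  have hA0 : 0 ≤ A := by positivity
  -- D ≤ 1 gives D^m ≤ D because m ≥ 1, and the second bound makes A·D < ε.
  set D : ℝ := min 1 (ε / (2 * (A + 1))) with hD
  have hD0 : 0 < D := lt_min one_pos (by positivity)
  filter_upwards [key D hD0] with N hN
  rw [dist_zero_right, norm_norm]
  refine hN.trans_lt ?_
  calc A * D ^ m ≤ A * D := by
        gcongr
        exact pow_le_of_le_one hD0.le (min_le_left _ _) (by omega)
    _ ≤ A * (ε / (2 * (A + 1))) := by
        gcongr
        exact min_le_right _ _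
    _ < ε := by
        rw [mul_div_assoc', div_lt_iff₀ (by positivity)]
        nlinarith

theorem norm_multilinear_le_sum {K m : ℕ} (A : (Fin K → ℂ) [×m]→L[ℂ] ℂ) :
    ‖A‖ ≤ ∑ i : Fin m → Fin K, ‖A fun s => Pi.single (i s) 1‖ := by
  refine ContinuousMultilinearMap.opNorm_le_bound (Finset.sum_nonneg fun _ _ => norm_nonneg _)
    fun v => ?_
  have hv : v = fun s => ∑ j, v s j • (Pi.single j 1 : Fin K → ℂ) := by
    funext s
    ext n
    simp [Finset.sum_apply, Pi.single_apply]
  conv_lhs => rw [hv]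
  rw [ContinuousMultilinearMap.map_sum, Finset.sum_mul]
  refine (norm_sum_le _ _).trans (Finset.sum_le_sum fun i _ => ?_)
  rw [ContinuousMultilinearMap.map_smul_univ, norm_smul, norm_prod, mul_comm]
  gcongr with s
  exact norm_le_pi_norm (v s) (i s)

/-- The inclusion of the span of the first `K` coordinate directions. -/
noncomputable def coordIncl (N K : ℕ) : (Fin K → ℂ) →L[ℂ] (Fin N → ℂ) :=
  ∑ b : Fin K, (ContinuousLinearMap.proj (R := ℂ) (φ := fun _ : Fin K => ℂ) b).smulRight
    (coordDir N b)

theorem coordIncl_single (N : ℕ) {K : ℕ} (b : Fin K) :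
    coordIncl N K (Pi.single b 1) = coordDir N b := by
  simp [coordIncl, Pi.single_apply]

/-- The ambient dimension grows with N, so full operator norms are not under control. Restriction to
the first K coordinates, with K bounding the indices in question, reduces to the fixed space ℂ^K,
where finitely many entries control the norm. -/
theorem tendsto_iteratedFDeriv_exp_logRemainder {ρ : ∀ N : ℕ, PMF (Signature N)}
    (hρ : ∀ N, SchurGenConverges (ρ N))
    (hlim : ∀ m : ℕ, 1 ≤ m → ∀ i : Fin m → ℕ,
      Tendsto (fun N => iteratedFDeriv ℂ m (logRemainder (ρ N)) 1 fun s => coordDir N (i s))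
        atTop (𝓝 0)) {m : ℕ} (hm : 1 ≤ m) (i : Fin m → ℕ) :
    Tendsto (fun N => iteratedFDeriv ℂ m (fun u => Complex.exp (logRemainder (ρ N) u)) 1
      fun s => coordDir N (i s)) atTop (𝓝 0) := by
  obtain ⟨K, hK⟩ : ∃ K, ∀ s, i s < K := ⟨∑ s, i s + 1, fun s => Nat.lt_succ_of_le
    (Finset.single_le_sum (f := i) (fun _ _ => Nat.zero_le _) (Finset.mem_univ s))⟩
  have hbase : ∀ N, (1 : Fin N → ℂ) + coordIncl N K 0 = 1 := fun N => by simp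
  have hcomp : ∀ N (f : (Fin N → ℂ) → ℂ) (n : ℕ), ContDiffAt ℂ n f 1 → ∀ j : Fin n → Fin K,
      (iteratedFDeriv ℂ n (fun y => f (1 + coordIncl N K y)) 0 fun s => Pi.single (j s) 1) =
        iteratedFDeriv ℂ n f 1 fun s => coordDir N (j s) := by
    intro N f n hf j
    rw [iteratedFDeriv_comp_affine (coordIncl N K) 1 0 (by rw [hbase]; exact hf), hbase,
      ContinuousMultilinearMap.compContinuousLinearMap_apply]
    simp only [coordIncl_single]
  have hsm : ∀ N (n : ℕ), ContDiffAt ℂ n (fun y => logRemainder (ρ N) (1 + coordIncl N K y)) 0 := by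
    intro N n
    have h1 : ContDiffAt ℂ n (fun y => (1 : Fin N → ℂ) + coordIncl N K y) 0 :=
      contDiffAt_const.add (coordIncl N K).contDiff.contDiffAt
    have h2 : ContDiffAt ℂ n (logRemainder (ρ N)) (1 + coordIncl N K 0) := by
      rw [hbase]
      exact (hρ N).contDiffAt_logRemainder n
    exact h2.comp (0 : Fin K → ℂ) h1
  have hexp := tendsto_norm_iteratedFDeriv_exp
    (F := fun N y => logRemainder (ρ N) (1 + coordIncl N K y))
    (Eventually.of_forall fun N n => hsm N n)
    (Eventually.of_forall fun N => by simp only [hbase, logRemainder_one])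
    (fun n hn => by
      refine squeeze_zero (fun _ => norm_nonneg _) (fun N => norm_multilinear_le_sum _) ?_
      have h3 : ∀ j : Fin n → Fin K, Tendsto (fun N => ‖iteratedFDeriv ℂ n
          (fun y => logRemainder (ρ N) (1 + coordIncl N K y)) 0 fun s => Pi.single (j s) 1‖)
          atTop (𝓝 0) := by
        intro j
        simp only [hcomp _ _ n ((hρ _).contDiffAt_logRemainder n) j]
        simpa using (hlim n hn fun s => j s).norm
      have h4 := tendsto_finsetSum (Finset.univ : Finset (Fin n → Fin K)) fun j _ => h3 j
      rwa [Finset.sum_const_zero] at h4) hm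
  refine squeeze_zero_norm (fun N => ?_) hexp
  have h2 := hcomp N (fun u => Complex.exp (logRemainder (ρ N) u)) m
    ((hρ N).contDiffAt_logRemainder m).cexp fun s => ⟨i s, hK s⟩
  rw [← h2]
  refine (ContinuousMultilinearMap.le_opNorm _ _).trans ?_
  refine mul_le_of_le_one_right (norm_nonneg _) (Finset.prod_le_one (fun _ _ => norm_nonneg _)
    fun s _ => ?_)
  refine (pi_norm_le_iff_of_nonneg zero_le_one).2 fun n => ?_
  by_cases h : n = ⟨i s, hK s⟩
  · subst h; simp
  · simp [Pi.single_eq_of_ne h]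

/-! ### Asymptotics of the operator values -/

theorem SchurGenConverges.taylorAt_logDeriv_axisGen {N : ℕ} {ρ : PMF (Signature N)}
    (hρ : SchurGenConverges ρ) :
    taylorAt 1 (fun u => deriv (axisGen ρ) u / axisGen ρ u) =
      PowerSeries.derivative ℂ (taylorAt 1 fun z => Complex.log (axisGen ρ z)) := by
  rw [← taylorAt_deriv]
  refine taylorAt_congr ?_
  have hs : ∀ᶠ z in 𝓝 (1 : ℂ), axisGen ρ z ∈ Complex.slitPlane :=
    hρ.analyticAt_axisGen.continuousAt.eventually (Complex.isOpen_slitPlane.mem_nhds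
      (by rw [axisGen_one]; exact Complex.one_mem_slitPlane))
  filter_upwards [hs, hρ.analyticAt_axisGen.eventually_analyticAt] with z hz ha
  exact (ha.differentiableAt.hasDerivAt.clog hz).deriv.symm

theorem seriesExpansion_axisGen {ρ : ∀ N : ℕ, PMF (Signature N)}
    (hρ : ∀ N, SchurGenConverges (ρ N)) {a b : ℕ → ℂ}
    (hpure : ∀ i k : ℕ, 1 ≤ k →
      Tendsto (fun N : ℕ => logSchurDeriv (ρ N) (fun _ : Fin k => i) - N * a k) atTop (𝓝 (b k)))
    (hΨ : TaylorOneConverges a) (hΦ : TaylorOneConverges b) :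
    SeriesExpansion (fun N => PowerSeries.C ((N : ℂ)⁻¹) *
      taylorAt 1 fun u => deriv (axisGen (ρ N)) u / axisGen (ρ N) u)
      (taylorAt 1 (deriv (taylorOne a))) (taylorAt 1 (deriv (taylorOne b))) := by
  intro j
  rw [taylorAt_deriv, taylorAt_deriv, PowerSeries.coeff_derivative, PowerSeries.coeff_derivative,
    coeff_taylorAt_taylorOne hΨ, coeff_taylorAt_taylorOne hΦ]
  simp only [(hρ _).taylorAt_logDeriv_axisGen, PowerSeries.coeff_C_mul,
    PowerSeries.coeff_derivative, coeff_taylorAt, (hρ _).iteratedDeriv_log_axisGen]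
  have h := (hpure 0 (j + 1) (Nat.le_add_left 1 j)).mul_const
    (((j + 1).factorial : ℂ)⁻¹ * ((j : ℂ) + 1))
  have hb : b (j + 1) / ((j + 1).factorial : ℂ) * ((j : ℂ) + 1) =
      b (j + 1) * (((j + 1).factorial : ℂ)⁻¹ * ((j : ℂ) + 1)) := by ring
  rw [HasExpansion, hb]
  refine h.congr' ?_
  filter_upwards [eventually_gt_atTop 0] with N hN
  have hN0 : (N : ℂ) ≠ 0 := by exact_mod_cast hN.ne'
  field_simp

/-- Logarithmic derivatives add, and that of the fixed function f is multiplied by 1/N, so it enters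
only the correction φ. -/
theorem seriesExpansion_mul_axisGen {ρ : ∀ N : ℕ, PMF (Signature N)}
    (hρ : ∀ N, SchurGenConverges (ρ N)) {ψ φ : PowerSeries ℂ}
    (h : SeriesExpansion (fun N => PowerSeries.C ((N : ℂ)⁻¹) *
      taylorAt 1 fun u => deriv (axisGen (ρ N)) u / axisGen (ρ N) u) ψ φ)
    {f : ℂ → ℂ} (hf : AnalyticAt ℂ f 1) (hf1 : f 1 = 1) :
    SeriesExpansion (fun N => PowerSeries.C ((N : ℂ)⁻¹) *
      taylorAt 1 fun u => deriv (fun z => f z * axisGen (ρ N) z) u / (f u * axisGen (ρ N) u))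
      ψ (φ + taylorAt 1 fun u => deriv f u / f u) := by
  have h1 := h.add (SeriesExpansion.const (taylorAt 1 fun u => deriv f u / f u)).inv_mul
  rw [add_zero] at h1
  refine h1.congr' (Eventually.of_forall fun N => ?_)
  have hg := (hρ N).analyticAt_axisGen
  have hg0 : axisGen (ρ N) 1 ≠ 0 := by rw [axisGen_one]; exact one_ne_zero
  have hf0 : f 1 ≠ 0 := by rw [hf1]; exact one_ne_zero
  simp only
  rw [← mul_add, ← taylorAt_add (hg.deriv.fun_div hg hg0) (hf.deriv.fun_div hf hf0)]
  congr 1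
  refine taylorAt_congr ?_
  filter_upwards [hg.eventually_analyticAt, hf.eventually_analyticAt,
    hg.continuousAt.eventually_ne hg0, hf.continuousAt.eventually_ne hf0] with z hgz hfz hg0z hf0z
  rw [deriv_fun_mul hfz.differentiableAt hgz.differentiableAt]
  field_simp
  ring

/-- Near 1^N, S_ρ = exp(R) ∏ g(u_j), and the symmetric jet of exp(R) reduces its value to product
values. The main term comes from g; every other term is a derivative of exp(R), which is o(1), times
a combination of product values with a common leading term and weights of sum 0, hence o(1/N). -/
theorem hasExpansion_diffOpValue {ρ : ∀ N : ℕ, PMF (Signature N)}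
    (hρ : ∀ N, SchurGenConverges (ρ N)) {a b : ℕ → ℂ}
    (hpure : ∀ i k : ℕ, 1 ≤ k →
      Tendsto (fun N : ℕ => logSchurDeriv (ρ N) (fun _ : Fin k => i) - N * a k) atTop (𝓝 (b k)))
    (hmixed : ∀ (m : ℕ) (i : Fin m → ℕ), 2 ≤ (Set.range i).ncard →
      Tendsto (fun N : ℕ => logSchurDeriv (ρ N) i) atTop (𝓝 0))
    (hΨ : TaylorOneConverges a) (hΦ : TaylorOneConverges b) (n : ℕ) (q : ℂ) {T : ℕ → ℂ}
    (hT : ∀ N, HasDiffOpValue n q (schurGen (ρ N)) (T N)) :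
    HasExpansion (fun N => ((N : ℂ)⁻¹) ^ (n + 1) * T N)
      (limitValue n q (taylorAt 1 (deriv (taylorOne a))))
      (correctionValue n q (taylorAt 1 (deriv (taylorOne a)))
        (taylorAt 1 (deriv (taylorOne b)))) := by
  set ψ := taylorAt 1 (deriv (taylorOne a))
  set φ := taylorAt 1 (deriv (taylorOne b))
  have hser : SeriesExpansion (fun N => PowerSeries.C ((N : ℂ)⁻¹) *
      taylorAt 1 fun u => deriv (axisGen (ρ N)) u / axisGen (ρ N) u) ψ φ :=
    seriesExpansion_axisGen hρ hpure hΨ hΦ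
  obtain ⟨γ, hγ, hval⟩ := exists_hasDiffOpValue_symm n q
  have hTeq : ∀ N, T N = productValue N n q (axisGen (ρ N)) + ∑ s : JetIndex (n + 1),
      (iteratedFDeriv ℂ s.order (fun u => Complex.exp (logRemainder (ρ N) u)) 1
        fun t => coordDir N (s.2.2.1 t)) *
        ∑ x, γ s x * productValue N n q fun z => s.factor x z * axisGen (ρ N) z := by
    intro N
    have h1 := hval N (fun u => Complex.exp (logRemainder (ρ N) u)) (axisGen (ρ N))
      (fun m => ((hρ N).contDiffAt_logRemainder m).cexp)
      (fun σ => Eventually.of_forall fun u => by simp only [logRemainder_perm])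
      (hρ N).analyticAt_axisGen (axisGen_one _)
    rw [logRemainder_one, Complex.exp_zero, one_mul] at h1
    have he := (hρ N).exp_logRemainder_mul
    have h2 : HasDiffOpValue n q (schurGen (ρ N)) _ := h1.congr_of_isLittleO (k := n)
      (((hρ N).contDiffAt 1).congr_of_eventuallyEq he).holNearOne
      ((hρ N).contDiffAt 1).holNearOne le_rfl
      ((Asymptotics.isLittleO_zero _ _).congr' (he.mono fun u hu => by simp [hu])
        EventuallyEq.rfl)
    exact (hT N).unique h2
  have hmain := hasExpansion_productValue n q
    (Eventually.of_forall fun N => (hρ N).analyticAt_axisGen)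
    (Eventually.of_forall fun N => axisGen_one (ρ N)) hser
  have hder := fun s : JetIndex (n + 1) => tendsto_iteratedFDeriv_exp_logRemainder hρ
    (fun m hm i => tendsto_iteratedFDeriv_logRemainder hρ hpure hmixed hm i)
    (m := s.order) (Nat.le_add_left 1 _) fun t => (s.2.2.1 t : ℕ)
  have hfac : ∀ s : JetIndex (n + 1), ∃ B, HasExpansion (fun N => ∑ x, γ s x *
      (((N : ℂ)⁻¹) ^ (n + 1) * productValue N n q fun z => s.factor x z * axisGen (ρ N) z)) 0 B := by
    intro s
    have h1 := HasExpansion.sum Finset.univ fun x (_ : x ∈ Finset.univ) =>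
      (hasExpansion_productValue n q (g := fun N z => s.factor x z * axisGen (ρ N) z)
        (Eventually.of_forall fun N =>
          (s.analyticAt_factor x 1).fun_mul (hρ N).analyticAt_axisGen)
        (Eventually.of_forall fun N => by rw [s.factor_one, axisGen_one, one_mul])
        (seriesExpansion_mul_axisGen hρ hser (s.analyticAt_factor x 1)
          (s.factor_one x))).const_mul (γ s x)
    -- All products share the leading term `limitValue`, so the vanishing sum of the weights removes
    -- it.
    rw [← Finset.sum_mul, hγ, zero_mul] at h1
    exact ⟨_, h1⟩
  choose B hB using hfac
  have hsmall : ∀ s : JetIndex (n + 1), HasExpansion (fun N =>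
      (iteratedFDeriv ℂ s.order (fun u => Complex.exp (logRemainder (ρ N) u)) 1
        fun t => coordDir N (s.2.2.1 t)) * ∑ x, γ s x * (((N : ℂ)⁻¹) ^ (n + 1) *
          productValue N n q fun z => s.factor x z * axisGen (ρ N) z)) 0 0 := by
    intro s
    -- The factor N is absorbed by the bracket, which is O(1/N); the derivative tends to 0.
    have h1 := (hder s).mul (hB s)
    rw [zero_mul] at h1
    refine h1.congr fun N => ?_
    ring
  have htot := hmain.add (HasExpansion.sum Finset.univ fun s _ => hsmall s)
  simp only [Finset.sum_const_zero, add_zero] at htot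
  refine htot.congr' (Eventually.of_forall fun N => ?_)
  simp only [hTeq]
  rw [mul_add, Finset.mul_sum]
  congr 1
  refine Finset.sum_congr rfl fun s _ => ?_
  rw [Finset.mul_sum, Finset.mul_sum, Finset.mul_sum]
  refine Finset.sum_congr rfl fun x _ => ?_
  ring

/-! ### The Perelomov-Popov measures -/

/-- Distinct integers differ by at least 1 ≥ |q|, so subtracting q never reverses the sign of a
difference. This matters because `ENNReal.ofReal` in `ppMeasure` would truncate negative weights. -/
theorem ppWeight_nonneg {N : ℕ} {q : ℝ} (hq : q ∈ Set.Icc (-1 : ℝ) 1) (lam : Signature N)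
    (i : Fin N) : 0 ≤ ppWeight q lam i := by
  refine Finset.prod_nonneg fun j hj => ?_
  have hne := lam.shifted_ne (Finset.ne_of_mem_erase hj)
  rcases lt_or_gt_of_ne hne with h | h
  · have h1 : (lam.shifted j : ℝ) + 1 ≤ lam.shifted i := by exact_mod_cast h
    exact div_nonneg (by linarith [hq.2]) (by linarith)
  · have h1 : (lam.shifted i : ℝ) + 1 ≤ lam.shifted j := by exact_mod_cast h
    exact div_nonneg_of_nonpos (by linarith [hq.1]) (by linarith)

theorem ppIntegral_eq_sum {N : ℕ} {q : ℝ} (hq : q ∈ Set.Icc (-1 : ℝ) 1) (lam : Signature N)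
    (P : ℂ[X]) : ppIntegral q lam P =
      ∑ i, (ppWeight q lam i : ℂ) / N * P.eval ((lam.shifted i : ℂ) / N) := by
  rw [ppIntegral, ppMeasure, MeasureTheory.integral_finsetSum_measure]
  · refine Finset.sum_congr rfl fun i _ => ?_
    rw [MeasureTheory.integral_smul_measure, MeasureTheory.integral_dirac,
      ENNReal.toReal_ofReal (div_nonneg (ppWeight_nonneg hq lam i) (Nat.cast_nonneg N)),
      Complex.real_smul]
    push_cast
    rfl
  · intro i _
    exact (MeasureTheory.integrable_dirac (by simp)).smul_measure (by simp)

/-! ### From factorial moments to ordinary moments. -/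

theorem pow_eq_sum_stirlingSecond (k : ℕ) (x : ℂ) :
    x ^ k = ∑ n ∈ Finset.range (k + 1), (Nat.stirlingSecond k n : ℂ) *
      (descPochhammer ℂ n).eval x := by
  induction k with
  | zero => simp
  | succ k ih =>
    have h1 : ∀ n : ℕ, x * (descPochhammer ℂ n).eval x =
        (descPochhammer ℂ (n + 1)).eval x + n * (descPochhammer ℂ n).eval x := by
      intro n
      rw [descPochhammer_succ_right]
      simp only [eval_mul, eval_sub, eval_X, eval_natCast]
      ring
    have h2 : ∑ n ∈ Finset.range (k + 1), (n : ℂ) * Nat.stirlingSecond k n *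
        (descPochhammer ℂ n).eval x = ∑ n ∈ Finset.range (k + 1), ((n : ℂ) + 1) *
          Nat.stirlingSecond k (n + 1) * (descPochhammer ℂ (n + 1)).eval x := by
      have h3 := Finset.sum_range_succ (fun n : ℕ => (n : ℂ) * Nat.stirlingSecond k n *
        (descPochhammer ℂ n).eval x) (k + 1)
      rw [Nat.stirlingSecond_eq_zero_of_lt (Nat.lt_succ_self k), Finset.sum_range_succ'] at h3
      simpa using h3.symm
    rw [pow_succ', ih, Finset.mul_sum, Finset.sum_range_succ' _ (k + 1), Nat.stirlingSecond_succ_zero]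
    simp only [Nat.cast_zero, zero_mul, add_zero, Nat.stirlingSecond_succ_succ]
    calc ∑ n ∈ Finset.range (k + 1), x * ((Nat.stirlingSecond k n : ℂ) *
          (descPochhammer ℂ n).eval x)
        = ∑ n ∈ Finset.range (k + 1), (Nat.stirlingSecond k n : ℂ) *
            (descPochhammer ℂ (n + 1)).eval x + ∑ n ∈ Finset.range (k + 1),
            (n : ℂ) * Nat.stirlingSecond k n * (descPochhammer ℂ n).eval x := by
          rw [← Finset.sum_add_distrib]
          refine Finset.sum_congr rfl fun n _ => ?_
          rw [mul_left_comm, h1]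
          ring
      _ = _ := by
          rw [h2, ← Finset.sum_add_distrib]
          refine Finset.sum_congr rfl fun n _ => ?_
          push_cast
          ring

/-- The expected moment of order `k`, in terms of the operator values. -/
noncomputable def momentOf (T : ℕ → ℂ) (N k : ℕ) : ℂ :=
  ((N : ℂ)⁻¹) ^ (k + 1) * ∑ n ∈ Finset.range (k + 1), (Nat.stirlingSecond k n : ℂ) * T n

theorem hasSum_ppIntegral {N : ℕ} {ρ : PMF (Signature N)} {q : ℝ} (hq : q ∈ Set.Icc (-1 : ℝ) 1)
    {T : ℕ → ℂ} (hT : ∀ n, HasSum (fun lam => ((ρ lam).toReal : ℂ) * ∑ i,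
      (descPochhammer ℂ n).eval (lam.shifted i : ℂ) * (ppWeight q lam i : ℂ)) (T n)) (P : ℂ[X]) :
    HasSum (fun lam => ((ρ lam).toReal : ℂ) * ppIntegral q lam P)
      (P.sum fun k c => c * momentOf T N k) := by
  have h1 : HasSum (fun lam => ∑ k ∈ P.support, P.coeff k * (((N : ℂ)⁻¹) ^ (k + 1) *
      ∑ n ∈ Finset.range (k + 1), (Nat.stirlingSecond k n : ℂ) * (((ρ lam).toReal : ℂ) * ∑ i,
        (descPochhammer ℂ n).eval (lam.shifted i : ℂ) * (ppWeight q lam i : ℂ))))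
      (P.sum fun k c => c * momentOf T N k) :=
    hasSum_sum fun k _ => ((hasSum_sum fun n _ => (hT n).mul_left _).mul_left _).mul_left _
  convert h1 using 2 with lam
  have h2 : ∀ k, ∑ n ∈ Finset.range (k + 1), (Nat.stirlingSecond k n : ℂ) *
      (((ρ lam).toReal : ℂ) * ∑ i,
        (descPochhammer ℂ n).eval (lam.shifted i : ℂ) * (ppWeight q lam i : ℂ)) =
      ((ρ lam).toReal : ℂ) * ∑ i, (lam.shifted i : ℂ) ^ k * (ppWeight q lam i : ℂ) := by
    intro k
    simp only [pow_eq_sum_stirlingSecond k, Finset.mul_sum, Finset.sum_mul]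
    rw [Finset.sum_comm]
    refine Finset.sum_congr rfl fun i _ => Finset.sum_congr rfl fun n _ => ?_
    ring
  simp only [h2]
  simp only [ppIntegral_eq_sum hq, eval_eq_sum, Polynomial.sum, Finset.mul_sum]
  rw [Finset.sum_comm]
  refine Finset.sum_congr rfl fun k _ => Finset.sum_congr rfl fun i _ => ?_
  rw [div_pow]
  ring

theorem HasExpansion.exists_inv_pow (p : ℕ) :
    ∃ a b, HasExpansion (fun N => ((N : ℂ)⁻¹) ^ p) a b := by
  induction p with
  | zero => exact ⟨1, 0, by simpa using HasExpansion.const 1⟩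
  | succ p ih =>
    obtain ⟨a, b, h⟩ := ih
    exact ⟨_, _, by simpa only [pow_succ] using h.mul HasExpansion.inv⟩

/-- The operator value of order n has size N^{n+1}, so under the normalization N^{-k-1} only n = k
and n = k - 1 reach order 1/N; their Stirling numbers are 1 and binom(k,2). -/
theorem hasExpansion_momentOf {T : ℕ → ℕ → ℂ} {L C : ℕ → ℂ}
    (h : ∀ n, HasExpansion (fun N => ((N : ℂ)⁻¹) ^ (n + 1) * T N n) (L n) (C n)) (k : ℕ) :
    HasExpansion (fun N => momentOf (T N) N k) (L k) (C k + k.choose 2 * L (k - 1)) := by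
  -- For k = 0 the index k - 1 is truncated to 0, but its coefficient binom(0,2) vanishes.
  rcases k with _ | k
  · simpa [momentOf] using h 0
  · have hlow : ∀ n ∈ Finset.range k, HasExpansion (fun N => (Nat.stirlingSecond (k + 1) n : ℂ) *
        (((N : ℂ)⁻¹) ^ (k - 1 - n) * ((N : ℂ)⁻¹ * ((N : ℂ)⁻¹ *
          (((N : ℂ)⁻¹) ^ (n + 1) * T N n))))) 0 0 := by
      intro n _
      obtain ⟨a, b, hab⟩ := HasExpansion.exists_inv_pow (k - 1 - n)
      simpa using (hab.mul (h n).inv_mul.inv_mul).const_mul (Nat.stirlingSecond (k + 1) n : ℂ)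
    have h1 := ((HasExpansion.sum (Finset.range k) (a := fun _ => 0) (b := fun _ => 0) hlow).add ((h k).inv_mul.const_mul
      (Nat.stirlingSecond (k + 1) k : ℂ))).add (h (k + 1))
    rw [Nat.stirlingSecond_succ_self_left] at h1
    simp only [Finset.sum_const_zero, mul_zero, zero_add] at h1
    rw [add_comm (C (k + 1)), Nat.add_sub_cancel]
    refine h1.congr' (Eventually.of_forall fun N => ?_)
    simp only [momentOf]
    rw [Finset.sum_range_succ, Finset.sum_range_succ, Nat.stirlingSecond_self,
      Nat.stirlingSecond_succ_self_left, mul_add, mul_add, Finset.mul_sum, Nat.cast_one]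
    congr 1
    congr 1
    · refine Finset.sum_congr rfl fun n hn => ?_
      have e : k + 1 + 1 = (k - 1 - n) + 1 + 1 + (n + 1) := by
        have := Finset.mem_range.1 hn
        omega
      rw [e]
      ring
    · ring
    · ring

/-- The linear functional on polynomials with given moments. -/
noncomputable def functionalOfMoments (μ : ℕ → ℂ) : ℂ[X] →ₗ[ℂ] ℂ :=
  Polynomial.lsum fun k => LinearMap.toSpanSingleton ℂ ℂ (μ k)

theorem functionalOfMoments_apply (μ : ℕ → ℂ) (P : ℂ[X]) :
    functionalOfMoments μ P = P.sum fun k c => c * μ k := rfl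

theorem functionalOfMoments_X_pow (μ : ℕ → ℂ) (k : ℕ) : functionalOfMoments μ (X ^ k) = μ k := by
  rw [functionalOfMoments_apply, ← monomial_one_right_eq_X_pow,
    sum_monomial_index _ _ (by simp), one_mul]

theorem isInfinitesimalLimit_of_hasExpansion {φN : ℕ → ℂ[X] → ℂ} {M : ℕ → ℕ → ℂ} {μ μ' : ℕ → ℂ}
    (hφ : ∀ N P, φN N P = P.sum fun k c => c * M N k)
    (h : ∀ k, HasExpansion (fun N => M N k) (μ k) (μ' k)) :
    IsInfinitesimalLimit φN (functionalOfMoments μ) (functionalOfMoments μ') := by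
  have key : ∀ P, HasExpansion (fun N => φN N P) (functionalOfMoments μ P)
      (functionalOfMoments μ' P) := by
    intro P
    simp only [hφ, functionalOfMoments_apply, Polynomial.sum]
    exact HasExpansion.sum _ fun k _ => (h k).const_mul _
  exact ⟨fun P => (key P).tendsto, key⟩

theorem theorem2
    (ρ : ∀ N : ℕ, PMF (Signature N))
    (hρ : ∀ N, SchurGenConverges (ρ N))
    (a b : ℕ → ℂ)
    (hpure : ∀ i k : ℕ, 1 ≤ k →
      Tendsto (fun N : ℕ => logSchurDeriv (ρ N) (fun _ : Fin k => i) - N * a k) atTop (𝓝 (b k)))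
    (hmixed : ∀ (m : ℕ) (i : Fin m → ℕ), 2 ≤ (Set.range i).ncard →
      Tendsto (fun N : ℕ => logSchurDeriv (ρ N) i) atTop (𝓝 0))
    (hΨ : TaylorOneConverges a) (hΦ : TaylorOneConverges b) :
    (∀ q ∈ Set.Icc (-1 : ℝ) 1, ∀ (N : ℕ) (P : ℂ[X]),
      Summable fun lam : Signature N => ((ρ N lam).toReal : ℂ) * ppIntegral q lam P) ∧
    ∃ φ φ' : ℝ → ℂ[X] →ₗ[ℂ] ℂ, ∀ q ∈ Set.Icc (-1 : ℝ) 1,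
      IsInfinitesimalLimit (fun N P => ppExpect q (ρ N) P) (φ q) (φ' q) ∧
      (∀ k : ℕ, φ q (X ^ k) = limitMoment (taylorOne a) q k) ∧
      (∀ k : ℕ, φ' q (X ^ k) = infinitesimalMoment (taylorOne a) (taylorOne b) q k) ∧
      ∀ᶠ z in 𝓝 (0 : ℂ),
        Summable (fun k : ℕ => φ 0 (X ^ k) * z ^ (k + 1)) ∧
        Summable (fun k : ℕ => φ' 0 (X ^ k) * z ^ (k + 1)) ∧
        Summable (fun k : ℕ => φ' q (X ^ k) * z ^ (k + 1)) ∧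
        Summable (fun k : ℕ => ((k : ℂ) + 1) * φ 0 (X ^ k) * z ^ (k + 2)) ∧
        Complex.exp (q * ∑' k : ℕ, φ 0 (X ^ k) * z ^ (k + 1)) *
            (∑' k : ℕ, φ' q (X ^ k) * z ^ (k + 1)) =
          (∑' k : ℕ, φ' 0 (X ^ k) * z ^ (k + 1)) +
            (q : ℂ) / 2 * (∑' k : ℕ, ((k : ℂ) + 1) * φ 0 (X ^ k) * z ^ (k + 2)) := by
  choose T hT hTsum using fun (N n : ℕ) (q : ℝ) => (hρ N).exists_hasSum n q
  have hsum : ∀ q ∈ Set.Icc (-1 : ℝ) 1, ∀ (N : ℕ) (P : ℂ[X]),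
      HasSum (fun lam : Signature N => ((ρ N lam).toReal : ℂ) * ppIntegral q lam P)
        (P.sum fun k c => c * momentOf (fun n => T N n q) N k) := fun q hq N P =>
    hasSum_ppIntegral hq (fun n => hTsum N n q) P
  have hΨa := analyticAt_taylorOne hΨ
  have hΦa := analyticAt_taylorOne hΦ
  refine ⟨fun q hq N P => (hsum q hq N P).summable,
    fun q => functionalOfMoments (limitMoment (taylorOne a) q),
    fun q => functionalOfMoments (infinitesimalMoment (taylorOne a) (taylorOne b) q),
    fun q hq => ⟨?_, fun k => functionalOfMoments_X_pow _ k,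
      fun k => functionalOfMoments_X_pow _ k, ?_⟩⟩
  · refine isInfinitesimalLimit_of_hasExpansion
      (fun N P => (hsum q hq N P).tsum_eq) fun k => ?_
    have h := hasExpansion_momentOf (T := fun N n => T N n q)
      (fun n => hasExpansion_diffOpValue hρ hpure hmixed hΨ hΦ n q fun N => hT N n q) k
    -- The correction of the operator value and the Stirling term combine to the stated
    -- infinitesimal moment.
    rwa [← limitMoment_eq_limitValue hΨa, correctionValue_add_limitValue hΨa hΦa] at h
  · simp only [functionalOfMoments_X_pow]
    exact eventually_generating_identity hΨa hΦa q
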